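/- Let $\hat V$ be the total space of $\mathcal O(-1)\oplus\mathcal O(-1)\to\mathbb P^1$, with its two trivializations $(\lambda,u,v)$ and $(\lambda',u',v')$ related by $\lambda'=\lambda^{-1}$, $u'=\lambda u$, $v'=\lambda v$. Let $r(\lambda,u,v)=(1+|\lambda|^2)^{1/3}(|u|^2+|v|^2)^{1/3}$ be the radius function (well defined on $\hat V$), let $\hat T(1)=\{r\le 1\}\subset\hat V$, and for $R>0$ let $S_R(\lambda,u,v)=(\lambda,R^{3/2}u,R^{3/2}v)$. Let $\omega_{FS}=\sqrt{-1}\,\partial\bar\partial\log(1+|\lambda|^2)$. The Riemannian metric of a $(1,1)$-form $\omega$ is $g(\cdot,\cdot)=\omega(\cdot,J\cdot)$. The Candelas–de la Ossa metrics are defined as follows. Let $f$ be a smooth function on $[0,\infty)$ with $x f'(x)^3+6f'(x)^2=1$ for all $x\ge 0$ (the Ricci-flatness equation) and such that $\sqrt{-1}\,\partial\bar\partial f(r^3)+4\omega_{FS}$ is positive definite on $\hat V$. Let $\kappa$ be the constant with $\kappa f(r^3)/r^2\to\frac12$ as $r\to\infty$. Let $\hat g_{co,1}$ be the Riemannian metric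 of $\kappa\big(\sqrt{-1}\,\partial\bar\partial f(r^3)+4\omega_{FS}\big)$, and for $a>0$ let $\hat g_{co,a}=a^2\,S_{a^{-1}}^*\hat g_{co,1}$. Let $\hat d_{co,a}$ be the distance function on $\hat V$ induced by $\hat g_{co,a}$. Let $V_0=\{z\in\mathbb C^4:\sum_i z_i^2=0\}$, with $r(z)=\|z\|^{2/3}$, and let $D_0(1)=\{z\in V_0: r(z)\le 1\}$. Let $g_{co,0}$ be the Riemannian metric of $\frac12\sqrt{-1}\,\partial\bar\partial r^2$ on $V_0\setminus\{0\}$, extended by $0$ to the origin, and let $d_{co,0}(p,q)$ be the infimum of the $g_{co,0}$-lengths of piecewise $C^1$ curves in $V_0$ from $p$ to $q$. Theorem. Such $f$ and $\kappa$ exist. For every such choice, $(\hat T(1),\hat d_{co,a})$ for each $a>0$ and $(D_0(1),d_{co,0})$, each with the restricted distance function, are compact metric spaces, and $(\hat T(1),\hat d_{co,a})$ converges to $(D_0(1),d_{co,0})$ in the Gromov–Hausdorff topology as $a\to0^+$. -/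

import Mathlib

open Set Filter Topology MeasureTheory
open scoped ENNReal ContDiff LinearAlgebra.Projectivization

namespace Conifold

noncomputable section

/-! ### Gromov-Hausdorff classes, piecewise `C¹` curves and the length distance -/

/-- `G`, a point of the Gromov-Hausdorff space (an isometry class of nonempty compact metric
spaces), is the class of the set `X` with the distance function `d`. In particular `d` is then a
finite distance function which turns `X` into a nonempty compact metric space. -/
def IsClassOf (G : GromovHausdorff.GHSpace) (X : Type) (d : X → X → ℝ≥0∞) : Prop :=
  ∃ e : X ≃ G.Rep, ∀ p q : X, edist (e p) (e q) = d p q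

/-- The length `∫₀¹ √(g(ċ, ċ)) dt` of a curve `c : [0,1] → E`, where `g p v` is the value at the
point `p` of the quadratic form `v ↦ g(v, v)` of a metric. -/
def arcLength {E : Type} [NormedAddCommGroup E] [NormedSpace ℝ E]
    (g : E → E → ℝ) (c : ℝ → E) : ℝ≥0∞ :=
  ∫⁻ t in Icc (0 : ℝ) 1, ENNReal.ofReal (√(g (c t) (derivWithin c (Icc 0 1) t)))

/-- Given a class of arcs in `M` (`arc p q ℓ`: there is an arc of length `ℓ` from `p` to `q`),
`PiecewiseArc arc p q L` says that some finite concatenation of arcs leads from `p` to `q` and has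
total length `L`. -/
inductive PiecewiseArc {M : Type} (arc : M → M → ℝ≥0∞ → Prop) : M → M → ℝ≥0∞ → Prop
  | nil (p : M) : PiecewiseArc arc p p 0
  | cons {p q s : M} {ℓ L : ℝ≥0∞} (h : arc p q ℓ) (t : PiecewiseArc arc q s L) :
      PiecewiseArc arc p s (ℓ + L)

/-- The infimum of the lengths of the finite concatenations of arcs from `p` to `q`. -/
def lengthDist {M : Type} (arc : M → M → ℝ≥0∞ → Prop) (p q : M) : ℝ≥0∞ :=
  sInf {L | PiecewiseArc arc p q L}

/-- The quadratic form `v ↦ ω(v, Jv)` at `p` of the real `(1,1)`-form `ω = √-1 ∂∂̄φ`. In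
coordinates this is `2 ∑ φ_{j k̄} v_j v̄_k`, that is, half the sum of the real Hessian of `φ` at
`(v, v)` and at `(Jv, Jv)`. -/
def ddbar {E : Type} [NormedAddCommGroup E] [NormedSpace ℝ E] [Module ℂ E]
    (φ : E → ℝ) (p v : E) : ℝ :=
  (fderiv ℝ (fderiv ℝ φ) p v v +
    fderiv ℝ (fderiv ℝ φ) p (Complex.I • v) (Complex.I • v)) / 2

/-! ### The small resolution `O(-1) ⊕ O(-1) → ℙ¹` -/

/-- The total space of `O(-1) ⊕ O(-1) → ℙ¹`: a line in `ℂ²` with two vectors on it. -/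
@[ext]
structure SmallRes where
  line : ℙ ℂ (Fin 2 → ℂ)
  fst : Fin 2 → ℂ
  snd : Fin 2 → ℂ
  fst_mem : fst ∈ line.submodule
  snd_mem : snd ∈ line.submodule

/-- The point of `ℙ¹` spanned by a nonzero vector `w`, with the vectors `u w` and `v w` on it. -/
def SmallRes.ofVec (w : Fin 2 → ℂ) (hw : w ≠ 0) (u v : ℂ) : SmallRes where
  line := Projectivization.mk ℂ w hw
  fst := u • w
  snd := v • w
  fst_mem := by
    rw [Projectivization.submodule_mk]
    exact Submodule.smul_mem _ _ (Submodule.mem_span_singleton_self w)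
  snd_mem := by
    rw [Projectivization.submodule_mk]
    exact Submodule.smul_mem _ _ (Submodule.mem_span_singleton_self w)

/-- The trivialization over `{[1 : l]}`, with coordinates `(l, u, v)`. -/
def chartU (p : ℂ × ℂ × ℂ) : SmallRes :=
  SmallRes.ofVec ![1, p.1] (fun h => one_ne_zero (congrFun h 0)) p.2.1 p.2.2

/-- The trivialization over `{[l : 1]}`, with coordinates `(l, u, v)`. -/
def chartV (p : ℂ × ℂ × ℂ) : SmallRes :=
  SmallRes.ofVec ![p.1, 1] (fun h => one_ne_zero (congrFun h 1)) p.2.1 p.2.2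

/-- The transition functions between the two trivializations. -/
theorem chartU_eq_chartV (l u v : ℂ) (hl : l ≠ 0) :
    chartU (l, u, v) = chartV (l⁻¹, l * u, l * v) := by
  have key : (![1, l] : Fin 2 → ℂ) = l • ![l⁻¹, 1] := by
    ext i
    fin_cases i <;> simp [hl]
  ext1
  · simp only [chartU, chartV, SmallRes.ofVec]
    rw [Projectivization.mk_eq_mk_iff]
    exact ⟨Units.mk0 l hl, key.symm⟩
  · simp only [chartU, chartV, SmallRes.ofVec]
    rw [key, smul_smul, mul_comm]
  · simp only [chartU, chartV, SmallRes.ofVec]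
    rw [key, smul_smul, mul_comm]

/-- The radius function `r` on the total space. -/
def radius (p : SmallRes) : ℝ :=
  ((∑ i, ‖p.fst i‖ ^ 2) + ∑ i, ‖p.snd i‖ ^ 2) ^ (1 / 3 : ℝ)

/-- The radius function in the coordinates of either trivialization. -/
def coordRadius (p : ℂ × ℂ × ℂ) : ℝ :=
  (1 + ‖p.1‖ ^ 2) ^ (1 / 3 : ℝ) * (‖p.2.1‖ ^ 2 + ‖p.2.2‖ ^ 2) ^ (1 / 3 : ℝ)

theorem radius_chartU (p : ℂ × ℂ × ℂ) : radius (chartU p) = coordRadius p := by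
  rw [coordRadius, ← Real.mul_rpow (by positivity) (by positivity)]
  simp only [radius, chartU, SmallRes.ofVec, Fin.sum_univ_two]
  congr 1
  simp
  ring

theorem radius_chartV (p : ℂ × ℂ × ℂ) : radius (chartV p) = coordRadius p := by
  rw [coordRadius, ← Real.mul_rpow (by positivity) (by positivity)]
  simp only [radius, chartV, SmallRes.ofVec, Fin.sum_univ_two]
  congr 1
  simp
  ring

/-- The tube `{r ≤ R}` around the zero section. -/
def Tube (R : ℝ) : Type := {p : SmallRes // radius p ≤ R}

/-! ### The Candelas-de la Ossa metrics on the small resolution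

The coordinate expressions below are the same in both trivializations. -/

/-- The metric of `√-1 ∂∂̄ f(r³) + 4 ω_FS`, where `ω_FS = √-1 ∂∂̄ log (1 + |l|²)`. -/
def potentialMetric (f : ℝ → ℝ) (p v : ℂ × ℂ × ℂ) : ℝ :=
  ddbar (fun q => f (coordRadius q ^ 3)) p v +
    4 * ddbar (fun q : ℂ × ℂ × ℂ => Real.log (1 + ‖q.1‖ ^ 2)) p v

/-- `f` is a smooth function on `[0,∞)` for which `√-1 ∂∂̄ f(r³) + 4 ω_FS` is a metric and the
differential equation expressing its Ricci-flatness, `x f'³ + 6 f'² = 1`, holds; and `κ` is the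
factor which rescales the leading coefficient `c₀` of `f = c₀ r² + ⋯` (as `r → ∞`) to `1/2`. -/
structure IsCandelasDeLaOssa (f : ℝ → ℝ) (κ : ℝ) : Prop where
  smooth : ContDiffOn ℝ ∞ f (Ici 0)
  pos_def : ∀ p v : ℂ × ℂ × ℂ, v ≠ 0 → 0 < potentialMetric f p v
  ode : ∀ x : ℝ, 0 ≤ x →
    x * derivWithin f (Ici 0) x ^ 3 + 6 * derivWithin f (Ici 0) x ^ 2 = 1
  leading : Tendsto (fun r : ℝ => κ * f (r ^ 3) / r ^ 2) atTop (𝓝 (1 / 2))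

/-- The scaling map `S_R`, in the coordinates of either trivialization. -/
def scaling (R : ℝ) (p : ℂ × ℂ × ℂ) : ℂ × ℂ × ℂ :=
  (p.1, ((R ^ (3 / 2 : ℝ) : ℝ) : ℂ) * p.2.1, ((R ^ (3 / 2 : ℝ) : ℝ) : ℂ) * p.2.2)

/-- The metric `a² S_{1/a}^* g₁`, where `g₁` is `κ` times the metric defined by `f`. -/
def resMetric (f : ℝ → ℝ) (κ a : ℝ) (p v : ℂ × ℂ × ℂ) : ℝ :=
  a ^ 2 * (κ * potentialMetric f (scaling a⁻¹ p) (fderiv ℝ (scaling a⁻¹) p v))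

/-- There is a `C¹` arc of length `ℓ` from `p` to `q` in the domain of a trivialization. -/
def ResArc (f : ℝ → ℝ) (κ a : ℝ) (p q : SmallRes) (ℓ : ℝ≥0∞) : Prop :=
  ∃ (φ : ℂ × ℂ × ℂ → SmallRes) (c : ℝ → ℂ × ℂ × ℂ),
    (φ = chartU ∨ φ = chartV) ∧ ContDiffOn ℝ 1 c (Icc 0 1) ∧
      φ (c 0) = p ∧ φ (c 1) = q ∧ ℓ = arcLength (resMetric f κ a) c

/-- The distance on the total space induced by the metric `resMetric f κ a`: the infimum of the
lengths of piecewise `C¹` curves. -/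
def resDist (f : ℝ → ℝ) (κ a : ℝ) : SmallRes → SmallRes → ℝ≥0∞ :=
  lengthDist (ResArc f κ a)

/-! ### The cone -/

/-- The cone `V₀ = {z ∈ ℂ⁴ | ∑ zᵢ² = 0}`. -/
def Cone : Type := {z : EuclideanSpace ℂ (Fin 4) // ∑ i, z i ^ 2 = 0}

/-- The radius function `r(z) = ‖z‖^(2/3)`. -/
def coneRadius (z : EuclideanSpace ℂ (Fin 4)) : ℝ := ‖z‖ ^ (2 / 3 : ℝ)

/-- The disc `{r ≤ R}` in the cone. -/
def Disc (R : ℝ) : Type := {z : Cone // coneRadius z.1 ≤ R}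

open Classical in
/-- The metric of `½ √-1 ∂∂̄ r²`, extended by `0` to the singular point. Since `V₀ \ {0}` is a
complex submanifold, the form on `V₀ \ {0}` is the restriction to tangent vectors of the form given
by the same potential on `ℂ⁴ \ {0}`. -/
def coneMetric (z v : EuclideanSpace ℂ (Fin 4)) : ℝ :=
  if z = 0 then 0 else 1 / 2 * ddbar (fun w => coneRadius w ^ 2) z v

/-- There is a `C¹` arc of length `ℓ` from `p` to `q` in the cone. -/
def ConeArc (p q : Cone) (ℓ : ℝ≥0∞) : Prop :=
  ∃ c : ℝ → EuclideanSpace ℂ (Fin 4),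
    ContDiffOn ℝ 1 c (Icc 0 1) ∧ (∀ t ∈ Icc (0 : ℝ) 1, ∑ i, c t i ^ 2 = 0) ∧
      c 0 = p.1 ∧ c 1 = q.1 ∧ ℓ = arcLength coneMetric c

/-- The distance on the cone induced by the cone metric: the infimum of the lengths of piecewise
`C¹` curves. -/
def coneDist : Cone → Cone → ℝ≥0∞ :=
  lengthDist ConeArc

end

end Conifold

/-! The contraction of the zero section, `(l, u, v) ↦ (u, lu, v, lv)` up to a unitary change of
coordinates, maps the small resolution onto the cone and is injective away from the apex. Let `s =
r³` be the squared norm of the image point, `N` that of the image of a tangent vector, and `I` the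
squared modulus of the Hermitian product of the two. The substitution `w = 1/f'` turns the
Ricci-flatness equation into `w³ - 6w = x`, whence `f = (3/2)w² - 6 log w + C` and `κ = 1/3`. After
rescaling, the metric with parameter `a` is `hForm W s N I + (8/3)a² fsSq`, where `W³ - 6a²W = s`;
the cone metric is `hForm r s N I` (`IsCandelasDeLaOssa.exists_resMetric_eq`, `coneMetric_eq`).
Since `r² ≤ W² ≤ r² + 6a²`, the two metrics agree on `r ≥ δ` up to the factor `1 + 6a²/δ²`
(`resMetric_coneMetric`).

The region `r ≤ δ` is small in both spaces: its diameter is at most `6δ` in the cone and `6δ + 8a`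
in the resolution, because a radial path has length at most `3r` and the zero section has size of
order `a`. A path is cut at its first and last times in this region. The outer pieces are pushed
down or lifted and their lengths compared; the inner piece is replaced by a bound on the diameter
(`curve_dichotomy`, `le_mul_lengthDist_add`). For `δ = √a` the factor is `1 + 6a` and the additive
error at most `6√a + 8a`. Diameters being bounded, the contraction of the tube onto the disc
distorts distances by an amount tending to `0`, which gives the convergence (`IsClassOf.dist_le`).

For the metric axioms, points are separated by Lipschitz maps into normed spaces, namely
stereographic images of the vector in `ℂ⁴` and of the line. Compactness holds because the tube is
covered by two compact coordinate sets on which the distance is continuous. The cone inherits both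
properties from the resolution through the comparison with small `a`. -/

namespace Conifold

noncomputable section

/-! ### Second derivatives along lines and the form `√-1 ∂∂̄` of a composition -/

theorem fderiv_fderiv_apply_self {E : Type} [NormedAddCommGroup E] [NormedSpace ℝ E]
    {φ : E → ℝ} {p v : E} {γ₁ : ℝ → ℝ} {γ₂ : ℝ} (hφ : ContDiffAt ℝ 2 φ p)
    (h₁ : ∀ᶠ t in 𝓝 (0 : ℝ), HasDerivAt (fun t : ℝ => φ (p + t • v)) (γ₁ t) t)
    (h₂ : HasDerivAt γ₁ γ₂ 0) : fderiv ℝ (fderiv ℝ φ) p v v = γ₂ := by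
  have hline : ∀ t : ℝ, HasDerivAt (fun t : ℝ => p + t • v) v t := fun t => by
    simpa using ((hasDerivAt_id t).smul_const v).const_add p
  have hline0 : Tendsto (fun t : ℝ => p + t • v) (𝓝 0) (𝓝 p) := by
    simpa using (hline 0).continuousAt.tendsto
  have hdiff : ∀ᶠ q in 𝓝 p, DifferentiableAt ℝ φ q :=
    (hφ.eventually (by simp)).mono fun q hq => hq.differentiableAt (by norm_num)
  have heq : (fun t : ℝ => fderiv ℝ φ (p + t • v) v) =ᶠ[𝓝 0] γ₁ := by
    filter_upwards [hline0.eventually hdiff, h₁] with t ht ht₁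
    exact (ht.hasFDerivAt.comp_hasDerivAt t (hline t)).unique ht₁
  have hd : DifferentiableAt ℝ (fderiv ℝ φ) p :=
    (hφ.fderiv_right (m := 1) (by norm_num)).differentiableAt (by norm_num)
  have h0 : HasDerivAt (fun t : ℝ => fderiv ℝ φ (p + t • v)) (fderiv ℝ (fderiv ℝ φ) p v) 0 := by
    have := hd.hasFDerivAt
    exact HasFDerivAt.comp_hasDerivAt_of_eq (0 : ℝ) this (hline 0) (by simp)
  have h0' : HasDerivAt (fun t : ℝ => fderiv ℝ φ (p + t • v) v)
      (fderiv ℝ (fderiv ℝ φ) p v v) 0 := by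
    simpa using h0.clm_apply (hasDerivAt_const (0 : ℝ) v)
  exact (h0'.congr_of_eventuallyEq heq.symm).unique h₂

/-- Degree four suffices because `sqNorm` is a product of two quadratic factors. Derivatives of `f`
are taken within `U` because `f` is only controlled on `[0,∞)`, and `sqNorm` attains the endpoint
`0` on the zero section. -/
theorem fderiv_fderiv_comp {E : Type} [NormedAddCommGroup E] [NormedSpace ℝ E]
    {f f₁ : ℝ → ℝ} {f₂ : ℝ} {U : Set ℝ} {σ : E → ℝ} {p v : E} (hφ : ContDiffAt ℝ 2 (f ∘ σ) p)
    (hU : ∀ᶠ q in 𝓝 p, σ q ∈ U)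
    (hf₁ : ∀ x ∈ U, HasDerivWithinAt f (f₁ x) U x)
    (hf₂ : HasDerivWithinAt f₁ f₂ U (σ p)) {c : Fin 5 → ℝ}
    (hc : ∀ t : ℝ, σ (p + t • v) = c 0 + c 1 * t + c 2 * t ^ 2 + c 3 * t ^ 3 + c 4 * t ^ 4) :
    fderiv ℝ (fderiv ℝ (f ∘ σ)) p v v = f₂ * c 1 ^ 2 + f₁ (σ p) * (2 * c 2) := by
  set S : ℝ → ℝ := fun t => c 0 + c 1 * t + c 2 * t ^ 2 + c 3 * t ^ 3 + c 4 * t ^ 4 with hS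
  set S₁ : ℝ → ℝ := fun t => c 1 + c 2 * (2 * t) + c 3 * (3 * t ^ 2) + c 4 * (4 * t ^ 3) with hS₁
  have hSd : ∀ t, HasDerivAt S (S₁ t) t := fun t => by
    have h := ((((hasDerivAt_const t (c 0)).add ((hasDerivAt_id t).const_mul (c 1))).add
      ((hasDerivAt_pow 2 t).const_mul (c 2))).add ((hasDerivAt_pow 3 t).const_mul (c 3))).add
      ((hasDerivAt_pow 4 t).const_mul (c 4))
    refine h.congr_deriv ?_
    simp [hS₁]
  have hS₁d : HasDerivAt S₁ (2 * c 2) 0 := by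
    have h := (((hasDerivAt_const (0 : ℝ) (c 1)).add
      (((hasDerivAt_id (0 : ℝ)).const_mul 2).const_mul (c 2))).add
      (((hasDerivAt_pow 2 (0 : ℝ)).const_mul 3).const_mul (c 3))).add
      (((hasDerivAt_pow 3 (0 : ℝ)).const_mul 4).const_mul (c 4))
    refine h.congr_deriv ?_
    simp; ring
  have hS0 : S 0 = σ p := by have := hc 0; simp at this; simp [hS, this]
  have hlim : Tendsto (fun t : ℝ => p + t • v) (𝓝 0) (𝓝 p) := by
    have : Continuous fun t : ℝ => p + t • v := by fun_prop
    simpa using this.tendsto 0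
  have hSU : ∀ᶠ t in 𝓝 (0 : ℝ), S t ∈ U := by
    filter_upwards [hlim.eventually hU] with t ht
    simpa [hS, hc t] using ht
  have hcomp : (fun t : ℝ => (f ∘ σ) (p + t • v)) = fun t => f (S t) := by
    funext t; simp [hS, hc t]
  refine fderiv_fderiv_apply_self (γ₁ := fun t => f₁ (S t) * S₁ t) hφ ?_ ?_
  · rw [hcomp]
    filter_upwards [hSU.eventually_nhds] with t ht
    exact (hf₁ _ ht.self_of_nhds).comp_hasDerivAt t (hSd t) ht
  · have h := (HasDerivWithinAt.comp_hasDerivAt_of_eq (0 : ℝ) hf₂ (hSd 0) hSU hS0.symm).mul hS₁d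
    refine h.congr_deriv ?_
    simp [hS₁, hS0]; ring

theorem ddbar_comp {E : Type} [NormedAddCommGroup E] [NormedSpace ℝ E] [Module ℂ E]
    {f f₁ : ℝ → ℝ} {f₂ : ℝ} {U : Set ℝ} {σ : E → ℝ} {p v : E} (hφ : ContDiffAt ℝ 2 (f ∘ σ) p)
    (hU : ∀ᶠ q in 𝓝 p, σ q ∈ U)
    (hf₁ : ∀ x ∈ U, HasDerivWithinAt f (f₁ x) U x)
    (hf₂ : HasDerivWithinAt f₁ f₂ U (σ p)) (c d : Fin 5 → ℝ)
    (hc : ∀ t : ℝ, σ (p + t • v) = c 0 + c 1 * t + c 2 * t ^ 2 + c 3 * t ^ 3 + c 4 * t ^ 4)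
    (hd : ∀ t : ℝ, σ (p + t • (Complex.I • v)) =
      d 0 + d 1 * t + d 2 * t ^ 2 + d 3 * t ^ 3 + d 4 * t ^ 4) :
    ddbar (f ∘ σ) p v = f₂ * (c 1 ^ 2 + d 1 ^ 2) / 2 + f₁ (σ p) * (c 2 + d 2) := by
  rw [ddbar, fderiv_fderiv_comp hφ hU hf₁ hf₂ hc, fderiv_fderiv_comp hφ hU hf₁ hf₂ hd]
  ring

/-! ### The metric of a function of `r³` in coordinates -/

/-- `r³ = (1 + |l|²)(|u|² + |v|²)` in coordinates. -/
def sqNorm (p : ℂ × ℂ × ℂ) : ℝ := (1 + ‖p.1‖ ^ 2) * (‖p.2.1‖ ^ 2 + ‖p.2.2‖ ^ 2)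

theorem coordRadius_cube (p : ℂ × ℂ × ℂ) : coordRadius p ^ 3 = sqNorm p := by
  rw [coordRadius, sqNorm, ← Real.mul_rpow (by positivity) (by positivity), ← Real.rpow_natCast,
    ← Real.rpow_mul (by positivity)]
  norm_num

theorem sqNorm_nonneg (p : ℂ × ℂ × ℂ) : 0 ≤ sqNorm p := by unfold sqNorm; positivity

/-- The squared norm of the image of `v` under the derivative at `p` of the contraction
`(l, u, v) ↦ (u, ul, v, vl)`. -/
def velSq (p v : ℂ × ℂ × ℂ) : ℝ :=
  ‖v.2.1‖ ^ 2 + ‖v.2.1 * p.1 + p.2.1 * v.1‖ ^ 2 + ‖v.2.2‖ ^ 2 + ‖v.2.2 * p.1 + p.2.2 * v.1‖ ^ 2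

/-- The squared modulus of the Hermitian product of the image of `p` under the contraction
`(l, u, v) ↦ (u, ul, v, vl)` and the image of `v` under its derivative at `p`. -/
def velInner (p v : ℂ × ℂ × ℂ) : ℝ :=
  ‖starRingEnd ℂ p.2.1 * v.2.1 + starRingEnd ℂ (p.2.1 * p.1) * (v.2.1 * p.1 + p.2.1 * v.1) +
    starRingEnd ℂ p.2.2 * v.2.2 + starRingEnd ℂ (p.2.2 * p.1) * (v.2.2 * p.1 + p.2.2 * v.1)‖ ^ 2

/-- Half the Fubini-Study metric. -/
def fsSq (p v : ℂ × ℂ × ℂ) : ℝ := ‖v.1‖ ^ 2 / (1 + ‖p.1‖ ^ 2) ^ 2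

/-- A quantitative Cauchy–Schwarz inequality: the defect is exactly `(1 + |l|²)² |u y - v x|²`, with
`x, y` the fibre components of the tangent vector. The term with `fsSq` is what later lets the cone
metric absorb the Fubini–Study summand. -/
theorem velInner_le (p v : ℂ × ℂ × ℂ) :
    sqNorm p ^ 2 * fsSq p v + velInner p v ≤ sqNorm p * velSq p v := by
  obtain ⟨⟨l₁, l₂⟩, ⟨u₁, u₂⟩, ⟨v₁, v₂⟩⟩ := p
  obtain ⟨⟨m₁, m₂⟩, ⟨x₁, x₂⟩, ⟨y₁, y₂⟩⟩ := v
  have hfs : sqNorm (⟨l₁, l₂⟩, ⟨u₁, u₂⟩, ⟨v₁, v₂⟩) ^ 2 *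
      fsSq (⟨l₁, l₂⟩, ⟨u₁, u₂⟩, ⟨v₁, v₂⟩) (⟨m₁, m₂⟩, ⟨x₁, x₂⟩, ⟨y₁, y₂⟩) =
      (u₁ ^ 2 + u₂ ^ 2 + (v₁ ^ 2 + v₂ ^ 2)) ^ 2 * (m₁ ^ 2 + m₂ ^ 2) := by
    have : (1 + (l₁ ^ 2 + l₂ ^ 2)) ≠ 0 := by positivity
    simp only [sqNorm, fsSq, Complex.sq_norm, Complex.normSq_apply, ← sq]
    field_simp
  rw [hfs]
  simp only [sqNorm, velSq, velInner, Complex.sq_norm, Complex.normSq_apply, ← sq, Complex.mul_re,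
    Complex.mul_im, Complex.add_re, Complex.add_im, Complex.conj_re, Complex.conj_im]
  have hQ : 0 ≤ (1 + (l₁ ^ 2 + l₂ ^ 2)) ^ 2 * ((u₁ * y₁ - u₂ * y₂ - (v₁ * x₁ - v₂ * x₂)) ^ 2 +
    (u₁ * y₂ + u₂ * y₁ - (v₁ * x₂ + v₂ * x₁)) ^ 2) := by positivity
  rw [← sub_nonneg]
  refine hQ.trans_eq ?_
  ring

theorem contDiff_sqNorm {n : WithTop ℕ∞} : ContDiff ℝ n sqNorm := by
  unfold sqNorm
  exact (contDiff_const.add (contDiff_fst.norm_sq ℝ)).mul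
    ((contDiff_snd.fst.norm_sq ℝ).add (contDiff_snd.snd.norm_sq ℝ))

theorem ddbar_comp_sqNorm {f f₁ : ℝ → ℝ} {f₂ : ℝ} {p : ℂ × ℂ × ℂ} (hf : ContDiffOn ℝ 2 f (Ici 0))
    (hf₁ : ∀ x ∈ Ici (0 : ℝ), HasDerivWithinAt f (f₁ x) (Ici 0) x)
    (hf₂ : HasDerivWithinAt f₁ f₂ (Ici 0) (sqNorm p)) (v : ℂ × ℂ × ℂ) :
    ddbar (fun q => f (coordRadius q ^ 3)) p v =
      2 * (f₁ (sqNorm p) * velSq p v + f₂ * velInner p v) := by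
  have hφ : (fun q => f (coordRadius q ^ 3)) = f ∘ sqNorm := by
    funext q; simp [coordRadius_cube]
  rw [hφ]
  have hcd : ContDiffAt ℝ 2 (f ∘ sqNorm) p :=
    (hf.comp (s := univ) contDiff_sqNorm.contDiffOn fun q _ => sqNorm_nonneg q).contDiffAt
      univ_mem
  obtain ⟨⟨l₁, l₂⟩, ⟨u₁, u₂⟩, ⟨v₁, v₂⟩⟩ := p
  obtain ⟨⟨m₁, m₂⟩, ⟨x₁, x₂⟩, ⟨y₁, y₂⟩⟩ := v
  -- Along the line in direction `v` the factors of `sqNorm` are `Q0 + Q1 t + Q2 t²` and `T0 + T1 t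
  -- + T2 t²`; the primed linear coefficients belong to the direction `Jv`.
  set Q0 := 1 + (l₁ ^ 2 + l₂ ^ 2) with hQ0
  set Q2 := m₁ ^ 2 + m₂ ^ 2 with hQ2
  set T0 := u₁ ^ 2 + u₂ ^ 2 + (v₁ ^ 2 + v₂ ^ 2) with hT0
  set T2 := x₁ ^ 2 + x₂ ^ 2 + (y₁ ^ 2 + y₂ ^ 2) with hT2
  set Q1 := 2 * (l₁ * m₁ + l₂ * m₂) with hQ1
  set Q1' := 2 * (l₂ * m₁ - l₁ * m₂) with hQ1'
  set T1 := 2 * (u₁ * x₁ + u₂ * x₂ + v₁ * y₁ + v₂ * y₂) with hT1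
  set T1' := 2 * (u₂ * x₁ - u₁ * x₂ + v₂ * y₁ - v₁ * y₂) with hT1'
  rw [ddbar_comp hcd (U := Ici 0)
    (Eventually.of_forall sqNorm_nonneg) hf₁ hf₂
    ![Q0 * T0, Q1 * T0 + Q0 * T1, Q2 * T0 + Q1 * T1 + Q0 * T2, Q2 * T1 + Q1 * T2, Q2 * T2]
    ![Q0 * T0, Q1' * T0 + Q0 * T1', Q2 * T0 + Q1' * T1' + Q0 * T2, Q2 * T1' + Q1' * T2, Q2 * T2]]
  · have h1 : velSq (⟨l₁, l₂⟩, ⟨u₁, u₂⟩, ⟨v₁, v₂⟩) (⟨m₁, m₂⟩, ⟨x₁, x₂⟩, ⟨y₁, y₂⟩) =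
        Q2 * T0 + Q0 * T2 + (Q1 * T1 + Q1' * T1') / 2 := by
      simp only [velSq, Complex.sq_norm, Complex.normSq_apply, ← sq, Complex.mul_re,
        Complex.mul_im, Complex.add_re, Complex.add_im, hQ0, hQ1, hQ2, hQ1', hT0, hT1, hT1', hT2]
      ring
    have h2 : velInner (⟨l₁, l₂⟩, ⟨u₁, u₂⟩, ⟨v₁, v₂⟩) (⟨m₁, m₂⟩, ⟨x₁, x₂⟩, ⟨y₁, y₂⟩) =
        ((Q1 * T0 + Q0 * T1) ^ 2 + (Q1' * T0 + Q0 * T1') ^ 2) / 4 := by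
      simp only [velInner, Complex.sq_norm, Complex.normSq_apply, ← sq, Complex.mul_re,
        Complex.mul_im, Complex.add_re, Complex.add_im, Complex.conj_re, Complex.conj_im,
        hQ0, hQ1, hQ1', hT0, hT1, hT1']
      ring
    rw [h1, h2]
    simp
    ring
  · intro t
    simp [sqNorm, Complex.sq_norm, Complex.normSq_apply, hQ0, hQ1, hQ2, hT0, hT1, hT2]
    ring
  · intro t
    simp [sqNorm, Complex.sq_norm, Complex.normSq_apply, hQ0, hQ1', hQ2, hT0, hT1', hT2]
    ring

theorem ddbar_log_fs (p v : ℂ × ℂ × ℂ) :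
    ddbar (fun q : ℂ × ℂ × ℂ => Real.log (1 + ‖q.1‖ ^ 2)) p v = 2 * fsSq p v := by
  set σ : ℂ × ℂ × ℂ → ℝ := fun q => 1 + ‖q.1‖ ^ 2 with hσ
  have hpos : ∀ q, 0 < σ q := fun q => by positivity
  have hcσ : ContDiff ℝ 2 σ := contDiff_const.add (contDiff_fst.norm_sq ℝ)
  have hcd : ContDiffAt ℝ 2 (Real.log ∘ σ) p := (hcσ.log fun q => (hpos q).ne').contDiffAt
  have := ddbar_comp (v := v) (f₁ := fun x => x⁻¹) (f₂ := -(σ p ^ 2)⁻¹) (U := Ioi 0) hcd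
    (Eventually.of_forall hpos)
    (fun x hx => (Real.hasDerivAt_log (ne_of_gt hx)).hasDerivWithinAt)
    ((hasDerivAt_inv (hpos p).ne').hasDerivWithinAt)
    ![1 + ‖p.1‖ ^ 2, 2 * (p.1.re * v.1.re + p.1.im * v.1.im), ‖v.1‖ ^ 2, 0, 0]
    ![1 + ‖p.1‖ ^ 2, 2 * (p.1.im * v.1.re - p.1.re * v.1.im), ‖v.1‖ ^ 2, 0, 0]
    (fun t => by simp [hσ, Complex.sq_norm, Complex.normSq_apply]; ring)
    (fun t => by simp [hσ, Complex.sq_norm, Complex.normSq_apply]; ring)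
  refine this.trans ?_
  have h0 : σ p ≠ 0 := (hpos p).ne'
  have h1 : (1 + ‖p.1‖ ^ 2) = σ p := rfl
  rw [fsSq, h1]
  have h2 : ‖p.1‖ ^ 2 = σ p - 1 := by simp [hσ]
  have h3 : p.1.re ^ 2 + p.1.im ^ 2 = σ p - 1 := by
    rw [← h2, Complex.sq_norm, Complex.normSq_apply]; ring
  have h4 : ‖v.1‖ ^ 2 = v.1.re ^ 2 + v.1.im ^ 2 := by
    rw [Complex.sq_norm, Complex.normSq_apply]; ring
  simp only [Matrix.cons_val_one, Matrix.cons_val_zero, Matrix.cons_val, h4]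
  field_simp
  linear_combination (-2 * (v.1.re ^ 2 + v.1.im ^ 2)) * h3

/-! ### The Ricci-flatness equation -/

/-- The cubic at `x = r³` squeezes `r² ≤ w² ≤ r² + 6`, so `w²/r² → 1`, while the logarithm and the
constant are negligible against `r²`. -/
theorem tendsto_profile {w : ℝ → ℝ} (hw : ∀ x, 0 ≤ x → 0 < w x) (hx : ∀ x, 0 ≤ x →
    w x ^ 3 - 6 * w x = x) (C : ℝ) :
    Tendsto (fun r : ℝ => (3 / 2 * w (r ^ 3) ^ 2 - 6 * Real.log (w (r ^ 3)) + C) / r ^ 2) atTop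
      (𝓝 (3 / 2)) := by
  have hinv : Tendsto (fun r : ℝ => (r ^ 2)⁻¹) atTop (𝓝 0) :=
    tendsto_inv_atTop_zero.comp (tendsto_pow_atTop (by norm_num))
  have key : ∀ r : ℝ, 0 < r → r ≤ w (r ^ 3) ∧ w (r ^ 3) ^ 2 ≤ r ^ 2 + 6 := by
    intro r hr
    have h1 := hw (r ^ 3) (by positivity)
    have h2 := hx (r ^ 3) (by positivity)
    have h3 : r ≤ w (r ^ 3) := by
      refine le_of_pow_le_pow_left₀ (n := 3) (by norm_num) h1.le ?_
      linarith
    refine ⟨h3, ?_⟩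
    have h4 : w (r ^ 3) * (w (r ^ 3) ^ 2 - 6) ≤ w (r ^ 3) * r ^ 2 := by nlinarith [sq_nonneg r]
    linarith [le_of_mul_le_mul_left h4 h1]
  have hsq : Tendsto (fun r : ℝ => w (r ^ 3) ^ 2 / r ^ 2) atTop (𝓝 1) := by
    refine tendsto_of_tendsto_of_tendsto_of_le_of_le' tendsto_const_nhds
      (h := fun r : ℝ => 1 + 6 * (r ^ 2)⁻¹) (by simpa using (hinv.const_mul 6).const_add 1) ?_ ?_
    · filter_upwards [eventually_gt_atTop 0] with r hr
      rw [le_div_iff₀ (by positivity), one_mul]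
      exact pow_le_pow_left₀ hr.le (key r hr).1 2
    · filter_upwards [eventually_gt_atTop 0] with r hr
      rw [div_le_iff₀ (by positivity)]
      have : (1 + 6 * (r ^ 2)⁻¹) * r ^ 2 = r ^ 2 + 6 := by field_simp
      rw [this]; exact (key r hr).2
  have hlog : Tendsto (fun r : ℝ => Real.log (w (r ^ 3)) / r ^ 2) atTop (𝓝 0) := by
    have hw' : Tendsto (fun r : ℝ => w (r ^ 3)) atTop atTop :=
      tendsto_atTop_mono' _ ((eventually_gt_atTop 0).mono fun r hr => (key r hr).1) tendsto_id
    have h1 : Tendsto (fun r : ℝ => Real.log (w (r ^ 3)) / w (r ^ 3)) atTop (𝓝 0) := by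
      have h := (Real.isLittleO_log_id_atTop.tendsto_div_nhds_zero).comp hw'
      exact h
    have h2 : Tendsto (fun r : ℝ => (w (r ^ 3))⁻¹) atTop (𝓝 0) := tendsto_inv_atTop_zero.comp hw'
    have h3 := (h1.mul h2).mul hsq
    rw [zero_mul, zero_mul] at h3
    refine h3.congr' ?_
    filter_upwards [eventually_gt_atTop 0] with r hr
    have := hw (r ^ 3) (by positivity)
    field_simp
  have h := ((hsq.const_mul (3 / 2)).sub (hlog.const_mul 6)).add (hinv.const_mul C)
  simp only [mul_one, mul_zero, sub_zero, add_zero] at h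
  refine h.congr fun r => ?_
  ring

namespace IsCandelasDeLaOssa

variable {f : ℝ → ℝ} {κ : ℝ}

theorem contDiffOn_deriv (h : IsCandelasDeLaOssa f κ) :
    ContDiffOn ℝ ∞ (derivWithin f (Ici 0)) (Ici 0) :=
  h.smooth.derivWithin (uniqueDiffOn_Ici 0) (by simp)

theorem hasDerivWithinAt (h : IsCandelasDeLaOssa f κ) :
    ∀ x ∈ Ici (0 : ℝ), HasDerivWithinAt f (derivWithin f (Ici 0) x) (Ici 0) x := fun x hx =>
  ((h.smooth.differentiableOn (by simp)) x hx).hasDerivWithinAt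

theorem hasDerivWithinAt_deriv_aux (h : IsCandelasDeLaOssa f κ) {x : ℝ} (hx : 0 ≤ x) :
    HasDerivWithinAt (derivWithin f (Ici 0))
      (derivWithin (derivWithin f (Ici 0)) (Ici 0) x) (Ici 0) x :=
  ((h.contDiffOn_deriv.differentiableOn (by simp)) x hx).hasDerivWithinAt

/-- The equation forbids zeros of `f'`, and positivity of the metric in a fibre direction at the
zero section fixes the sign at `0`; the intermediate value theorem carries the sign along `[0,∞)`.
-/
theorem deriv_pos (h : IsCandelasDeLaOssa f κ) {x : ℝ} (hx : 0 ≤ x) :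
    0 < derivWithin f (Ici 0) x := by
  have h0 : 0 < derivWithin f (Ici 0) 0 := by
    have hp := h.pos_def (0, 0, 0) (0, 1, 0) (by simp)
    have hs : sqNorm (0, 0, 0) = 0 := by simp [sqNorm]
    rw [potentialMetric, ddbar_comp_sqNorm (contDiffOn_infty.mp h.smooth 2)
      h.hasDerivWithinAt
      (h.hasDerivWithinAt_deriv_aux (sqNorm_nonneg _)), ddbar_log_fs, hs] at hp
    simpa [velSq, velInner, fsSq] using hp
  by_contra! hneg
  obtain ⟨y, hy, hy0⟩ := isPreconnected_Ici.intermediate_value (show x ∈ Ici (0 : ℝ) from hx)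
    (self_mem_Ici) h.contDiffOn_deriv.continuousOn ⟨hneg, h0.le⟩
  have := h.ode y hy
  simp [hy0] at this

theorem inv_deriv_cubic (h : IsCandelasDeLaOssa f κ) {x : ℝ} (hx : 0 ≤ x) :
    (derivWithin f (Ici 0) x)⁻¹ ^ 3 - 6 * (derivWithin f (Ici 0) x)⁻¹ = x := by
  have h1 := h.deriv_pos hx
  have h2 := h.ode x hx
  field_simp
  linarith

/-- Implicit differentiation of the equation, followed by cancelling the nonzero factor `f'`. -/
theorem hasDerivWithinAt_deriv (h : IsCandelasDeLaOssa f κ) {x : ℝ} (hx : 0 ≤ x) :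
    HasDerivWithinAt (derivWithin f (Ici 0))
      (-(derivWithin f (Ici 0) x ^ 2 / (3 * x * derivWithin f (Ici 0) x + 12))) (Ici 0) x := by
  have h1 := h.deriv_pos hx
  have hd := h.hasDerivWithinAt_deriv_aux hx
  set y := derivWithin f (Ici 0) x with hy
  set z := derivWithin (derivWithin f (Ici 0)) (Ici 0) x
  have e1 := (((hasDerivWithinAt_id x (Ici 0)).mul (hd.pow 3)).add ((hd.pow 2).const_mul 6))
  have e2 := e1.congr (f₁ := fun _ => (1 : ℝ)) (fun t ht => (by simpa using (h.ode t ht).symm))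
    (by simpa using (h.ode x hx).symm)
  have e3 := (uniqueDiffOn_Ici (0 : ℝ) x hx).eq_deriv _ e2 (hasDerivWithinAt_const x (Ici 0) 1)
  simp only [id, ← hy, Pi.pow_apply] at e3
  norm_num at e3
  refine hd.congr_deriv ?_
  have h3 : 0 < 3 * x * y + 12 := by positivity
  rw [← neg_div, eq_div_iff h3.ne']
  have h4 : y * (z * (3 * x * y + 12) + y ^ 2) = 0 := by linear_combination e3
  have := (mul_eq_zero.mp h4).resolve_left h1.ne'
  linarith

theorem potentialMetric_eq (h : IsCandelasDeLaOssa f κ) (p v : ℂ × ℂ × ℂ) {y : ℝ}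
    (hy : derivWithin f (Ici 0) (sqNorm p) = y) :
    potentialMetric f p v = 2 * (y * velSq p v - y ^ 2 / (3 * sqNorm p * y + 12) * velInner p v) +
      8 * fsSq p v := by
  rw [potentialMetric, ddbar_comp_sqNorm (contDiffOn_infty.mp h.smooth 2)
    h.hasDerivWithinAt (h.hasDerivWithinAt_deriv (sqNorm_nonneg _)), ddbar_log_fs, hy]
  ring

/-- With `w = 1/f'` one has `dx = (3w² - 6) dw`, so `df = (3w - 6/w) dw`. Thus `f` is known up to a
constant and its leading coefficient is `3/2`. -/
theorem kappa_eq (h : IsCandelasDeLaOssa f κ) : κ = 1 / 3 := by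
  set w : ℝ → ℝ := fun x => (derivWithin f (Ici 0) x)⁻¹ with hw
  have hwpos : ∀ x, 0 ≤ x → 0 < w x := fun x hx => inv_pos.mpr (h.deriv_pos hx)
  have hwx : ∀ x, 0 ≤ x → w x ^ 3 - 6 * w x = x := fun x hx => h.inv_deriv_cubic hx
  obtain ⟨C, hC⟩ : ∃ C, ∀ x, 0 ≤ x → f x = 3 / 2 * w x ^ 2 - 6 * Real.log (w x) + C := by
    set g : ℝ → ℝ := fun x => f x - (3 / 2 * w x ^ 2 - 6 * Real.log (w x)) with hg
    have hgd : ∀ x ∈ Ici (0 : ℝ), HasDerivWithinAt g 0 (Ici 0) x := by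
      intro x hx
      have h1 := h.deriv_pos hx
      have hwd := (h.hasDerivWithinAt_deriv hx).inv h1.ne'
      have hd := (h.hasDerivWithinAt x hx).sub
        (((hwd.pow 2).const_mul (3 / 2)).sub ((hwd.log (hwpos x hx).ne').const_mul 6))
      refine hd.congr_deriv ?_
      have h2 := h.ode x hx
      simp only [Pi.inv_apply]
      set y := derivWithin f (Ici 0) x
      have hx' : (0 : ℝ) ≤ x := hx
      have h3 : 0 < 3 * x * y + 12 := by positivity
      norm_num
      field_simp
      linear_combination 3 * h2
    refine ⟨g 0, fun x hx => ?_⟩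
    have := (convex_Ici (0 : ℝ)).is_const_of_fderivWithin_eq_zero (𝕜 := ℝ) (f := g)
      (fun t ht => (hgd t ht).differentiableWithinAt) (fun t ht => by
        rw [(hgd t ht).hasFDerivWithinAt.fderivWithin (uniqueDiffOn_Ici 0 t ht)]
        ext; simp) (x := x) (y := 0) hx self_mem_Ici
    rw [← this]; simp [hg]
  have h1 := (tendsto_profile hwpos hwx C).const_mul κ
  have h2 := h.leading
  have h3 : Tendsto (fun r : ℝ => κ * f (r ^ 3) / r ^ 2) atTop (𝓝 (κ * (3 / 2))) := by
    refine h1.congr' ?_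
    filter_upwards [eventually_gt_atTop 0] with r hr
    rw [hC (r ^ 3) (by positivity)]; ring
  have := tendsto_nhds_unique h2 h3
  linarith

end IsCandelasDeLaOssa

/-! ### The common shape of the metrics -/

/-- With `N` and `I` the squared norm of a tangent vector of the cone and the squared modulus of its
Hermitian product with the position vector of squared norm `s`, this is the Candelas-de la Ossa
metric (up to the Fubini-Study summand) with profile `W`, where `W (W² - 6a²) = s`. For `a = 0`,
that is for `W³ = s`, it is the cone metric. -/
def hForm (W s N I : ℝ) : ℝ := 2 / 3 * (N / W - I / (W * (2 * W ^ 3 + s)))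

section hForm

variable {W R s N I : ℝ}

/-- Splitting into the part Hermitian-orthogonal to the position vector, of squared norm `N - I/s`,
and the radial part, of squared norm `I/s`. Each carries its own weight in `W`, so metrics are
compared weight by weight. -/
theorem hForm_eq (hW : 0 < W) (hs : 0 < s) :
    hForm W s N I =
      2 / 3 * ((s * N - I) / s * (1 / W) + I / s * (2 * W ^ 2 / (2 * W ^ 3 + s))) := by
  unfold hForm
  have : 0 < 2 * W ^ 3 + s := by positivity
  field_simp
  ring

/-- Since `3s ≤ 2W³ + s`, the subtracted term is at most a third of `N / W`. -/
theorem le_hForm (hW : 0 < W) (hs : 0 ≤ s) (hsW : s ≤ W ^ 3) (hN : 0 ≤ N) (hI : I ≤ s * N) :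
    4 / 9 * (N / W) ≤ hForm W s N I := by
  unfold hForm
  have h1 : 0 < 2 * W ^ 3 + s := by positivity
  have h2 : I / (W * (2 * W ^ 3 + s)) ≤ 1 / 3 * (N / W) := by
    rw [div_le_iff₀ (by positivity)]
    have h3 : 1 / 3 * (N / W) * (W * (2 * W ^ 3 + s)) = N * ((2 * W ^ 3 + s) / 3) := by
      field_simp
    rw [h3]
    nlinarith
  linarith

theorem hForm_le_hForm (hR : 0 < R) (hRW : R ≤ W) (hs : R ^ 3 = s) (hI0 : 0 ≤ I)
    (hI : I ≤ s * N) : hForm W s N I ≤ hForm R s N I := by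
  have hW := hR.trans_le hRW
  have hs0 : 0 < s := hs ▸ by positivity
  rw [hForm_eq hW hs0, hForm_eq hR hs0]
  have h1 : (s * N - I) / s * (1 / W) ≤ (s * N - I) / s * (1 / R) :=
    mul_le_mul_of_nonneg_left (one_div_le_one_div_of_le hR hRW)
      (div_nonneg (by linarith) hs0.le)
  have h2 : 2 * W ^ 2 / (2 * W ^ 3 + s) ≤ 2 * R ^ 2 / (2 * R ^ 3 + s) := by
    rw [div_le_div_iff₀ (by positivity) (by positivity), ← hs]
    -- Half the difference of the two sides after clearing denominators; this is the monotonicity of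
    -- the radial weight in `W ≥ R`.
    have : 0 ≤ (W - R) * R ^ 2 * (2 * W ^ 2 - R * W - R ^ 2) := by
      have h3 : 0 ≤ 2 * W ^ 2 - R * W - R ^ 2 := by nlinarith
      have h4 : 0 ≤ W - R := by linarith
      positivity
    nlinarith
  have h3 := mul_le_mul_of_nonneg_left h2 (div_nonneg hI0 hs0.le)
  linarith

/-- Both weights lose at most the factor `ρ`: the orthogonal one is `1/W`, and the radial one equals
`2/(3R)` at `R` and is at least `2/(3W)` at `W`. -/
theorem hForm_le_mul_hForm {ρ : ℝ} (hR : 0 < R) (hRW : R ≤ W) (hW : W ≤ ρ * R) (hs : R ^ 3 = s)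
    (hI0 : 0 ≤ I) (hI : I ≤ s * N) : hForm R s N I ≤ ρ * hForm W s N I := by
  have hW0 := hR.trans_le hRW
  have hs0 : 0 < s := hs ▸ by positivity
  have hsW : s ≤ W ^ 3 := hs ▸ pow_le_pow_left₀ hR.le hRW 3
  have hρ : 0 < ρ := pos_of_mul_pos_left (hW0.trans_le hW) hR.le
  rw [hForm_eq hW0 hs0, hForm_eq hR hs0]
  have h0 : 1 / R ≤ ρ * (1 / W) := by
    rw [mul_one_div, div_le_div_iff₀ hR hW0]; linarith
  have h1 : (s * N - I) / s * (1 / R) ≤ (s * N - I) / s * (ρ * (1 / W)) :=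
    mul_le_mul_of_nonneg_left h0 (div_nonneg (by linarith) hs0.le)
  have h2 : 2 * R ^ 2 / (2 * R ^ 3 + s) ≤ ρ * (2 * W ^ 2 / (2 * W ^ 3 + s)) := by
    have e1 : 2 * R ^ 2 / (2 * R ^ 3 + s) = 2 / 3 * (1 / R) := by rw [← hs]; field_simp; ring
    have e2 : 2 / 3 * (1 / W) ≤ 2 * W ^ 2 / (2 * W ^ 3 + s) := by
      rw [mul_one_div, div_le_div_iff₀ hW0 (by positivity)]
      nlinarith
    rw [e1]
    have := mul_le_mul_of_nonneg_left e2 hρ.le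
    linarith
  have h3 := mul_le_mul_of_nonneg_left h2 (div_nonneg hI0 hs0.le)
  linarith

/-- The orthogonal part alone suffices; the hypothesis on `q` is supplied by `velInner_le`. -/
theorem mul_le_hForm {q : ℝ} (hR : 0 < R) (hs : R ^ 3 = s) (hI0 : 0 ≤ I)
    (hq : s ^ 2 * q + I ≤ s * N) : 2 / 3 * R ^ 2 * q ≤ hForm R s N I := by
  have hs0 : 0 < s := hs ▸ by positivity
  rw [hForm_eq hR hs0]
  have h1 : R ^ 2 * q ≤ (s * N - I) / s * (1 / R) := by
    rw [div_mul_div_comm, le_div_iff₀ (by positivity)]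
    calc R ^ 2 * q * (s * R) = s * R ^ 3 * q := by ring
      _ = s ^ 2 * q := by rw [hs]; ring
      _ ≤ _ := by linarith
  have h2 : 0 ≤ I / s * (2 * R ^ 2 / (2 * R ^ 3 + s)) := by positivity
  linarith

end hForm

theorem velSq_nonneg (p v : ℂ × ℂ × ℂ) : 0 ≤ velSq p v := by unfold velSq; positivity

theorem velInner_nonneg (p v : ℂ × ℂ × ℂ) : 0 ≤ velInner p v := by unfold velInner; positivity

theorem fsSq_nonneg (p v : ℂ × ℂ × ℂ) : 0 ≤ fsSq p v := by unfold fsSq; positivity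

theorem velInner_le_mul (p v : ℂ × ℂ × ℂ) : velInner p v ≤ sqNorm p * velSq p v := by
  have := velInner_le p v
  have := mul_nonneg (sq_nonneg (sqNorm p)) (fsSq_nonneg p v)
  linarith

theorem eq_zero_of_velSq_of_fsSq {p v : ℂ × ℂ × ℂ} (h : velSq p v ≤ 0) (h' : fsSq p v ≤ 0) :
    v = 0 := by
  have h0 := le_antisymm h (velSq_nonneg p v)
  have h1 : v.2.1 = 0 := by
    have : ‖v.2.1‖ ^ 2 ≤ 0 := by
      rw [← h0, velSq]
      have := sq_nonneg ‖v.2.1 * p.1 + p.2.1 * v.1‖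
      have := sq_nonneg ‖v.2.2‖
      have := sq_nonneg ‖v.2.2 * p.1 + p.2.2 * v.1‖
      linarith
    simpa using le_antisymm this (sq_nonneg _)
  have h2 : v.2.2 = 0 := by
    have : ‖v.2.2‖ ^ 2 ≤ 0 := by
      rw [← h0, velSq]
      have := sq_nonneg ‖v.2.1 * p.1 + p.2.1 * v.1‖
      have := sq_nonneg ‖v.2.1‖
      have := sq_nonneg ‖v.2.2 * p.1 + p.2.2 * v.1‖
      linarith
    simpa using le_antisymm this (sq_nonneg _)
  have h3 : v.1 = 0 := by
    have hQ : (0 : ℝ) < (1 + ‖p.1‖ ^ 2) ^ 2 := by positivity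
    have : ‖v.1‖ ^ 2 / (1 + ‖p.1‖ ^ 2) ^ 2 = 0 := le_antisymm h' (fsSq_nonneg p v)
    rw [div_eq_zero_iff] at this
    simpa using this.resolve_right hQ.ne'
  exact Prod.ext h3 (Prod.ext h1 h2)

/-! ### Existence of the potential -/

/-- On `y > 2` the cubic `y³ - 6y` is injective with nonvanishing derivative. Its values there fill
`(-4, ∞)`, which contains `0` in its interior, so the inverse function theorem gives smoothness up
to and including the endpoint `0`. -/
theorem exists_cubic_inverse : ∃ w : ℝ → ℝ, ∀ x, 0 ≤ x →
    2 < w x ∧ w x ^ 3 - 6 * w x = x ∧ ContDiffAt ℝ ∞ w x := by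
  set P : ℝ → ℝ := fun y => y ^ 3 - 6 * y with hP
  have hPc : ContDiff ℝ ∞ P := (contDiff_id.pow 3).sub (contDiff_const.mul contDiff_id)
  have hinj : ∀ y z : ℝ, 2 < y → 2 < z → P y = P z → y = z := by
    intro y z hy hz h
    have h1 : (y - z) * (y ^ 2 + y * z + z ^ 2 - 6) = 0 := by
      simp only [hP] at h; linear_combination h
    have h2 : y ^ 2 + y * z + z ^ 2 - 6 ≠ 0 := by nlinarith
    linarith [(mul_eq_zero.mp h1).resolve_right h2]
  have hex : ∀ x : ℝ, ∃ y : ℝ, -4 < x → 2 < y ∧ P y = x := by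
    intro x
    by_cases hx : -4 < x
    · have hcont : ContinuousOn P (Icc 2 (|x| + 3)) := hPc.continuous.continuousOn
      have hmem : x ∈ Icc (P 2) (P (|x| + 3)) := by
        refine ⟨by norm_num [hP]; linarith, (le_abs_self x).trans ?_⟩
        have := abs_nonneg x
        simp only [hP]
        nlinarith [mul_nonneg this this, mul_nonneg this (mul_nonneg this this)]
      obtain ⟨y, hy, hyx⟩ := intermediate_value_Icc (by linarith [abs_nonneg x]) hcont hmem
      refine ⟨y, fun _ => ⟨lt_of_le_of_ne hy.1 ?_, hyx⟩⟩
      rintro rfl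
      norm_num [hP] at hyx
      linarith
    · exact ⟨0, fun h => absurd h hx⟩
  choose w hw using hex
  refine ⟨w, fun x hx => ?_⟩
  obtain ⟨h2, hwx⟩ := hw x (by linarith)
  refine ⟨h2, hwx, ?_⟩
  have hd : HasDerivAt P (3 * w x ^ 2 - 6) (w x) := by
    refine ((hasDerivAt_pow 3 (w x)).sub ((hasDerivAt_id (w x)).const_mul 6)).congr_deriv ?_
    norm_num
  have hne : 3 * w x ^ 2 - 6 ≠ 0 := by nlinarith
  have hfd := hd.hasFDerivAt_equiv hne
  have hca : ContDiffAt ℝ ∞ P (w x) := hPc.contDiffAt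
  have hn : (∞ : WithTop ℕ∞) ≠ 0 := by simp
  have hloc := hca.to_localInverse hfd hn
  rw [hwx] at hloc
  have hleft : ∀ᶠ y in 𝓝 (w x), w (P y) = y := by
    have hP4 : ∀ᶠ y in 𝓝 (w x), -4 < P y :=
      hPc.continuous.continuousAt.eventually (lt_mem_nhds (by rw [hwx]; linarith))
    filter_upwards [lt_mem_nhds h2, hP4] with y hy hy4
    exact hinj _ _ (hw _ hy4).1 hy (hw _ hy4).2
  have huniq := (hca.hasStrictFDerivAt' hfd hn).localInverse_unique hleft
  rw [hwx] at huniq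
  exact hloc.congr_of_eventuallyEq huniq

/-- The primitive found by integrating `1/w` along the branch of `exists_cubic_inverse`. The `f`
part of the metric is `3 * hForm` and controls `velSq`; the Fubini–Study part handles the directions
along the zero section, where `velSq` degenerates. -/
theorem exists_isCandelasDeLaOssa : ∃ (f : ℝ → ℝ) (κ : ℝ), IsCandelasDeLaOssa f κ := by
  obtain ⟨w, hw⟩ := exists_cubic_inverse
  have hw2 : ∀ x, 0 ≤ x → 2 < w x := fun x hx => (hw x hx).1
  have hwpos : ∀ x, 0 ≤ x → 0 < w x := fun x hx => by linarith [hw2 x hx]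
  have hwx : ∀ x, 0 ≤ x → w x ^ 3 - 6 * w x = x := fun x hx => (hw x hx).2.1
  have hwd : ∀ x ∈ Ici (0 : ℝ), HasDerivWithinAt w (1 / (3 * w x ^ 2 - 6)) (Ici 0) x := by
    intro x hx
    have hd := ((hw x hx).2.2.differentiableAt (by simp)).hasDerivAt.hasDerivWithinAt (s := Ici 0)
    have e1 := (hd.pow 3).sub (hd.const_mul 6)
    have e2 := e1.congr (f₁ := fun t => t) (fun t ht => (hwx t ht).symm) (hwx x hx).symm
    have e3 := (uniqueDiffOn_Ici (0 : ℝ) x hx).eq_deriv _ e2 (hasDerivWithinAt_id x (Ici 0))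
    refine hd.congr_deriv ?_
    have : 0 < 3 * w x ^ 2 - 6 := by nlinarith [hw2 x hx]
    rw [eq_div_iff this.ne']
    norm_num at e3
    linarith
  set f : ℝ → ℝ := fun x => 3 / 2 * w x ^ 2 - 6 * Real.log (w x) with hf
  have hsmooth : ContDiffOn ℝ ∞ f (Ici 0) := by
    have hwc : ContDiffOn ℝ ∞ w (Ici 0) := fun x hx => (hw x hx).2.2.contDiffWithinAt
    exact (contDiffOn_const.mul (hwc.pow 2)).sub
      (contDiffOn_const.mul (hwc.log fun x hx => (hwpos x hx).ne'))
  have hfd : ∀ x ∈ Ici (0 : ℝ), HasDerivWithinAt f (w x)⁻¹ (Ici 0) x := by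
    intro x hx
    have h0 := hwpos x hx
    have hd := (((hwd x hx).pow 2).const_mul (3 / 2)).sub
      (((hwd x hx).log h0.ne').const_mul 6)
    refine hd.congr_deriv ?_
    have : 0 < 3 * w x ^ 2 - 6 := by nlinarith [hw2 x hx]
    norm_num
    field_simp
  have hfd' : ∀ x ∈ Ici (0 : ℝ), derivWithin f (Ici 0) x = (w x)⁻¹ := fun x hx =>
    (hfd x hx).derivWithin (uniqueDiffOn_Ici 0 x hx)
  refine ⟨f, 1 / 3, hsmooth, ?_, ?_, ?_⟩
  · intro p v hv
    have hs := sqNorm_nonneg p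
    have h0 := hwpos _ hs
    have hx := hwx _ hs
    rw [potentialMetric, ddbar_comp_sqNorm (contDiffOn_infty.mp hsmooth 2) hfd
      ((hwd _ hs).inv h0.ne'), ddbar_log_fs]
    have hN := velSq_nonneg p v
    have hq := fsSq_nonneg p v
    have hle := le_hForm h0 hs (by linarith) hN (velInner_le_mul p v)
    have heq : 2 * ((w (sqNorm p))⁻¹ * velSq p v +
        -(1 / (3 * w (sqNorm p) ^ 2 - 6)) / w (sqNorm p) ^ 2 * velInner p v) =
        3 * hForm (w (sqNorm p)) (sqNorm p) (velSq p v) (velInner p v) := by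
      unfold hForm
      have e : w (sqNorm p) * (2 * w (sqNorm p) ^ 3 + sqNorm p) =
          w (sqNorm p) ^ 2 * (3 * w (sqNorm p) ^ 2 - 6) := by
        linear_combination (-w (sqNorm p)) * hx
      have : 0 < 3 * w (sqNorm p) ^ 2 - 6 := by nlinarith [hw2 _ hs]
      rw [e]
      field_simp
      ring
    rw [heq]
    have hNw : 0 ≤ velSq p v / w (sqNorm p) := by positivity
    by_contra! hneg
    refine hv (eq_zero_of_velSq_of_fsSq (p := p) ?_ (by linarith))
    have : velSq p v / w (sqNorm p) ≤ 0 := by linarith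
    rwa [div_le_iff₀ h0, zero_mul] at this
  · intro x hx
    rw [hfd' x hx]
    have := hwpos x hx
    have := hwx x hx
    field_simp
    linarith
  · have h := (tendsto_profile hwpos hwx 0).const_mul (1 / 3)
    norm_num at h
    refine (h.congr fun r => ?_).trans (by norm_num)
    simp only [hf]; ring

/-! ### The rescaled metrics -/

theorem fderiv_scaling (R : ℝ) (p v : ℂ × ℂ × ℂ) : fderiv ℝ (scaling R) p v = scaling R v := by
  have h : IsBoundedLinearMap ℝ (scaling R) := by
    have hl : IsLinearMap ℝ (scaling R) :=
      ⟨fun x y => by simp [scaling, mul_add], fun c x => by simp [scaling, mul_left_comm]⟩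
    exact (LinearMap.toContinuousLinearMap hl.mk').isBoundedLinearMap
  rw [h.fderiv]; rfl

theorem sq_rpow_three_halves {R : ℝ} (hR : 0 ≤ R) : (R ^ (3 / 2 : ℝ)) ^ 2 = R ^ 3 := by
  rw [← Real.rpow_natCast, ← Real.rpow_mul hR, ← Real.rpow_natCast]
  norm_num

theorem sqNorm_scaling {R : ℝ} (hR : 0 ≤ R) (p : ℂ × ℂ × ℂ) :
    sqNorm (scaling R p) = R ^ 3 * sqNorm p := by
  simp only [sqNorm, scaling, norm_mul, mul_pow, Complex.norm_real, Real.norm_eq_abs, sq_abs,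
    sq_rpow_three_halves hR]
  ring

theorem velSq_scaling {R : ℝ} (hR : 0 ≤ R) (p v : ℂ × ℂ × ℂ) :
    velSq (scaling R p) (scaling R v) = R ^ 3 * velSq p v := by
  simp only [velSq, scaling, mul_assoc, ← mul_add, norm_mul, mul_pow, Complex.norm_real,
    Real.norm_eq_abs, sq_abs, sq_rpow_three_halves hR]

theorem velInner_scaling {R : ℝ} (hR : 0 ≤ R) (p v : ℂ × ℂ × ℂ) :
    velInner (scaling R p) (scaling R v) = R ^ 6 * velInner p v := by
  have h : ∀ k : ℝ, ∀ x y z a b c d e : ℂ, ‖starRingEnd ℂ (k * x) * (k * y) +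
      starRingEnd ℂ (k * x * z) * (k * y * z + k * x * a) + starRingEnd ℂ (k * b) * (k * c) +
      starRingEnd ℂ (k * b * z) * (k * c * z + k * b * a)‖ ^ 2 = (k ^ 2) ^ 2 *
      ‖starRingEnd ℂ x * y + starRingEnd ℂ (x * z) * (y * z + x * a) + starRingEnd ℂ b * c +
      starRingEnd ℂ (b * z) * (c * z + b * a)‖ ^ 2 := by
    intro k x y z a b c d e
    rw [← mul_pow]
    congr 1
    have : ((k ^ 2 : ℝ) : ℂ) = (k : ℂ) ^ 2 := by push_cast; ring
    rw [← Real.norm_of_nonneg (sq_nonneg k), ← Complex.norm_real, this, ← norm_mul]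
    congr 1
    simp only [map_mul, Complex.conj_ofReal]
    ring
  simp only [velInner, scaling]
  rw [h _ _ _ _ _ _ _ 0 0, sq_rpow_three_halves hR]
  ring

theorem fsSq_scaling (R : ℝ) (p v : ℂ × ℂ × ℂ) : fsSq (scaling R p) (scaling R v) = fsSq p v := rfl

/-- Here `W = a / f'(s / a³)`. The homogeneities under `scaling` absorb all powers of `a` except in
the cubic for `W` and in the Fubini–Study term, so the dependence on `a` is explicit and formally
becomes the cone at `a = 0`. -/
theorem IsCandelasDeLaOssa.exists_resMetric_eq {f : ℝ → ℝ} {κ : ℝ} (h : IsCandelasDeLaOssa f κ)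
    {a : ℝ} (ha : 0 < a) (p : ℂ × ℂ × ℂ) : ∃ W : ℝ, 0 < W ∧ W * (W ^ 2 - 6 * a ^ 2) = sqNorm p ∧
      ∀ v, resMetric f κ a p v = hForm W (sqNorm p) (velSq p v) (velInner p v) +
        8 / 3 * a ^ 2 * fsSq p v := by
  have hs := sqNorm_nonneg (scaling a⁻¹ p)
  set y := derivWithin f (Ici 0) (sqNorm (scaling a⁻¹ p)) with hy
  have hy0 : 0 < y := h.deriv_pos hs
  have hode := h.ode _ hs
  rw [← hy] at hode
  have hsc := sqNorm_scaling (inv_nonneg.mpr ha.le) p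
  have hsp : sqNorm p = a ^ 3 * sqNorm (scaling a⁻¹ p) := by rw [hsc]; field_simp
  have hW : a / y * ((a / y) ^ 2 - 6 * a ^ 2) = sqNorm p := by
    rw [hsp]
    generalize sqNorm (scaling a⁻¹ p) = x at hode
    field_simp
    linarith
  refine ⟨a / y, by positivity, hW, fun v => ?_⟩
  rw [resMetric, fderiv_scaling, h.potentialMetric_eq _ _ hy.symm, h.kappa_eq,
    velSq_scaling (inv_nonneg.mpr ha.le), velInner_scaling (inv_nonneg.mpr ha.le), fsSq_scaling,
    hForm]
  have h2 : a / y * (2 * (a / y) ^ 3 + sqNorm p) =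
      a ^ 4 / y ^ 2 * (3 * sqNorm (scaling a⁻¹ p) * y + 12) := by
    rw [hsp]
    generalize sqNorm (scaling a⁻¹ p) = x at hode
    field_simp
    linear_combination (-2) * hode
  rw [h2]
  generalize sqNorm (scaling a⁻¹ p) = x at hs
  have h1 : 0 < 3 * x * y + 12 := by positivity
  field_simp

/-! ### The contraction of the zero section -/

/-- The isometric identification of the pairs of vectors in `ℂ²` with the vectors in `ℂ⁴` under
which twice the determinant corresponds to the quadratic form `∑ zᵢ²`. -/
def quadricVec (x y : Fin 2 → ℂ) : EuclideanSpace ℂ (Fin 4) :=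
  ((√2)⁻¹ : ℝ) • !₂[x 0 + y 1, -Complex.I * (x 0 - y 1), y 0 - x 1, -Complex.I * (x 1 + y 0)]

theorem sum_sq_quadricVec (x y : Fin 2 → ℂ) :
    ∑ i, quadricVec x y i ^ 2 = 2 * (x 0 * y 1 - x 1 * y 0) := by
  have h : (((√2)⁻¹ : ℝ) : ℂ) ^ 2 = 1 / 2 := by
    rw [← Complex.ofReal_pow, inv_pow, Real.sq_sqrt (by norm_num)]; norm_num
  simp only [quadricVec, Fin.sum_univ_four, PiLp.smul_apply, Complex.real_smul]
  simp only [Matrix.cons_val_zero, Matrix.cons_val_one, Matrix.cons_val, mul_pow,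
    h, neg_sq, Complex.I_sq]
  ring

theorem inner_quadricVec (x y x' y' : Fin 2 → ℂ) :
    inner ℂ (quadricVec x y) (quadricVec x' y') =
      starRingEnd ℂ (x 0) * x' 0 + starRingEnd ℂ (x 1) * x' 1 + starRingEnd ℂ (y 0) * y' 0 +
        starRingEnd ℂ (y 1) * y' 1 := by
  have h : (((√2)⁻¹ : ℝ) : ℂ) ^ 2 = 1 / 2 := by
    rw [← Complex.ofReal_pow, inv_pow, Real.sq_sqrt (by norm_num)]; norm_num
  simp only [quadricVec, PiLp.inner_apply, Fin.sum_univ_four, PiLp.smul_apply, Complex.real_smul]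
  simp only [Matrix.cons_val_zero, Matrix.cons_val_one, Matrix.cons_val,
    RCLike.inner_apply, map_mul, map_add, map_sub, map_neg, Complex.conj_ofReal, Complex.conj_I]
  linear_combination (2 * (starRingEnd ℂ (x 0) * x' 0 + starRingEnd ℂ (x 1) * x' 1 +
    starRingEnd ℂ (y 0) * y' 0 + starRingEnd ℂ (y 1) * y' 1)) * h - (((√2)⁻¹ : ℝ) : ℂ) ^ 2 *
    ((starRingEnd ℂ (x 0) - starRingEnd ℂ (y 1)) * (x' 0 - y' 1) +
      (starRingEnd ℂ (x 1) + starRingEnd ℂ (y 0)) * (x' 1 + y' 0)) * Complex.I_sq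

theorem norm_sq_quadricVec (x y : Fin 2 → ℂ) :
    ‖quadricVec x y‖ ^ 2 = ‖x 0‖ ^ 2 + ‖x 1‖ ^ 2 + ‖y 0‖ ^ 2 + ‖y 1‖ ^ 2 := by
  have h := inner_quadricVec x y x y
  rw [inner_self_eq_norm_sq_to_K] at h
  simp only [← Complex.normSq_eq_conj_mul_self, Complex.normSq_eq_norm_sq] at h
  apply Complex.ofReal_injective
  simpa using h

/-- The pair of vectors in `ℂ²` corresponding to a vector in `ℂ⁴`. -/
def quadricPair (z : EuclideanSpace ℂ (Fin 4)) : (Fin 2 → ℂ) × (Fin 2 → ℂ) :=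
  (((√2)⁻¹ : ℝ) • ![z 0 + Complex.I * z 1, -z 2 + Complex.I * z 3],
    ((√2)⁻¹ : ℝ) • ![z 2 + Complex.I * z 3, z 0 - Complex.I * z 1])

theorem quadricVec_quadricPair (z : EuclideanSpace ℂ (Fin 4)) :
    quadricVec (quadricPair z).1 (quadricPair z).2 = z := by
  have h : (((√2)⁻¹ : ℝ) : ℂ) ^ 2 = 1 / 2 := by
    rw [← Complex.ofReal_pow, inv_pow, Real.sq_sqrt (by norm_num)]; norm_num
  rw [Complex.ofReal_inv] at h
  ext i
  simp only [quadricVec, quadricPair, PiLp.smul_apply, Complex.real_smul]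
  fin_cases i
  · simp
    linear_combination 2 * z 0 * h
  · simp
    linear_combination 2 * z 1 * h - 2 * z 1 * ((√2 : ℝ) : ℂ)⁻¹ ^ 2 * Complex.I_sq
  · simp
    linear_combination 2 * z 2 * h
  · simp
    linear_combination 2 * z 3 * h - 2 * z 3 * ((√2 : ℝ) : ℂ)⁻¹ ^ 2 * Complex.I_sq

theorem isLinearMap_quadricVec :
    IsLinearMap ℝ fun q : (Fin 2 → ℂ) × (Fin 2 → ℂ) => quadricVec q.1 q.2 := by
  constructor
  · intro a b
    ext i
    fin_cases i <;> simp [quadricVec] <;> ring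
  · intro c a
    ext i
    fin_cases i <;> simp [quadricVec] <;> ring

theorem isLinearMap_quadricPair : IsLinearMap ℝ quadricPair := by
  constructor
  · intro a b
    ext i <;> fin_cases i <;> simp [quadricPair] <;> ring
  · intro c a
    ext i <;> fin_cases i <;> simp [quadricPair] <;> ring

theorem quadricVec_injective {x y x' y' : Fin 2 → ℂ} (h : quadricVec x y = quadricVec x' y') :
    x = x' ∧ y = y' := by
  have h0 : quadricVec (x - x') (y - y') = 0 := by
    have := isLinearMap_quadricVec.map_sub (x, y) (x', y')
    simpa [h] using this
  have h1 := norm_sq_quadricVec (x - x') (y - y')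
  rw [h0] at h1
  simp only [norm_zero, Pi.sub_apply] at h1
  have e : ∀ a b : ℂ, ‖a - b‖ ^ 2 ≤ 0 → a = b := fun a b hab =>
    sub_eq_zero.mp (by simpa using le_antisymm hab (sq_nonneg _))
  have n := fun a b : ℂ => sq_nonneg ‖a - b‖
  constructor <;> ext i <;> fin_cases i <;> refine e _ _ ?_ <;> dsimp <;>
    linarith [n (x 0) (x' 0), n (x 1) (x' 1), n (y 0) (y' 0), n (y 1) (y' 1)]

/-- The vector in `ℂ⁴` corresponding to a point of the small resolution. -/
def SmallRes.vec (P : SmallRes) : EuclideanSpace ℂ (Fin 4) := quadricVec P.fst P.snd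

/-- The two vectors lie on a common line, so their determinant vanishes. -/
theorem SmallRes.mem_cone (P : SmallRes) : ∑ i, P.vec i ^ 2 = 0 := by
  obtain ⟨w, hw⟩ : ∃ w, P.line.submodule = Submodule.span ℂ {w} :=
    ⟨P.line.rep, P.line.submodule_eq⟩
  have h1 := P.fst_mem
  have h2 := P.snd_mem
  rw [hw, Submodule.mem_span_singleton] at h1 h2
  obtain ⟨a, ha⟩ := h1
  obtain ⟨b, hb⟩ := h2
  rw [SmallRes.vec, sum_sq_quadricVec, ← ha, ← hb]
  simp
  ring

/-- The contraction of the zero section. -/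
def SmallRes.contract (P : SmallRes) : Cone := ⟨P.vec, P.mem_cone⟩

theorem norm_sq_vec (P : SmallRes) : ‖P.vec‖ ^ 2 = (∑ i, ‖P.fst i‖ ^ 2) + ∑ i, ‖P.snd i‖ ^ 2 := by
  rw [SmallRes.vec, norm_sq_quadricVec]
  simp [Fin.sum_univ_two]
  ring

theorem coneRadius_vec (P : SmallRes) : coneRadius P.vec = radius P := by
  rw [radius, ← norm_sq_vec, coneRadius, ← Real.rpow_natCast, ← Real.rpow_mul (norm_nonneg _)]
  norm_num

/-- One of the two vectors in `ℂ²` is nonzero and then spans the line. -/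
theorem SmallRes.eq_of_vec_eq {P Q : SmallRes} (h : P.vec = Q.vec) (h0 : P.vec ≠ 0) : P = Q := by
  obtain ⟨h1, h2⟩ := quadricVec_injective h
  have key : ∀ (L : ℙ ℂ (Fin 2 → ℂ)) (x : Fin 2 → ℂ) (hx : x ≠ 0), x ∈ L.submodule →
      L = Projectivization.mk ℂ x hx := by
    intro L x hx hm
    rw [L.submodule_eq, Submodule.mem_span_singleton] at hm
    obtain ⟨a, ha⟩ := hm
    have ha0 : a ≠ 0 := by rintro rfl; exact hx (by simpa using ha.symm)
    conv_lhs => rw [← L.mk_rep]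
    rw [eq_comm, Projectivization.mk_eq_mk_iff]
    exact ⟨Units.mk0 a ha0, ha⟩
  have hline : P.line = Q.line := by
    by_cases hf : P.fst = 0
    · have hs : P.snd ≠ 0 := by
        intro hs
        refine h0 ?_
        have := norm_sq_vec P
        rw [hf, hs] at this
        simpa using this
      rw [key P.line P.snd hs P.snd_mem, key Q.line P.snd hs (h2 ▸ Q.snd_mem)]
    · rw [key P.line P.fst hf P.fst_mem, key Q.line P.fst hf (h1 ▸ Q.fst_mem)]
  exact SmallRes.ext hline h1 h2

theorem hasFDerivAt_vec_two {E : Type} [NormedAddCommGroup E] [NormedSpace ℝ E] {f g : E → ℂ}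
    {f' g' : E →L[ℝ] ℂ} {p : E} (hf : HasFDerivAt f f' p) (hg : HasFDerivAt g g' p) :
    HasFDerivAt (fun q => ![f q, g q]) (ContinuousLinearMap.pi ![f', g']) p := by
  have h : HasFDerivAt (fun q i => ![f, g] i q) (ContinuousLinearMap.pi ![f', g']) p :=
    hasFDerivAt_pi.mpr fun i => by fin_cases i; exacts [hf, hg]
  refine h.congr_of_eventuallyEq (Eventually.of_forall fun q => ?_)
  ext i
  fin_cases i <;> rfl

/-- Because `quadricVec` is unitary, the coordinate quantities entering `hForm` are the
corresponding norms and products in `ℂ⁴`. Both metrics can thus be evaluated on the same `s`, `N`,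
`I`, in either chart. -/
theorem vec_chart {φ : ℂ × ℂ × ℂ → SmallRes} (hφ : φ = chartU ∨ φ = chartV) (p : ℂ × ℂ × ℂ) :
    ‖(φ p).vec‖ ^ 2 = sqNorm p ∧ ∃ D : ℂ × ℂ × ℂ →L[ℝ] EuclideanSpace ℂ (Fin 4),
      HasFDerivAt (fun q => (φ q).vec) D p ∧ ∀ v, ‖D v‖ ^ 2 = velSq p v ∧
        ‖inner ℂ (φ p).vec (D v)‖ ^ 2 = velInner p v := by
  set L := LinearMap.toContinuousLinearMap isLinearMap_quadricVec.mk' with hL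
  have hLa : ∀ x y, L (x, y) = quadricVec x y := fun x y => rfl
  have h1 : HasFDerivAt (𝕜 := ℝ) (fun q : ℂ × ℂ × ℂ => q.1) (ContinuousLinearMap.fst ℝ _ _) p :=
    hasFDerivAt_fst
  have h2 : HasFDerivAt (𝕜 := ℝ) (fun q : ℂ × ℂ × ℂ => q.2.1)
      ((ContinuousLinearMap.fst ℝ _ _).comp (ContinuousLinearMap.snd ℝ _ _)) p :=
    hasFDerivAt_snd.fst
  have h3 : HasFDerivAt (𝕜 := ℝ) (fun q : ℂ × ℂ × ℂ => q.2.2)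
      ((ContinuousLinearMap.snd ℝ _ _).comp (ContinuousLinearMap.snd ℝ _ _)) p :=
    hasFDerivAt_snd.snd
  have h4 := h2.mul h1
  have h5 := h3.mul h1
  rcases hφ with rfl | rfl
  · have e : (fun q => (chartU q).vec) =
        fun q => L (![q.2.1, q.2.1 * q.1], ![q.2.2, q.2.2 * q.1]) := by
      funext q
      rw [hLa, SmallRes.vec]
      congr 1 <;> ext i <;> fin_cases i <;> simp [chartU, SmallRes.ofVec]
    have ep := congrFun e p
    simp only [hLa] at ep
    refine ⟨?_, _, (L.hasFDerivAt.comp p ((hasFDerivAt_vec_two h2 h4).prodMk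
      (hasFDerivAt_vec_two h3 h5))).congr_of_eventuallyEq (Eventually.of_forall (congrFun e)), fun v => ?_⟩
    · rw [ep, norm_sq_quadricVec]
      simp [sqNorm]; ring
    · simp only [ContinuousLinearMap.comp_apply, ContinuousLinearMap.prod_apply, hLa, ep,
        norm_sq_quadricVec, inner_quadricVec]
      simp [velSq, velInner, add_comm, mul_comm]
  · have e : (fun q => (chartV q).vec) =
        fun q => L (![q.2.1 * q.1, q.2.1], ![q.2.2 * q.1, q.2.2]) := by
      funext q
      rw [hLa, SmallRes.vec]
      congr 1 <;> ext i <;> fin_cases i <;> simp [chartV, SmallRes.ofVec]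
    have ep := congrFun e p
    simp only [hLa] at ep
    refine ⟨?_, _, (L.hasFDerivAt.comp p ((hasFDerivAt_vec_two h4 h2).prodMk
      (hasFDerivAt_vec_two h5 h3))).congr_of_eventuallyEq (Eventually.of_forall (congrFun e)), fun v => ?_⟩
    · rw [ep, norm_sq_quadricVec]
      simp [sqNorm]; ring
    · simp only [ContinuousLinearMap.comp_apply, ContinuousLinearMap.prod_apply, hLa, ep,
        norm_sq_quadricVec, inner_quadricVec]
      simp [velSq, velInner]
      constructor
      · ring_nf
      · congr 1
        ring

theorem contDiff_vec_chart {φ : ℂ × ℂ × ℂ → SmallRes} (hφ : φ = chartU ∨ φ = chartV)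
    {n : WithTop ℕ∞} : ContDiff ℝ n fun q => (φ q).vec := by
  set L := LinearMap.toContinuousLinearMap isLinearMap_quadricVec.mk' with hL
  have hLa : ∀ x y, L (x, y) = quadricVec x y := fun x y => rfl
  rcases hφ with rfl | rfl
  · refine L.contDiff.comp (f := fun q => ((chartU q).fst, (chartU q).snd)) ?_
    refine ContDiff.prodMk (contDiff_pi.mpr fun i => ?_) (contDiff_pi.mpr fun i => ?_) <;>
      fin_cases i <;> simp [chartU, SmallRes.ofVec] <;> fun_prop
  · refine L.contDiff.comp (f := fun q => ((chartV q).fst, (chartV q).snd)) ?_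
    refine ContDiff.prodMk (contDiff_pi.mpr fun i => ?_) (contDiff_pi.mpr fun i => ?_) <;>
      fin_cases i <;> simp [chartV, SmallRes.ofVec] <;> fun_prop

/-! ### The cone metric -/

theorem coneRadius_cube (z : EuclideanSpace ℂ (Fin 4)) : coneRadius z ^ 3 = ‖z‖ ^ 2 := by
  rw [coneRadius, ← Real.rpow_natCast, ← Real.rpow_mul (norm_nonneg _), ← Real.rpow_natCast]
  norm_num

theorem coneRadius_pos {z : EuclideanSpace ℂ (Fin 4)} (hz : z ≠ 0) : 0 < coneRadius z :=
  Real.rpow_pos_of_pos (norm_pos_iff.mpr hz) _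

/-- The potential is `s^(2/3)` with `s = ‖z‖²`. The first-order terms along `v` and `Jv` are the
real part and, up to sign, the imaginary part of `⟪z, v⟫`, whose squares add up to `I`. -/
theorem coneMetric_eq {z : EuclideanSpace ℂ (Fin 4)} (hz : z ≠ 0) (v : EuclideanSpace ℂ (Fin 4)) :
    coneMetric z v = hForm (coneRadius z) (‖z‖ ^ 2) (‖v‖ ^ 2) (‖inner ℂ z v‖ ^ 2) := by
  have hR := coneRadius_pos hz
  have hR3 := coneRadius_cube z
  set σ : EuclideanSpace ℂ (Fin 4) → ℝ := fun w => ‖w‖ ^ 2 with hσ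
  have hpos : ∀ w, w ≠ 0 → 0 < σ w := fun w hw => pow_pos (norm_pos_iff.mpr hw) 2
  have hz0 : 0 < σ z := hpos z hz
  have hφ : (fun w => coneRadius w ^ 2) = (fun x : ℝ => x ^ (2 / 3 : ℝ)) ∘ σ := by
    funext w
    simp only [hσ, Function.comp, coneRadius]
    rw [← Real.rpow_natCast, ← Real.rpow_natCast, ← Real.rpow_mul (norm_nonneg _),
      ← Real.rpow_mul (norm_nonneg _)]
    norm_num
  have hcσ : ContDiff ℝ 2 σ := contDiff_id.norm_sq ℂ
  have hcd : ContDiffAt ℝ 2 ((fun x : ℝ => x ^ (2 / 3 : ℝ)) ∘ σ) z :=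
    (Real.contDiffAt_rpow_const_of_ne hz0.ne').comp z hcσ.contDiffAt
  have hd₁ : ∀ x ∈ Ioi (0 : ℝ), HasDerivWithinAt (fun x : ℝ => x ^ (2 / 3 : ℝ))
      (2 / 3 * x ^ (-1 / 3 : ℝ)) (Ioi 0) x := fun x hx => by
    refine (Real.hasDerivAt_rpow_const (Or.inl (ne_of_gt hx))).hasDerivWithinAt.congr_deriv ?_
    norm_num
  have hd₂ : HasDerivWithinAt (fun x : ℝ => 2 / 3 * x ^ (-1 / 3 : ℝ))
      (2 / 3 * (-1 / 3 * σ z ^ (-4 / 3 : ℝ))) (Ioi 0) (σ z) := by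
    refine ((Real.hasDerivAt_rpow_const (Or.inl hz0.ne')).const_mul _).hasDerivWithinAt.congr_deriv
      ?_
    norm_num
  have hexp : ∀ (w : EuclideanSpace ℂ (Fin 4)) (t : ℝ),
      σ (z + t • w) = σ z + 2 * (inner ℂ z w).re * t + ‖w‖ ^ 2 * t ^ 2 := by
    intro w t
    simp only [hσ]
    rw [norm_add_sq (𝕜 := ℂ), norm_smul, mul_pow, Real.norm_eq_abs, sq_abs,
      ← Complex.coe_smul, inner_smul_right]
    simp
    ring
  rw [coneMetric, if_neg hz, hφ, ddbar_comp hcd (U := Ioi 0)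
    (hcσ.continuous.continuousAt.eventually (lt_mem_nhds hz0)) hd₁ hd₂
    ![σ z, 2 * (inner ℂ z v).re, ‖v‖ ^ 2, 0, 0]
    ![σ z, 2 * (inner ℂ z (Complex.I • v)).re, ‖Complex.I • v‖ ^ 2, 0, 0]
    (fun t => by rw [hexp]; simp) (fun t => by rw [hexp]; simp)]
  have e1 : σ z ^ (-1 / 3 : ℝ) = (coneRadius z)⁻¹ := by
    simp only [hσ, coneRadius]
    rw [← Real.rpow_natCast, ← Real.rpow_mul (norm_nonneg _), ← Real.rpow_neg (norm_nonneg _)]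
    norm_num
  have e2 : σ z ^ (-4 / 3 : ℝ) = (coneRadius z ^ 4)⁻¹ := by
    simp only [hσ, coneRadius]
    rw [← Real.rpow_natCast, ← Real.rpow_mul (norm_nonneg _), ← Real.rpow_natCast,
      ← Real.rpow_mul (norm_nonneg _), ← Real.rpow_neg (norm_nonneg _)]
    norm_num
  have e3 : ‖inner ℂ z v‖ ^ 2 = (inner ℂ z v).re ^ 2 + (inner ℂ z v).im ^ 2 := by
    rw [Complex.sq_norm, Complex.normSq_apply]; ring
  rw [e1, e2, e3, ← hR3, hForm]
  simp [norm_smul]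
  field_simp
  ring

/-! ### Comparison of the metrics -/

theorem coneMetric_chart {φ : ℂ × ℂ × ℂ → SmallRes} (hφ : φ = chartU ∨ φ = chartV)
    {p : ℂ × ℂ × ℂ} (hp : (φ p).vec ≠ 0) (v : ℂ × ℂ × ℂ) :
    coneMetric (φ p).vec (fderiv ℝ (fun q => (φ q).vec) p v) =
      hForm (coneRadius (φ p).vec) (sqNorm p) (velSq p v) (velInner p v) := by
  obtain ⟨h1, D, h2, h3⟩ := vec_chart hφ p
  rw [coneMetric_eq hp, h1, h2.fderiv, (h3 v).1, (h3 v).2]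

theorem coneMetric_smul (z : EuclideanSpace ℂ (Fin 4)) (k : ℝ) (v : EuclideanSpace ℂ (Fin 4)) :
    coneMetric z (k • v) = k ^ 2 * coneMetric z v := by
  by_cases hz : z = 0
  · simp [coneMetric, hz]
  · rw [coneMetric_eq hz, coneMetric_eq hz, norm_smul, ← Complex.coe_smul, inner_smul_right,
      norm_mul, Complex.norm_real, mul_pow, mul_pow, Real.norm_eq_abs, sq_abs, hForm, hForm]
    ring

section

variable {f : ℝ → ℝ} {κ a : ℝ}

theorem resMetric_smul (h : IsCandelasDeLaOssa f κ) (ha : 0 < a) (p : ℂ × ℂ × ℂ) (k : ℝ)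
    (v : ℂ × ℂ × ℂ) : resMetric f κ a p (k • v) = k ^ 2 * resMetric f κ a p v := by
  obtain ⟨W, -, -, hW⟩ := h.exists_resMetric_eq ha p
  have h1 : velSq p (k • v) = k ^ 2 * velSq p v := by
    have e : ∀ x y : ℂ, ‖(k : ℂ) * x * p.1 + y * (k * v.1)‖ ^ 2 =
        k ^ 2 * ‖x * p.1 + y * v.1‖ ^ 2 := fun x y => by
      rw [show (k : ℂ) * x * p.1 + y * (k * v.1) = k * (x * p.1 + y * v.1) by ring, norm_mul,
        mul_pow, Complex.norm_real, Real.norm_eq_abs, sq_abs]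
    simp only [velSq, Prod.smul_fst, Prod.smul_snd, Complex.real_smul, e]
    simp only [norm_mul, mul_pow, Complex.norm_real, Real.norm_eq_abs, sq_abs]
    ring
  have h2 : velInner p (k • v) = k ^ 2 * velInner p v := by
    simp only [velInner, Prod.smul_fst, Prod.smul_snd, Complex.real_smul]
    rw [← sq_abs k, ← Real.norm_eq_abs, ← Complex.norm_real, ← mul_pow, ← norm_mul]
    refine congrArg (fun z : ℂ => ‖z‖ ^ 2) ?_
    ring
  have h3 : fsSq p (k • v) = k ^ 2 * fsSq p v := by
    simp only [fsSq, Prod.smul_fst, norm_smul, mul_pow, Real.norm_eq_abs, sq_abs]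
    ring
  rw [hW, hW, h1, h2, h3, hForm, hForm]
  ring

/-- Away from the zero section the metrics are uniformly close to the cone metric. -/
theorem resMetric_coneMetric (h : IsCandelasDeLaOssa f κ) (ha : 0 < a) {δ : ℝ} (hδ : 0 < δ)
    {φ : ℂ × ℂ × ℂ → SmallRes} (hφ : φ = chartU ∨ φ = chartV) {p : ℂ × ℂ × ℂ}
    (hp : δ ≤ coneRadius (φ p).vec) (v : ℂ × ℂ × ℂ) :
    coneMetric (φ p).vec (fderiv ℝ (fun q => (φ q).vec) p v) ≤
        (1 + 6 * a ^ 2 / δ ^ 2) * resMetric f κ a p v ∧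
      resMetric f κ a p v ≤
        (1 + 6 * a ^ 2 / δ ^ 2) * coneMetric (φ p).vec (fderiv ℝ (fun q => (φ q).vec) p v) := by
  have hR : 0 < coneRadius (φ p).vec := hδ.trans_le hp
  have hz : (φ p).vec ≠ 0 := by
    intro h0
    rw [h0, coneRadius, norm_zero, Real.zero_rpow (by norm_num)] at hR
    exact hR.ne rfl
  have hs : coneRadius (φ p).vec ^ 3 = sqNorm p := by
    rw [coneRadius_cube, (vec_chart hφ p).1]
  obtain ⟨W, hW0, hWs, hW⟩ := h.exists_resMetric_eq ha p
  rw [coneMetric_chart hφ hz, hW]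
  set R := coneRadius (φ p).vec
  have hI0 := velInner_nonneg p v
  have hI := velInner_le_mul p v
  have hq0 := fsSq_nonneg p v
  -- The cubic reads `R³ = W³ - 6a²W`; it gives this bound and, after division by `W`, the bound on
  -- `W²` below.
  have hRW : R ≤ W := by
    refine le_of_pow_le_pow_left₀ (n := 3) (by norm_num) hW0.le ?_
    rw [hs, ← hWs]
    have : 0 ≤ W * a ^ 2 := by positivity
    linarith
  have hρ : 1 + 6 * a ^ 2 / R ^ 2 ≤ 1 + 6 * a ^ 2 / δ ^ 2 := by gcongr
  have hρ1 : 1 ≤ 1 + 6 * a ^ 2 / δ ^ 2 := by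
    have : 0 ≤ 6 * a ^ 2 / δ ^ 2 := by positivity
    linarith
  have hWR : W ^ 2 ≤ R ^ 2 + 6 * a ^ 2 := by
    have : W * (W ^ 2 - 6 * a ^ 2) ≤ W * R ^ 2 := by
      rw [hWs, ← hs]
      nlinarith [sq_nonneg R]
    linarith [le_of_mul_le_mul_left this hW0]
  have hWρ : W ≤ (1 + 6 * a ^ 2 / δ ^ 2) * R := by
    refine le_of_sq_le_sq ?_ (by positivity)
    have e : R ^ 2 + 6 * a ^ 2 = (1 + 6 * a ^ 2 / R ^ 2) * R ^ 2 := by field_simp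
    calc W ^ 2 ≤ (1 + 6 * a ^ 2 / R ^ 2) * R ^ 2 := hWR.trans_eq e
      _ ≤ (1 + 6 * a ^ 2 / δ ^ 2) * R ^ 2 := by gcongr
      _ ≤ (1 + 6 * a ^ 2 / δ ^ 2) ^ 2 * R ^ 2 := by
        gcongr
        exact le_self_pow₀ hρ1 (by norm_num)
      _ = _ := by ring
  constructor
  · refine (hForm_le_mul_hForm hR hRW hWρ hs hI0 hI).trans ?_
    have : 0 ≤ 8 / 3 * a ^ 2 * fsSq p v := by positivity
    gcongr
    linarith
  · have h1 := hForm_le_hForm hR hRW hs hI0 hI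
    have h2 := mul_le_hForm hR hs hI0 (velInner_le p v)
    have h3 : 0 ≤ hForm R (sqNorm p) (velSq p v) (velInner p v) := le_trans (by positivity) h2
    -- The Fubini–Study summand is `4a²/R²` times a quantity below the cone metric, hence fits into
    -- the ratio `6a²/δ²`.
    have h4 : 8 / 3 * a ^ 2 * fsSq p v =
        4 * a ^ 2 / R ^ 2 * (2 / 3 * R ^ 2 * fsSq p v) := by field_simp; ring
    have h5 : 4 * a ^ 2 / R ^ 2 * (2 / 3 * R ^ 2 * fsSq p v) ≤ 6 * a ^ 2 / δ ^ 2 *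
        hForm R (sqNorm p) (velSq p v) (velInner p v) := by
      gcongr
      norm_num
    rw [h4]
    linarith

/-- A lower bound for the metrics, with a constant that is bounded for bounded `a`. -/
theorem velSq_le_resMetric (h : IsCandelasDeLaOssa f κ) (ha : 0 < a) (p v : ℂ × ℂ × ℂ) :
    9 * velSq p v / (1 + sqNorm p) ^ 2 ≤ (14 * (1 + a)) ^ 2 * resMetric f κ a p v := by
  obtain ⟨W, hW0, hWs, hW⟩ := h.exists_resMetric_eq ha p
  have hs := sqNorm_nonneg p
  have hN := velSq_nonneg p v
  have hq := fsSq_nonneg p v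
  have hWa : 0 ≤ W * a ^ 2 := by positivity
  have h1 := le_hForm hW0 hs (by linarith) hN (velInner_le_mul p v)
  have h2 : 4 / 9 * (velSq p v / W) ≤ resMetric f κ a p v := by
    rw [hW]
    have : 0 ≤ 8 / 3 * a ^ 2 * fsSq p v := by positivity
    linarith
  have hWle : W ≤ 9 * (1 + a ^ 2) * (1 + sqNorm p) := by
    by_contra! hlt
    set s := sqNorm p
    have h3 : 9 ≤ W := le_trans (by nlinarith [mul_nonneg (sq_nonneg a) hs]) hlt.le
    have h4 : W ^ 2 ≤ s + 6 * a ^ 2 := by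
      nlinarith [mul_nonneg (sub_nonneg.mpr h3) hs]
    nlinarith [mul_nonneg (sq_nonneg a) hs]
  have h5 : 9 * velSq p v / (1 + sqNorm p) ^ 2 ≤
      (14 * (1 + a)) ^ 2 * (4 / 9 * (velSq p v / W)) := by
    have e : (14 * (1 + a)) ^ 2 * (4 / 9 * (velSq p v / W)) =
      (14 * (1 + a)) ^ 2 * 4 * velSq p v / (9 * W) := by field_simp
    rw [e, div_le_div_iff₀ (by positivity) (by positivity)]
    have h6 : 81 * W ≤ (14 * (1 + a)) ^ 2 * 4 * (1 + sqNorm p) ^ 2 := by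
      have h7 : 1 + sqNorm p ≤ (1 + sqNorm p) ^ 2 := le_self_pow₀ (by linarith) (by norm_num)
      -- The constant `14` is the least integer `k` with `4k² ≥ 729`.
      have h8 : 81 * 9 * (1 + a ^ 2) ≤ (14 * (1 + a)) ^ 2 * 4 := by nlinarith
      calc 81 * W ≤ 81 * 9 * (1 + a ^ 2) * (1 + sqNorm p) := by linarith
        _ ≤ (14 * (1 + a)) ^ 2 * 4 * (1 + sqNorm p) ^ 2 := by gcongr
    have := mul_le_mul_of_nonneg_left h6 hN
    linarith
  refine h5.trans ?_
  gcongr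

theorem fsSq_le_resMetric (h : IsCandelasDeLaOssa f κ) (ha : 0 < a) (p v : ℂ × ℂ × ℂ) :
    9 * fsSq p v ≤ (2 / a) ^ 2 * resMetric f κ a p v := by
  obtain ⟨W, hW0, hWs, hW⟩ := h.exists_resMetric_eq ha p
  have hs := sqNorm_nonneg p
  have hN := velSq_nonneg p v
  have hq := fsSq_nonneg p v
  have hWa : 0 ≤ W * a ^ 2 := by positivity
  have h1 := le_hForm hW0 hs (by linarith) hN (velInner_le_mul p v)
  have h2 : 8 / 3 * a ^ 2 * fsSq p v ≤ resMetric f κ a p v := by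
    rw [hW]
    have : 0 ≤ 4 / 9 * (velSq p v / W) := by positivity
    linarith
  calc 9 * fsSq p v ≤ (2 / a) ^ 2 * (8 / 3 * a ^ 2 * fsSq p v) := by
        have : (2 / a) ^ 2 * (8 / 3 * a ^ 2 * fsSq p v) = 32 / 3 * fsSq p v := by
          field_simp; ring
        rw [this]; linarith
    _ ≤ _ := by gcongr

theorem resMetric_le (h : IsCandelasDeLaOssa f κ) (ha : 0 < a) (p v : ℂ × ℂ × ℂ) :
    resMetric f κ a p v ≤ velSq p v / a + 3 * a ^ 2 * ‖v.1‖ ^ 2 := by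
  obtain ⟨W, hW0, hWs, hW⟩ := h.exists_resMetric_eq ha p
  have hs := sqNorm_nonneg p
  have hN := velSq_nonneg p v
  have hI := velInner_nonneg p v
  -- For `W < a` the left side of the cubic would be negative, whereas `sqNorm` is not.
  have haW : a ≤ W := by
    by_contra! hlt
    have : W * (W ^ 2 - 6 * a ^ 2) < 0 := mul_neg_of_pos_of_neg hW0 (by nlinarith)
    linarith
  have h1 : hForm W (sqNorm p) (velSq p v) (velInner p v) ≤ velSq p v / a := by
    have h2 : velSq p v / W ≤ velSq p v / a := by gcongr
    have h3 : 0 ≤ velInner p v / (W * (2 * W ^ 3 + sqNorm p)) := by positivity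
    have h4 : 0 ≤ velSq p v / a := by positivity
    unfold hForm
    linarith
  have h5 : fsSq p v ≤ ‖v.1‖ ^ 2 := by
    refine div_le_self (sq_nonneg _) (one_le_pow₀ ?_)
    linarith [sq_nonneg ‖p.1‖]
  have h6 : 8 / 3 * a ^ 2 * fsSq p v ≤ 3 * a ^ 2 * ‖v.1‖ ^ 2 := by
    have := fsSq_nonneg p v
    gcongr
    norm_num
  rw [hW]
  linarith

end

/-! ### Lengths of curves -/

section Length

variable {E : Type} [NormedAddCommGroup E] [NormedSpace ℝ E]

/-- Stated with `uIcc` so that one change of variables covers both restriction to a subinterval and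
reversal of a curve. -/
theorem arcLength_comp_affine {g : E → E → ℝ} (hg : ∀ p (k : ℝ) v, g p (k • v) = k ^ 2 * g p v)
    {c : ℝ → E} {α β : ℝ} (hαβ : α ≠ β) (hc : ContDiffOn ℝ 1 c (uIcc α β)) :
    arcLength g (fun t => c (α + t * (β - α))) =
      ∫⁻ t in uIcc α β, ENNReal.ofReal (√(g (c t) (derivWithin c (uIcc α β) t))) := by
  set ψ : ℝ → ℝ := fun t => α + t * (β - α) with hψ
  have himg : ψ '' Icc 0 1 = uIcc α β := by
    rw [← segment_eq_uIcc, segment_eq_image']; rfl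
  have hψd : ∀ t, HasDerivAt ψ (β - α) t := fun t =>
    (((hasDerivAt_id t).mul_const (β - α)).const_add α).congr_deriv (by simp)
  have hinj : InjOn ψ (Icc 0 1) := fun x _ y _ hxy => by
    have : (x - y) * (β - α) = 0 := by simp only [hψ] at hxy; linarith
    rcases mul_eq_zero.mp this with h | h
    · linarith
    · exact absurd (by linarith) hαβ
  rw [← himg, lintegral_image_eq_lintegral_abs_deriv_mul measurableSet_Icc
    (fun t _ => (hψd t).hasDerivWithinAt) hinj, himg, arcLength]
  refine setLIntegral_congr_fun measurableSet_Icc fun t ht => ?_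
  have hmem : ψ t ∈ uIcc α β := himg ▸ mem_image_of_mem ψ ht
  have hmaps : MapsTo ψ (Icc 0 1) (uIcc α β) := fun s hs => himg ▸ mem_image_of_mem ψ hs
  have hd := (hc.differentiableOn (by norm_num) (ψ t) hmem).hasDerivWithinAt
  have hd' := (hd.scomp t (hψd t).hasDerivWithinAt hmaps).derivWithin
    (uniqueDiffOn_Icc zero_lt_one t ht)
  have hd'' : derivWithin (fun t => c (ψ t)) (Icc 0 1) t =
      (β - α) • derivWithin c (uIcc α β) (ψ t) := hd'
  simp only [hψ] at hd'' ⊢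
  rw [hd'', hg, Real.sqrt_mul (sq_nonneg _), Real.sqrt_sq_eq_abs,
    ENNReal.ofReal_mul (abs_nonneg _)]

theorem derivWithin_eq_of_Icc_subset {c : ℝ → E} {α β : ℝ} {s : Set ℝ} (hαβ : α < β)
    (hs : Icc α β ⊆ s) (hc : DifferentiableOn ℝ c s) {t : ℝ} (ht : t ∈ Icc α β) :
    derivWithin c (Icc α β) t = derivWithin c s t :=
  ((hc t (hs ht)).hasDerivWithinAt.mono hs).derivWithin (uniqueDiffOn_Icc hαβ t ht)

end Length

section lengthDist

variable {M : Type} {arc : M → M → ℝ≥0∞ → Prop}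

theorem lengthDist_self (p : M) : lengthDist arc p p = 0 :=
  le_antisymm (sInf_le (PiecewiseArc.nil p)) bot_le

theorem lengthDist_le_of_arc {p q : M} {ℓ : ℝ≥0∞} (h : arc p q ℓ) : lengthDist arc p q ≤ ℓ :=
  sInf_le (by simpa using PiecewiseArc.cons h (PiecewiseArc.nil q))

theorem PiecewiseArc.trans {p q s : M} {L L' : ℝ≥0∞} (h : PiecewiseArc arc p q L)
    (h' : PiecewiseArc arc q s L') : PiecewiseArc arc p s (L + L') := by
  induction h with
  | nil p => simpa using h'
  | cons ha _ ih => rw [add_assoc]; exact PiecewiseArc.cons ha (ih h')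

theorem lengthDist_triangle (p q s : M) :
    lengthDist arc p s ≤ lengthDist arc p q + lengthDist arc q s := by
  unfold lengthDist
  rw [ENNReal.sInf_add]
  refine le_iInf₂ fun L hL => ?_
  rw [add_comm, ENNReal.sInf_add]
  refine le_iInf₂ fun L' hL' => ?_
  rw [add_comm]
  exact sInf_le (PiecewiseArc.trans hL hL')

theorem PiecewiseArc.symm (hs : ∀ p q ℓ, arc p q ℓ → arc q p ℓ) {p q : M} {L : ℝ≥0∞}
    (h : PiecewiseArc arc p q L) : PiecewiseArc arc q p L := by
  induction h with
  | nil p => exact .nil p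
  | cons ha _ ih =>
    rw [add_comm]
    refine ih.trans ?_
    simpa using PiecewiseArc.cons (hs _ _ _ ha) (PiecewiseArc.nil _)

theorem lengthDist_comm (hs : ∀ p q ℓ, arc p q ℓ → arc q p ℓ) (p q : M) :
    lengthDist arc p q = lengthDist arc q p :=
  le_antisymm (le_sInf fun _ hL => sInf_le (hL.symm hs)) (le_sInf fun _ hL => sInf_le (hL.symm hs))

end lengthDist

/-! ### Arcs in the two spaces -/

theorem lintegral_Icc_add_Icc (F : ℝ → ℝ≥0∞) {α β γ : ℝ} (h : α ≤ β) (h' : β ≤ γ) :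
    (∫⁻ t in Icc α β, F t) + ∫⁻ t in Icc β γ, F t = ∫⁻ t in Icc α γ, F t := by
  rw [← Measure.restrict_congr_set Ico_ae_eq_Icc, ← Ico_union_Icc_eq_Icc h h',
    lintegral_union measurableSet_Icc]
  exact disjoint_left.mpr fun t ht ht' => absurd ht.2 (not_lt.mpr ht'.1)

section

variable {f : ℝ → ℝ} {κ a : ℝ}

theorem ResArc.symm (h : IsCandelasDeLaOssa f κ) (ha : 0 < a) (P Q : SmallRes) (ℓ : ℝ≥0∞)
    (hPQ : ResArc f κ a P Q ℓ) : ResArc f κ a Q P ℓ := by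
  obtain ⟨φ, c, hφ, hc, h0, h1, hℓ⟩ := hPQ
  refine ⟨φ, fun t => c (1 + t * (0 - 1)), hφ, ?_, by simpa using h1, by simpa using h0, ?_⟩
  · refine hc.comp (by fun_prop) fun t ht => ?_
    constructor <;> linarith [ht.1, ht.2]
  · have := arcLength_comp_affine (resMetric_smul (f := f) (κ := κ) h ha) (c := c)
      one_ne_zero (by simpa using hc)
    rw [hℓ, this, arcLength]
    simp

theorem ConeArc.symm (p q : Cone) (ℓ : ℝ≥0∞) (hpq : ConeArc p q ℓ) : ConeArc q p ℓ := by
  obtain ⟨c, hc, hV, h0, h1, hℓ⟩ := hpq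
  have hmem : ∀ t ∈ Icc (0 : ℝ) 1, 1 + t * (0 - 1) ∈ Icc (0 : ℝ) 1 := fun t ht => by
    constructor <;> linarith [ht.1, ht.2]
  refine ⟨fun t => c (1 + t * (0 - 1)), hc.comp (by fun_prop) hmem, fun t ht => hV _ (hmem t ht),
    by simpa using h1, by simpa using h0, ?_⟩
  have := arcLength_comp_affine coneMetric_smul (c := c) one_ne_zero (by simpa using hc)
  rw [hℓ, this, arcLength]
  simp

theorem resDist_le_lintegral (h : IsCandelasDeLaOssa f κ) (ha : 0 < a)
    {φ : ℂ × ℂ × ℂ → SmallRes} (hφ : φ = chartU ∨ φ = chartV) {c : ℝ → ℂ × ℂ × ℂ} {α β : ℝ}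
    (hαβ : α < β) (hc : ContDiffOn ℝ 1 c (Icc α β)) :
    resDist f κ a (φ (c α)) (φ (c β)) ≤
      ∫⁻ t in Icc α β, ENNReal.ofReal (√(resMetric f κ a (c t) (derivWithin c (Icc α β) t))) := by
  refine lengthDist_le_of_arc
    ⟨φ, fun t => c (α + t * (β - α)), hφ, ?_, by simp, by simp, ?_⟩
  · refine hc.comp (by fun_prop) fun t ht => ?_
    constructor <;> nlinarith [ht.1, ht.2]
  · rw [← uIcc_of_le hαβ.le] at hc ⊢
    exact (arcLength_comp_affine (resMetric_smul h ha) hαβ.ne hc).symm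

theorem coneDist_le_lintegral {c : ℝ → EuclideanSpace ℂ (Fin 4)} {α β : ℝ}
    (hαβ : α < β) (hc : ContDiffOn ℝ 1 c (Icc α β)) (hV : ∀ t ∈ Icc α β, ∑ i, c t i ^ 2 = 0)
    {p q : Cone} (hp : p.1 = c α) (hq : q.1 = c β) :
    coneDist p q ≤
      ∫⁻ t in Icc α β, ENNReal.ofReal (√(coneMetric (c t) (derivWithin c (Icc α β) t))) := by
  have hmem : ∀ t ∈ Icc (0 : ℝ) 1, α + t * (β - α) ∈ Icc α β := fun t ht => by
    constructor <;> nlinarith [ht.1, ht.2]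
  refine lengthDist_le_of_arc ⟨fun t => c (α + t * (β - α)), hc.comp (by fun_prop) hmem,
    fun t ht => hV _ (hmem t ht), by simp [hp], by simp [hq], ?_⟩
  rw [← uIcc_of_le hαβ.le] at hc ⊢
  exact (arcLength_comp_affine coneMetric_smul hαβ.ne hc).symm

end

/-! ### Decomposition of paths at a ball -/

/-- If the curve meets `ϱ ≤ δ`, then `t₀` and `t₁` are its first and last times there; the middle
piece is discarded. The distance `D` and the points `n t` are abstract, and `n` need not be
continuous, so that the same argument serves for pushing down and for lifting. -/
theorem curve_dichotomy {N : Type} {D : N → N → ℝ≥0∞} (hD : ∀ x, D x x = 0) {ϱ : ℝ → ℝ}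
    (hϱ : ContinuousOn ϱ (Icc 0 1)) {δ : ℝ} {F : ℝ → ℝ≥0∞} {n : ℝ → N} {C : ℝ≥0∞}
    (H : ∀ α β, 0 ≤ α → α < β → β ≤ 1 → (∀ t ∈ Icc α β, δ ≤ ϱ t) →
      D (n α) (n β) ≤ C * ∫⁻ t in Icc α β, F t) :
    D (n 0) (n 1) ≤ C * ∫⁻ t in Icc 0 1, F t ∨
      ∃ t₀ ∈ Icc (0 : ℝ) 1, ∃ t₁ ∈ Icc (0 : ℝ) 1, ϱ t₀ ≤ δ ∧ ϱ t₁ ≤ δ ∧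
        D (n 0) (n t₀) + D (n t₁) (n 1) ≤ C * ∫⁻ t in Icc 0 1, F t := by
  -- Degenerate intervals carry no condition, since a curve may start or end strictly inside the
  -- region.
  have H' : ∀ α β, 0 ≤ α → α ≤ β → β ≤ 1 → (α < β → ∀ t ∈ Icc α β, δ ≤ ϱ t) →
      D (n α) (n β) ≤ C * ∫⁻ t in Icc α β, F t := by
    intro α β h0 hαβ h1 h
    rcases hαβ.eq_or_lt with rfl | hlt
    · rw [hD]; exact bot_le
    · exact H α β h0 hlt h1 (h hlt)
  set S : Set ℝ := Icc 0 1 ∩ ϱ ⁻¹' Iic δ with hS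
  by_cases hne : S.Nonempty
  · right
    have hcomp : IsCompact S := by
      refine isCompact_Icc.of_isClosed_subset ?_ inter_subset_left
      exact hϱ.preimage_isClosed_of_isClosed isClosed_Icc isClosed_Iic
    obtain ⟨t₀, ht₀, hmin⟩ := hcomp.exists_isLeast hne
    obtain ⟨t₁, ht₁, hmax⟩ := hcomp.exists_isGreatest hne
    have hle : t₀ ≤ t₁ := hmin ht₁
    have hlt₀ : ∀ t ∈ Icc (0 : ℝ) 1, t < t₀ → δ < ϱ t := fun t ht hlt => by
      by_contra! hcon
      exact absurd (hmin ⟨ht, hcon⟩) (not_le.mpr hlt)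
    have hlt₁ : ∀ t ∈ Icc (0 : ℝ) 1, t₁ < t → δ < ϱ t := fun t ht hlt => by
      by_contra! hcon
      exact absurd (hmax ⟨ht, hcon⟩) (not_le.mpr hlt)
    refine ⟨t₀, ht₀.1, t₁, ht₁.1, ht₀.2, ht₁.2, ?_⟩
    have h1 : D (n 0) (n t₀) ≤ C * ∫⁻ t in Icc 0 t₀, F t := by
      refine H' 0 t₀ le_rfl ht₀.1.1 ht₀.1.2 fun h0 t ht => ?_
      rcases ht.2.eq_or_lt with rfl | hlt
      -- At the first time `ϱ` cannot lie strictly below `δ`: the value `δ` would have been taken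
      -- earlier.
      · by_contra! hcon
        have h00 := hlt₀ 0 ⟨le_rfl, zero_le_one⟩ h0
        obtain ⟨s, hs, hsδ⟩ := intermediate_value_Icc' ht₀.1.1
          (hϱ.mono (Icc_subset_Icc_right ht₀.1.2)) ⟨hcon.le, h00.le⟩
        have : s ∈ S := ⟨⟨hs.1, hs.2.trans ht₀.1.2⟩, hsδ.le⟩
        have hst : s = t := le_antisymm hs.2 (hmin this)
        rw [hst] at hsδ
        exact hcon.ne hsδ
      · exact (hlt₀ t ⟨ht.1, ht.2.trans ht₀.1.2⟩ hlt).le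
    have h2 : D (n t₁) (n 1) ≤ C * ∫⁻ t in Icc t₁ 1, F t := by
      refine H' t₁ 1 ht₁.1.1 ht₁.1.2 le_rfl fun h0 t ht => ?_
      rcases ht.1.eq_or_lt with rfl | hlt
      · by_contra! hcon
        have h00 := hlt₁ 1 ⟨zero_le_one, le_rfl⟩ h0
        obtain ⟨s, hs, hsδ⟩ := intermediate_value_Icc ht₁.1.2
          (hϱ.mono (Icc_subset_Icc_left ht₁.1.1)) ⟨hcon.le, h00.le⟩
        have : s ∈ S := ⟨⟨ht₁.1.1.trans hs.1, hs.2⟩, hsδ.le⟩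
        have hst : s = t₁ := le_antisymm (hmax this) hs.1
        rw [hst] at hsδ
        exact hcon.ne hsδ
      · exact (hlt₁ t ⟨ht₁.1.1.trans ht.1, ht.2⟩ hlt).le
    calc D (n 0) (n t₀) + D (n t₁) (n 1)
        ≤ (C * ∫⁻ t in Icc 0 t₀, F t) + C * ∫⁻ t in Icc t₁ 1, F t := add_le_add h1 h2
      _ ≤ (C * ∫⁻ t in Icc 0 t₀, F t) + C * ∫⁻ t in Icc t₀ 1, F t := by
          gcongr
      _ = C * ∫⁻ t in Icc 0 1, F t := by
          rw [← mul_add, lintegral_Icc_add_Icc F ht₀.1.1 ht₀.1.2]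
  · left
    refine H' 0 1 le_rfl zero_le_one le_rfl fun _ t ht => ?_
    by_contra! hcon
    exact hne ⟨t, ht, hcon.le⟩

section

variable {M N : Type} {arc : M → M → ℝ≥0∞ → Prop} {D : N → N → ℝ≥0∞} {R : M → N → Prop}
  {B : N → Prop} {C : ℝ≥0∞}

/-- `R` is a relation rather than a map because the apex has many lifts; `hnil` says that two lifts
of one point coincide or both lie in the small region `B`. Under concatenation only the first entry
into and the last exit from `B` are kept. -/
theorem PiecewiseArc.dichotomy (hD : ∀ x, D x x = 0) (htri : ∀ x y z, D x z ≤ D x y + D y z)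
    (htot : ∀ m, ∃ n, R m n) (hnil : ∀ m n n', R m n → R m n' → n = n' ∨ B n ∧ B n')
    (harc : ∀ m m' ℓ n n', arc m m' ℓ → R m n → R m' n' → D n n' ≤ C * ℓ ∨
      ∃ x y, B x ∧ B y ∧ D n x + D y n' ≤ C * ℓ) {m m' : M} {L : ℝ≥0∞}
    (h : PiecewiseArc arc m m' L) : ∀ n n', R m n → R m' n' → D n n' ≤ C * L ∨
      ∃ x y, B x ∧ B y ∧ D n x + D y n' ≤ C * L := by
  induction h with
  | nil m =>
    intro n n' hn hn'
    rcases hnil m n n' hn hn' with rfl | ⟨hB, hB'⟩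
    · left; rw [hD]; exact bot_le
    · right; exact ⟨n, n', hB, hB', by rw [hD, hD]; simp⟩
  | @cons m m₁ m' ℓ L ha _ ih =>
    intro n n' hn hn'
    obtain ⟨n₁, hn₁⟩ := htot m₁
    rw [mul_add]
    rcases harc _ _ _ n n₁ ha hn hn₁ with h1 | ⟨x, y, hx, hy, h1⟩ <;>
      rcases ih n₁ n' hn₁ hn' with h2 | ⟨x', y', hx', hy', h2⟩
    · left
      exact (htri _ n₁ _).trans (add_le_add h1 h2)
    · right
      refine ⟨x', y', hx', hy', ?_⟩
      calc D n x' + D y' n' ≤ D n n₁ + D n₁ x' + D y' n' := by gcongr; exact htri _ _ _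
        _ = D n n₁ + (D n₁ x' + D y' n') := add_assoc _ _ _
        _ ≤ _ := add_le_add h1 h2
    · right
      refine ⟨x, y, hx, hy, ?_⟩
      calc D n x + D y n' ≤ D n x + (D y n₁ + D n₁ n') := by gcongr; exact htri _ _ _
        _ = D n x + D y n₁ + D n₁ n' := (add_assoc _ _ _).symm
        _ ≤ _ := add_le_add h1 h2
    -- Both parts meet `B`: the terms from `y` to `n₁` and from `n₁` to `x'` are dropped.
    · right
      refine ⟨x, y', hx, hy', ?_⟩
      calc D n x + D y' n' ≤ (D n x + D y n₁) + (D n₁ x' + D y' n') :=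
            add_le_add le_self_add le_add_self
        _ ≤ _ := add_le_add h1 h2

theorem le_mul_lengthDist_add (hD : ∀ x, D x x = 0) (htri : ∀ x y z, D x z ≤ D x y + D y z)
    (htot : ∀ m, ∃ n, R m n)
    (hnil : ∀ m n n', R m n → R m n' → n = n' ∨ B n ∧ B n')
    (harc : ∀ m m' ℓ n n', arc m m' ℓ → R m n → R m' n' → D n n' ≤ C * ℓ ∨
      ∃ x y, B x ∧ B y ∧ D n x + D y n' ≤ C * ℓ) {ε : ℝ≥0∞} (hB : ∀ x y, B x → B y → D x y ≤ ε)
    (hC0 : C ≠ 0) (hC : C ≠ ⊤) {m m' : M} {n n' : N} (hn : R m n) (hn' : R m' n') :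
    D n n' ≤ C * lengthDist arc m m' + ε := by
  have key : ∀ L, PiecewiseArc arc m m' L → D n n' ≤ C * L + ε := by
    intro L hL
    rcases PiecewiseArc.dichotomy hD htri htot hnil harc hL n n' hn hn'
      with h1 | ⟨x, y, hx, hy, h1⟩
    · exact h1.trans le_self_add
    · calc D n n' ≤ D n x + (D x y + D y n') :=
            (htri _ x _).trans (add_le_add le_rfl (htri _ y _))
        _ = (D n x + D y n') + D x y := by ring
        _ ≤ _ := add_le_add h1 (hB x y hx hy)
  rw [← tsub_le_iff_right, mul_comm, ← ENNReal.div_le_iff hC0 hC]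
  refine le_sInf fun L hL => ?_
  rw [ENNReal.div_le_iff hC0 hC, tsub_le_iff_right, mul_comm]
  exact key L hL

end

/-! ### Lifting curves to the small resolution -/

/-- The squared norm of a column of the matrix corresponding to a vector in `ℂ⁴`. -/
def colSq (j : Fin 2) (z : EuclideanSpace ℂ (Fin 4)) : ℝ :=
  ‖(quadricPair z).1 j‖ ^ 2 + ‖(quadricPair z).2 j‖ ^ 2

/-- The coordinates of the preimage of a point of the cone under the contraction, in the
trivialization in which the column `j` of the matrix is `(u, v)` and the column `i` is
`(lu, lv)`. -/
def liftCoord (i j : Fin 2) (z : EuclideanSpace ℂ (Fin 4)) : ℂ × ℂ × ℂ :=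
  (((quadricPair z).1 i * starRingEnd ℂ ((quadricPair z).1 j) +
    (quadricPair z).2 i * starRingEnd ℂ ((quadricPair z).2 j)) *
    ((quadricPair z).1 j * starRingEnd ℂ ((quadricPair z).1 j) +
      (quadricPair z).2 j * starRingEnd ℂ ((quadricPair z).2 j))⁻¹,
    (quadricPair z).1 j, (quadricPair z).2 j)

theorem colSq_cast (j : Fin 2) (z : EuclideanSpace ℂ (Fin 4)) :
    (quadricPair z).1 j * starRingEnd ℂ ((quadricPair z).1 j) +
      (quadricPair z).2 j * starRingEnd ℂ ((quadricPair z).2 j) = (colSq j z : ℂ) := by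
  rw [Complex.mul_conj, Complex.mul_conj, colSq, Complex.normSq_eq_norm_sq,
    Complex.normSq_eq_norm_sq]
  push_cast
  rfl

theorem contDiff_quadricPair {n : WithTop ℕ∞} : ContDiff ℝ n quadricPair :=
  (LinearMap.toContinuousLinearMap isLinearMap_quadricPair.mk').contDiff

theorem contDiff_quadricPair_fst {n : WithTop ℕ∞} (j : Fin 2) :
    ContDiff ℝ n fun z => (quadricPair z).1 j :=
  contDiff_pi.mp (contDiff_fst.comp contDiff_quadricPair) j

theorem contDiff_quadricPair_snd {n : WithTop ℕ∞} (j : Fin 2) :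
    ContDiff ℝ n fun z => (quadricPair z).2 j :=
  contDiff_pi.mp (contDiff_snd.comp contDiff_quadricPair) j

theorem continuous_colSq (j : Fin 2) : Continuous (colSq j) :=
  ((contDiff_quadricPair_fst (n := 0) j).continuous.norm.pow 2).add
    ((contDiff_quadricPair_snd (n := 0) j).continuous.norm.pow 2)

theorem contDiffAt_liftCoord {n : WithTop ℕ∞} {i j : Fin 2} {z : EuclideanSpace ℂ (Fin 4)}
    (hz : colSq j z ≠ 0) : ContDiffAt ℝ n (liftCoord i j) z := by
  have h1 := fun j => (contDiff_quadricPair_fst (n := n) j).contDiffAt (x := z)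
  have h2 := fun j => (contDiff_quadricPair_snd (n := n) j).contDiffAt (x := z)
  have hconj : ∀ g : EuclideanSpace ℂ (Fin 4) → ℂ, ContDiffAt ℝ n g z →
      ContDiffAt ℝ n (fun z => starRingEnd ℂ (g z)) z := fun g hg =>
    Complex.conjCLE.contDiff.contDiffAt.comp z hg
  have hne : (quadricPair z).1 j * starRingEnd ℂ ((quadricPair z).1 j) +
      (quadricPair z).2 j * starRingEnd ℂ ((quadricPair z).2 j) ≠ 0 := by
    rw [colSq_cast]; exact_mod_cast hz
  refine ContDiffAt.prodMk (ContDiffAt.mul ?_ (ContDiffAt.inv ?_ hne)) ((h1 j).prodMk (h2 j))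
  · exact ((h1 i).mul (hconj _ (h1 j))).add ((h2 i).mul (hconj _ (h2 j)))
  · exact ((h1 j).mul (hconj _ (h1 j))).add ((h2 j).mul (hconj _ (h2 j)))

/-- The columns are proportional because the determinant vanishes, and the factor is recovered as
the Hermitian quotient `⟨col i, col j⟩ / |col j|²`. This is smooth wherever column `j` is nonzero,
without deciding which of its entries is. -/
theorem liftCoord_mul {i j : Fin 2} {z : EuclideanSpace ℂ (Fin 4)} (hz : colSq j z ≠ 0)
    (hV : (quadricPair z).1 i * (quadricPair z).2 j = (quadricPair z).1 j * (quadricPair z).2 i) :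
    (liftCoord i j z).2.1 * (liftCoord i j z).1 = (quadricPair z).1 i ∧
      (liftCoord i j z).2.2 * (liftCoord i j z).1 = (quadricPair z).2 i := by
  have hne : (quadricPair z).1 j * starRingEnd ℂ ((quadricPair z).1 j) +
      (quadricPair z).2 j * starRingEnd ℂ ((quadricPair z).2 j) ≠ 0 := by
    rw [colSq_cast]; exact_mod_cast hz
  simp only [liftCoord]
  constructor
  · rw [← mul_assoc, mul_inv_eq_iff_eq_mul₀ hne]
    linear_combination -(starRingEnd ℂ ((quadricPair z).2 j)) * hV
  · rw [← mul_assoc, mul_inv_eq_iff_eq_mul₀ hne]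
    linear_combination (starRingEnd ℂ ((quadricPair z).1 j)) * hV

theorem quadricPair_mul {z : EuclideanSpace ℂ (Fin 4)} (hz : ∑ i, z i ^ 2 = 0) :
    (quadricPair z).1 0 * (quadricPair z).2 1 = (quadricPair z).1 1 * (quadricPair z).2 0 := by
  have h := sum_sq_quadricVec (quadricPair z).1 (quadricPair z).2
  rw [quadricVec_quadricPair, hz] at h
  linear_combination (-1 / 2 : ℂ) * h

/-- The trivialization in which the column `j` of the matrix is `(u, v)`. -/
def chartOf (j : Fin 2) : ℂ × ℂ × ℂ → SmallRes := if j = 0 then chartU else chartV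

theorem chartOf_eq (j : Fin 2) : chartOf j = chartU ∨ chartOf j = chartV := by
  unfold chartOf; split_ifs <;> simp

theorem vec_chartOf_liftCoord {j : Fin 2} {z : EuclideanSpace ℂ (Fin 4)} (hz : colSq j z ≠ 0)
    (hV : ∑ i, z i ^ 2 = 0) : (chartOf j (liftCoord (1 - j) j z)).vec = z := by
  conv_rhs => rw [← quadricVec_quadricPair z]
  have h := quadricPair_mul hV
  fin_cases j
  · obtain ⟨h1, h2⟩ := liftCoord_mul (i := 1) hz h.symm
    have h3 : (liftCoord 1 0 z).2.1 = (quadricPair z).1 0 := rfl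
    have h4 : (liftCoord 1 0 z).2.2 = (quadricPair z).2 0 := rfl
    change quadricVec ((liftCoord 1 0 z).2.1 • ![1, (liftCoord 1 0 z).1])
      ((liftCoord 1 0 z).2.2 • ![1, (liftCoord 1 0 z).1]) = _
    congr 1 <;> ext i <;> fin_cases i <;> simp [h3, h4]
    · rw [← h3]; exact h1
    · rw [← h4]; exact h2
  · obtain ⟨h1, h2⟩ := liftCoord_mul (i := 0) hz h
    have h3 : (liftCoord 0 1 z).2.1 = (quadricPair z).1 1 := rfl
    have h4 : (liftCoord 0 1 z).2.2 = (quadricPair z).2 1 := rfl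
    change quadricVec ((liftCoord 0 1 z).2.1 • ![(liftCoord 0 1 z).1, 1])
      ((liftCoord 0 1 z).2.2 • ![(liftCoord 0 1 z).1, 1]) = _
    congr 1 <;> ext i <;> fin_cases i <;> simp [h3, h4]
    · rw [← h3]; exact h1
    · rw [← h4]; exact h2

theorem exists_colSq_ne_zero {z : EuclideanSpace ℂ (Fin 4)} (hz : z ≠ 0) :
    ∃ j, colSq j z ≠ 0 := by
  by_contra! h
  refine hz ?_
  have h1 := norm_sq_quadricVec (quadricPair z).1 (quadricPair z).2
  have h2 := h 0
  have h3 := h 1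
  rw [quadricVec_quadricPair] at h1
  unfold colSq at h2 h3
  have : ‖z‖ ^ 2 = 0 := by linarith
  simpa using this

theorem exists_vec_eq (z : Cone) : ∃ P : SmallRes, P.vec = z.1 := by
  by_cases hz : z.1 = 0
  · refine ⟨chartU (0, 0, 0), ?_⟩
    have := (vec_chart (Or.inl rfl) (0, 0, 0)).1
    rw [hz]
    simpa [sqNorm] using this
  · obtain ⟨j, hj⟩ := exists_colSq_ne_zero hz
    exact ⟨_, vec_chartOf_liftCoord hj z.2⟩

/-- Dividing by the larger homogeneous coordinate keeps the base coordinate in the unit disc, which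
is needed for compactness and for the size of the zero section. -/
theorem exists_chart (P : SmallRes) :
    ∃ (φ : ℂ × ℂ × ℂ → SmallRes) (p : ℂ × ℂ × ℂ), (φ = chartU ∨ φ = chartV) ∧ φ p = P ∧
      ‖p.1‖ ≤ 1 := by
  set w := P.line.rep with hw
  have hw0 : w ≠ 0 := P.line.rep_nonzero
  have h1 := P.fst_mem
  have h2 := P.snd_mem
  rw [P.line.submodule_eq, Submodule.mem_span_singleton] at h1 h2
  obtain ⟨a, ha⟩ := h1
  obtain ⟨b, hb⟩ := h2
  rcases le_total ‖w 1‖ ‖w 0‖ with hle | hle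
  · have h0 : w 0 ≠ 0 := by
      intro h0
      rw [h0, norm_zero, norm_le_zero_iff] at hle
      exact hw0 (by ext i; fin_cases i <;> simp [h0, hle])
    have hww : w = w 0 • ![1, w 1 / w 0] := by
      ext i; fin_cases i <;> simp; field_simp
    refine ⟨chartU, (w 1 / w 0, a * w 0, b * w 0), Or.inl rfl, ?_, ?_⟩
    · refine SmallRes.ext ?_ ?_ ?_
      · conv_rhs => rw [← P.line.mk_rep]
        simp only [chartU, SmallRes.ofVec]
        rw [eq_comm, Projectivization.mk_eq_mk_iff]
        exact ⟨Units.mk0 _ h0, hww.symm⟩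
      · rw [← ha, ← hw]
        conv_rhs => rw [hww]
        simp only [chartU, SmallRes.ofVec, smul_smul]
      · rw [← hb, ← hw]
        conv_rhs => rw [hww]
        simp only [chartU, SmallRes.ofVec, smul_smul]
    · rw [norm_div]
      exact div_le_one_of_le₀ hle (norm_nonneg _)
  · have h0 : w 1 ≠ 0 := by
      intro h0
      rw [h0, norm_zero, norm_le_zero_iff] at hle
      exact hw0 (by ext i; fin_cases i <;> simp [h0, hle])
    have hww : w = w 1 • ![w 0 / w 1, 1] := by
      ext i; fin_cases i <;> simp; field_simp
    refine ⟨chartV, (w 0 / w 1, a * w 1, b * w 1), Or.inr rfl, ?_, ?_⟩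
    · refine SmallRes.ext ?_ ?_ ?_
      · conv_rhs => rw [← P.line.mk_rep]
        simp only [chartV, SmallRes.ofVec]
        rw [eq_comm, Projectivization.mk_eq_mk_iff]
        exact ⟨Units.mk0 _ h0, hww.symm⟩
      · rw [← ha, ← hw]
        conv_rhs => rw [hww]
        simp only [chartV, SmallRes.ofVec, smul_smul]
      · rw [← hb, ← hw]
        conv_rhs => rw [hww]
        simp only [chartV, SmallRes.ofVec, smul_smul]
    · rw [norm_div]
      exact div_le_one_of_le₀ hle (norm_nonneg _)

/-! ### Comparison of the distances -/

section

variable {f : ℝ → ℝ} {κ a : ℝ}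

/-- Lengths would scale by `√ρ`; the weaker factor `ρ` is enough and keeps constants rational. -/
theorem ofReal_sqrt_le {x y ρ : ℝ} (hρ : 1 ≤ ρ) (h : x ≤ ρ * y) :
    ENNReal.ofReal (√x) ≤ ENNReal.ofReal ρ * ENNReal.ofReal (√y) := by
  rw [← ENNReal.ofReal_mul (by linarith)]
  refine ENNReal.ofReal_le_ofReal ?_
  rcases le_total 0 y with hy | hy
  · refine Real.sqrt_le_iff.mpr ⟨by positivity, ?_⟩
    rw [mul_pow, Real.sq_sqrt hy]
    exact h.trans (mul_le_mul_of_nonneg_right (le_self_pow₀ hρ (by norm_num)) hy)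
  · rw [Real.sqrt_eq_zero'.mpr (h.trans (mul_nonpos_of_nonneg_of_nonpos (by linarith) hy))]
    positivity

theorem derivWithin_vec_comp {φ : ℂ × ℂ × ℂ → SmallRes} (hφ : φ = chartU ∨ φ = chartV)
    {c : ℝ → ℂ × ℂ × ℂ} {s : Set ℝ} {t : ℝ} (hs : UniqueDiffWithinAt ℝ s t)
    (hc : DifferentiableWithinAt ℝ c s t) :
    derivWithin (fun t => (φ (c t)).vec) s t =
      fderiv ℝ (fun q => (φ q).vec) (c t) (derivWithin c s t) :=
  (((contDiff_vec_chart (n := 1) hφ).differentiable (by norm_num) (c t)).hasFDerivAt.comp_hasDerivWithinAt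
    t hc.hasDerivWithinAt).derivWithin hs

theorem continuous_coneRadius : Continuous coneRadius :=
  continuous_norm.rpow_const fun _ => Or.inr (by norm_num)

theorem one_le_ratio (a δ : ℝ) : 1 ≤ 1 + 6 * a ^ 2 / δ ^ 2 := by
  have : 0 ≤ 6 * a ^ 2 / δ ^ 2 := by positivity
  linarith

theorem resArc_dichotomy (h : IsCandelasDeLaOssa f κ) (ha : 0 < a) {δ : ℝ} (hδ : 0 < δ)
    {P Q : SmallRes} {ℓ : ℝ≥0∞} (hPQ : ResArc f κ a P Q ℓ) :
    coneDist P.contract Q.contract ≤ ENNReal.ofReal (1 + 6 * a ^ 2 / δ ^ 2) * ℓ ∨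
      ∃ x y : Cone, coneRadius x.1 ≤ δ ∧ coneRadius y.1 ≤ δ ∧
        coneDist P.contract x + coneDist y Q.contract ≤
          ENNReal.ofReal (1 + 6 * a ^ 2 / δ ^ 2) * ℓ := by
  obtain ⟨φ, c, hφ, hc, rfl, rfl, rfl⟩ := hPQ
  rw [arcLength]
  have hZ : ContDiffOn ℝ 1 (fun t => (φ (c t)).vec) (Icc 0 1) :=
    (contDiff_vec_chart hφ).comp_contDiffOn hc
  have H : ∀ α β, 0 ≤ α → α < β → β ≤ 1 →
      (∀ t ∈ Icc α β, δ ≤ coneRadius (φ (c t)).vec) →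
      coneDist (φ (c α)).contract (φ (c β)).contract ≤
        ENNReal.ofReal (1 + 6 * a ^ 2 / δ ^ 2) * ∫⁻ t in Icc α β,
          ENNReal.ofReal (√(resMetric f κ a (c t) (derivWithin c (Icc 0 1) t))) := by
    intro α β hα hαβ hβ hr
    have hsub : Icc α β ⊆ Icc 0 1 := Icc_subset_Icc hα hβ
    refine (coneDist_le_lintegral hαβ (hZ.mono hsub) (fun t _ => (φ (c t)).mem_cone) rfl rfl).trans
      ?_
    rw [← lintegral_const_mul' _ _ ENNReal.ofReal_ne_top]
    refine setLIntegral_mono' measurableSet_Icc fun t ht => ?_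
    rw [derivWithin_eq_of_Icc_subset hαβ hsub (hZ.differentiableOn (by norm_num)) ht,
      derivWithin_vec_comp hφ (uniqueDiffOn_Icc zero_lt_one t (hsub ht))
        (hc.differentiableOn (by norm_num) t (hsub ht))]
    exact ofReal_sqrt_le (one_le_ratio a δ) (resMetric_coneMetric h ha hδ hφ (hr t ht) _).1
  rcases curve_dichotomy (D := coneDist) (n := fun t => (φ (c t)).contract) lengthDist_self
    (continuous_coneRadius.comp_continuousOn hZ.continuousOn) H with h1 | ⟨t₀, -, t₁, -, h1, h2, h3⟩
  · exact Or.inl h1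
  · exact Or.inr ⟨(φ (c t₀)).contract, (φ (c t₁)).contract, h1, h2, h3⟩

/-- Away from the apex preimages are unique, so the smooth lift in the chart necessarily joins the
prescribed endpoints `P` and `Q`. -/
theorem resDist_le_of_lift (h : IsCandelasDeLaOssa f κ) (ha : 0 < a) {δ : ℝ} (hδ : 0 < δ)
    {c : ℝ → EuclideanSpace ℂ (Fin 4)} {α β : ℝ} (hαβ : α < β) (hc : ContDiffOn ℝ 1 c (Icc α β))
    (hV : ∀ t ∈ Icc α β, ∑ i, c t i ^ 2 = 0) {j : Fin 2} (hj : ∀ t ∈ Icc α β, colSq j (c t) ≠ 0)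
    (hr : ∀ t ∈ Icc α β, δ ≤ coneRadius (c t)) {P Q : SmallRes} (hP : P.vec = c α)
    (hQ : Q.vec = c β) :
    resDist f κ a P Q ≤ ENNReal.ofReal (1 + 6 * a ^ 2 / δ ^ 2) *
      ∫⁻ t in Icc α β, ENNReal.ofReal (√(coneMetric (c t) (derivWithin c (Icc α β) t))) := by
  set ĉ : ℝ → ℂ × ℂ × ℂ := fun t => liftCoord (1 - j) j (c t) with hĉ
  have hφ := chartOf_eq j
  have hĉd : ContDiffOn ℝ 1 ĉ (Icc α β) := fun t ht =>
    (contDiffAt_liftCoord (hj t ht)).comp_contDiffWithinAt t (hc t ht)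
  have hvec : ∀ t ∈ Icc α β, (chartOf j (ĉ t)).vec = c t := fun t ht =>
    vec_chartOf_liftCoord (hj t ht) (hV t ht)
  have hne : ∀ t ∈ Icc α β, c t ≠ 0 := by
    intro t ht h0
    have := hδ.trans_le (hr t ht)
    rw [h0, coneRadius, norm_zero, Real.zero_rpow (by norm_num)] at this
    exact this.ne rfl
  have hα : α ∈ Icc α β := left_mem_Icc.mpr hαβ.le
  have hβ : β ∈ Icc α β := right_mem_Icc.mpr hαβ.le
  have eP : P = chartOf j (ĉ α) := SmallRes.eq_of_vec_eq (by rw [hP, hvec α hα])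
    (by rw [hP]; exact hne α hα)
  have eQ : Q = chartOf j (ĉ β) := SmallRes.eq_of_vec_eq (by rw [hQ, hvec β hβ])
    (by rw [hQ]; exact hne β hβ)
  rw [eP, eQ, ← lintegral_const_mul' _ _ ENNReal.ofReal_ne_top]
  refine (resDist_le_lintegral h ha hφ hαβ hĉd).trans ?_
  refine setLIntegral_mono' measurableSet_Icc fun t ht => ?_
  have hu := uniqueDiffOn_Icc hαβ t ht
  have hd : derivWithin c (Icc α β) t = fderiv ℝ (fun q => (chartOf j q).vec) (ĉ t)
      (derivWithin ĉ (Icc α β) t) := by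
    rw [← derivWithin_vec_comp hφ hu (hĉd.differentiableOn (by norm_num) t ht)]
    exact derivWithin_congr (fun s hs => (hvec s hs).symm) (hvec t ht).symm
  rw [hd]
  conv_rhs => rw [← hvec t ht]
  refine ofReal_sqrt_le (one_le_ratio a δ) (resMetric_coneMetric h ha hδ hφ ?_ _).2
  rw [hvec t ht]
  exact hr t ht

theorem forall_mem_Icc_of_subset {α β : ℝ} {U : Set (Icc α β)} {q : ℝ → Prop}
    (hU : ∀ x : Icc α β, x ∈ U ↔ q x) {x y : Icc α β} (h : Icc x y ⊆ U) :
    ∀ s ∈ Icc (x : ℝ) y, q s := fun s hs => by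
  have hs' : s ∈ Icc α β := ⟨x.2.1.trans hs.1, hs.2.trans y.2.2⟩
  have hm : (⟨s, hs'⟩ : Icc α β) ∈ Icc x y := ⟨hs.1, hs.2⟩
  exact (hU _).mp (h hm)

/-- The interval is subdivided so that on each piece one column of the matrix does not vanish; the
pieces are lifted separately and fit together by uniqueness of lifts. -/
theorem resDist_le_of_curve (h : IsCandelasDeLaOssa f κ) (ha : 0 < a) {δ : ℝ} (hδ : 0 < δ)
    {c : ℝ → EuclideanSpace ℂ (Fin 4)} (hc : ContDiffOn ℝ 1 c (Icc 0 1))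
    (hV : ∀ t ∈ Icc (0 : ℝ) 1, ∑ i, c t i ^ 2 = 0) {n : ℝ → SmallRes}
    (hn : ∀ t ∈ Icc (0 : ℝ) 1, (n t).vec = c t) {α β : ℝ} (hα : 0 ≤ α) (hαβ : α < β) (hβ : β ≤ 1)
    (hr : ∀ t ∈ Icc α β, δ ≤ coneRadius (c t)) :
    resDist f κ a (n α) (n β) ≤
      ENNReal.ofReal (1 + 6 * a ^ 2 / δ ^ 2) * ∫⁻ t in Icc α β,
        ENNReal.ofReal (√(coneMetric (c t) (derivWithin c (Icc 0 1) t))) := by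
  have hsub : Icc α β ⊆ Icc 0 1 := Icc_subset_Icc hα hβ
  have hcr : Continuous ((Icc α β).domRestrict c) :=
    continuousOn_iff_continuous_domRestrict.mp (hc.continuousOn.mono hsub)
  obtain ⟨U, hU⟩ : ∃ U : Fin 2 → Set (Icc α β), ∀ j x, x ∈ U j ↔ colSq j (c x) ≠ 0 :=
    ⟨fun j => {x | colSq j (c x) ≠ 0}, fun _ _ => Iff.rfl⟩
  have hUo : ∀ j, IsOpen (U j) := fun j => by
    have : U j = {x : Icc α β | colSq j (c x) ≠ 0} := Set.ext fun x => hU j x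
    rw [this]
    exact isOpen_ne_fun ((continuous_colSq j).comp hcr) continuous_const
  have hUc : univ ⊆ ⋃ j, U j := by
    intro x _
    have hx : c x ≠ 0 := by
      intro h0
      have := hδ.trans_le (hr x x.2)
      rw [h0, coneRadius, norm_zero, Real.zero_rpow (by norm_num)] at this
      exact this.ne rfl
    obtain ⟨j, hj⟩ := exists_colSq_ne_zero hx
    exact mem_iUnion.mpr ⟨j, (hU j x).mpr hj⟩
  obtain ⟨t, ht0, htm, ⟨m, hm⟩, htc⟩ := exists_monotone_Icc_subset_open_cover_Icc hαβ.le hUo hUc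
  have key : ∀ k, resDist f κ a (n α) (n (t k)) ≤ ENNReal.ofReal (1 + 6 * a ^ 2 / δ ^ 2) *
      ∫⁻ s in Icc α (t k), ENNReal.ofReal (√(coneMetric (c s) (derivWithin c (Icc 0 1) s))) := by
    intro k
    induction k with
    | zero => rw [ht0, resDist, lengthDist_self]; exact bot_le
    | succ k ih =>
      have hle : (t k : ℝ) ≤ t (k + 1) := htm (Nat.le_succ k)
      rcases hle.eq_or_lt with heq | hlt
      · rw [← heq]; exact ih
      obtain ⟨j, hj⟩ := htc k
      have hsub' : Icc (t k : ℝ) (t (k + 1)) ⊆ Icc α β := Icc_subset_Icc (t k).2.1 (t (k + 1)).2.2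
      have hj' := forall_mem_Icc_of_subset (q := fun s => colSq j (c s) ≠ 0) (hU j) hj
      have hstep := resDist_le_of_lift h ha hδ hlt (hc.mono (hsub'.trans hsub))
        (fun s hs => hV s (hsub (hsub' hs))) hj'
        (fun s hs => hr s (hsub' hs)) (hn _ (hsub (t k).2)) (hn _ (hsub (t (k + 1)).2))
      rw [← lintegral_Icc_add_Icc _ (t k).2.1 hle, mul_add]
      refine (lengthDist_triangle _ (n (t k)) _).trans (add_le_add ih (hstep.trans_eq ?_))
      congr 1
      refine setLIntegral_congr_fun measurableSet_Icc fun s hs => ?_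
      rw [derivWithin_eq_of_Icc_subset hlt (hsub'.trans hsub)
        (hc.differentiableOn (by norm_num)) hs]
  have := key m
  rwa [hm m le_rfl] at this

theorem coneArc_dichotomy (h : IsCandelasDeLaOssa f κ) (ha : 0 < a) {δ : ℝ} (hδ : 0 < δ)
    {p q : Cone} {ℓ : ℝ≥0∞} (hpq : ConeArc p q ℓ) {P Q : SmallRes} (hP : P.vec = p.1)
    (hQ : Q.vec = q.1) :
    resDist f κ a P Q ≤ ENNReal.ofReal (1 + 6 * a ^ 2 / δ ^ 2) * ℓ ∨
      ∃ x y : SmallRes, radius x ≤ δ ∧ radius y ≤ δ ∧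
        resDist f κ a P x + resDist f κ a y Q ≤
          ENNReal.ofReal (1 + 6 * a ^ 2 / δ ^ 2) * ℓ := by
  obtain ⟨c, hc, hV, h0, h1, rfl⟩ := hpq
  rw [arcLength]
  -- A pointwise lift with prescribed ends: over the apex, `P` and `Q` are not determined by the
  -- curve.
  obtain ⟨n, hn0, hn1, hn⟩ : ∃ n : ℝ → SmallRes, n 0 = P ∧ n 1 = Q ∧
      ∀ t ∈ Icc (0 : ℝ) 1, (n t).vec = c t := by
    have hex : ∀ t : ℝ, ∃ S : SmallRes, (t = 0 → S = P) ∧ (t = 1 → S = Q) ∧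
        (t ∈ Icc (0 : ℝ) 1 → S.vec = c t) := by
      intro t
      by_cases ht0 : t = 0
      · exact ⟨P, fun _ => rfl, fun ht1 => absurd (ht0.symm.trans ht1) (by norm_num),
          fun _ => by rw [ht0, h0, hP]⟩
      by_cases ht1 : t = 1
      · exact ⟨Q, fun h => absurd h ht0, fun _ => rfl, fun _ => by rw [ht1, h1, hQ]⟩
      by_cases ht : t ∈ Icc (0 : ℝ) 1
      · obtain ⟨S, hS⟩ := exists_vec_eq ⟨c t, hV t ht⟩
        exact ⟨S, fun h => absurd h ht0, fun h => absurd h ht1, fun _ => hS⟩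
      · exact ⟨P, fun _ => rfl, fun h => absurd h ht1, fun h => absurd h ht⟩
    choose n hn using hex
    exact ⟨n, (hn 0).1 rfl, (hn 1).2.1 rfl, fun t => (hn t).2.2⟩
  have H : ∀ α β, 0 ≤ α → α < β → β ≤ 1 → (∀ t ∈ Icc α β, δ ≤ coneRadius (c t)) →
      resDist f κ a (n α) (n β) ≤
        ENNReal.ofReal (1 + 6 * a ^ 2 / δ ^ 2) * ∫⁻ t in Icc α β,
          ENNReal.ofReal (√(coneMetric (c t) (derivWithin c (Icc 0 1) t))) := by
    exact fun α β hα hαβ hβ hr => resDist_le_of_curve h ha hδ hc hV hn hα hαβ hβ hr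
  rcases curve_dichotomy (D := resDist f κ a) (n := n) lengthDist_self
    (continuous_coneRadius.comp_continuousOn hc.continuousOn) H
    with h2 | ⟨t₀, ht₀, t₁, ht₁, h2, h3, h4⟩
  · rw [hn0, hn1] at h2
    exact Or.inl h2
  · rw [hn0, hn1] at h4
    refine Or.inr ⟨n t₀, n t₁, ?_, ?_, h4⟩
    · rw [← coneRadius_vec, hn t₀ ht₀]; exact h2
    · rw [← coneRadius_vec, hn t₁ ht₁]; exact h3

end

/-! ### Explicit curves -/

theorem lintegral_Icc_le_ofReal {F : ℝ → ℝ} {K : ℝ} (hK : 0 ≤ K)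
    (hF : ∀ t ∈ Icc (0 : ℝ) 1, F t ≤ K ^ 2) :
    ∫⁻ t in Icc (0 : ℝ) 1, ENNReal.ofReal (√(F t)) ≤ ENNReal.ofReal K := by
  calc ∫⁻ t in Icc (0 : ℝ) 1, ENNReal.ofReal (√(F t))
      ≤ ∫⁻ _ in Icc (0 : ℝ) 1, ENNReal.ofReal K :=
        setLIntegral_mono' measurableSet_Icc fun t ht =>
          ENNReal.ofReal_le_ofReal (Real.sqrt_le_iff.mpr ⟨hK, hF t ht⟩)
    _ = ENNReal.ofReal K := by simp

theorem hForm_le_div {W s N I : ℝ} (hW : 0 < W) (hs : 0 ≤ s) (hN : 0 ≤ N) (hI : 0 ≤ I) :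
    hForm W s N I ≤ N / W := by
  have h1 : 0 ≤ N / W := by positivity
  have h2 : 0 ≤ I / (W * (2 * W ^ 3 + s)) := by positivity
  unfold hForm
  linarith

/-- The apex of the cone. -/
def Cone.apex : Cone := ⟨0, by simp⟩

theorem coneRadius_nonneg (z : EuclideanSpace ℂ (Fin 4)) : 0 ≤ coneRadius z :=
  Real.rpow_nonneg (norm_nonneg _) _

/-- Along the ray `t³z` the radius is `t²r`, and the squared speed is at most `N / R = 9t²r²`. The
parametrization keeps the speed bounded down to the apex. -/
theorem coneDist_apex_le (z : Cone) :
    coneDist Cone.apex z ≤ ENNReal.ofReal (3 * coneRadius z.1) := by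
  have hR := coneRadius_nonneg z.1
  have hd : ∀ t : ℝ, HasDerivAt (fun t : ℝ => t ^ 3 • z.1) ((3 * t ^ 2) • z.1) t := fun t => by
    simpa using (hasDerivAt_pow 3 t).smul_const z.1
  refine (lengthDist_le_of_arc (arc := ConeArc) ⟨fun t : ℝ => t ^ 3 • z.1,
    (by fun_prop : ContDiff ℝ 1 fun t : ℝ => t ^ 3 • z.1).contDiffOn, fun t _ => ?_,
    by simp [Cone.apex], by simp, rfl⟩).trans ?_
  · have h1 : ∀ i, (t ^ 3 • z.1) i ^ 2 = ((t ^ 3 : ℝ) : ℂ) ^ 2 * z.1 i ^ 2 := fun i => by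
      simp [mul_pow]
    simp only [h1, ← Finset.mul_sum, z.2, mul_zero]
  · refine lintegral_Icc_le_ofReal (by positivity) fun t ht => ?_
    rw [(hd t).hasDerivWithinAt.derivWithin (uniqueDiffOn_Icc zero_lt_one t ht)]
    by_cases hz : t ^ 3 • z.1 = 0
    · rw [coneMetric, if_pos hz]; positivity
    have ht0 : 0 < t := lt_of_le_of_ne ht.1 (by rintro rfl; simp at hz)
    have hR' : coneRadius (t ^ 3 • z.1) = t ^ 2 * coneRadius z.1 := by
      refine (pow_left_inj₀ (n := 3) (coneRadius_nonneg _) (by positivity)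
        (by norm_num)).mp ?_
      rw [coneRadius_cube, mul_pow, coneRadius_cube, norm_smul, mul_pow, Real.norm_eq_abs, sq_abs]
      ring
    have hz1 : z.1 ≠ 0 := fun h0 => hz (by rw [h0, smul_zero])
    have hRpos := coneRadius_pos hz1
    rw [coneMetric_eq hz]
    refine (hForm_le_div (coneRadius_pos hz) (by positivity) (by positivity) (by positivity)).trans
      ?_
    rw [hR', norm_smul, mul_pow, Real.norm_eq_abs, sq_abs, ← coneRadius_cube,
      div_le_iff₀ (by positivity)]
    have ht2 : t ^ 2 ≤ 1 := pow_le_one₀ ht.1 ht.2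
    calc (3 * t ^ 2) ^ 2 * coneRadius z.1 ^ 3 = 9 * t ^ 2 * coneRadius z.1 ^ 2 *
          (t ^ 2 * coneRadius z.1) := by ring
      _ ≤ 9 * 1 * coneRadius z.1 ^ 2 * (t ^ 2 * coneRadius z.1) := by gcongr
      _ = (3 * coneRadius z.1) ^ 2 * (t ^ 2 * coneRadius z.1) := by ring

theorem coneDist_le_of_radius {x y : Cone} {δ : ℝ} (hx : coneRadius x.1 ≤ δ)
    (hy : coneRadius y.1 ≤ δ) : coneDist x y ≤ ENNReal.ofReal (6 * δ) := by
  have h0 := coneRadius_nonneg x.1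
  have h1 : coneDist x Cone.apex ≤ ENNReal.ofReal (3 * δ) := by
    rw [coneDist, lengthDist_comm ConeArc.symm]
    exact (coneDist_apex_le x).trans (ENNReal.ofReal_le_ofReal (by linarith))
  have h2 : coneDist Cone.apex y ≤ ENNReal.ofReal (3 * δ) :=
    (coneDist_apex_le y).trans (ENNReal.ofReal_le_ofReal (by linarith))
  refine (lengthDist_triangle x Cone.apex y).trans ((add_le_add h1 h2).trans ?_)
  rw [← ENNReal.ofReal_add (by linarith) (by linarith)]
  exact ENNReal.ofReal_le_ofReal (by linarith)

section

variable {f : ℝ → ℝ} {κ a : ℝ}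

theorem radius_nonneg (P : SmallRes) : 0 ≤ radius P := by unfold radius; positivity

theorem radius_cube {φ : ℂ × ℂ × ℂ → SmallRes} (hφ : φ = chartU ∨ φ = chartV)
    (p : ℂ × ℂ × ℂ) : radius (φ p) ^ 3 = sqNorm p := by
  rw [← coordRadius_cube]
  rcases hφ with rfl | rfl
  · rw [radius_chartU]
  · rw [radius_chartV]

/-- The same cubic ray, now inside a fibre: the Fubini–Study term vanishes there, and `W ≥ t²r`
makes the metric no larger than in the cone estimate. -/
theorem resDist_zeroSection_le (h : IsCandelasDeLaOssa f κ) (ha : 0 < a)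
    {φ : ℂ × ℂ × ℂ → SmallRes} (hφ : φ = chartU ∨ φ = chartV) (p : ℂ × ℂ × ℂ) :
    resDist f κ a (φ (p.1, 0, 0)) (φ p) ≤ ENNReal.ofReal (3 * radius (φ p)) := by
  have hR := radius_nonneg (φ p)
  have hR3 := radius_cube hφ p
  set R := radius (φ p)
  set c : ℝ → ℂ × ℂ × ℂ := fun t => (p.1, t ^ 3 • p.2.1, t ^ 3 • p.2.2) with hc
  have hd : ∀ t : ℝ, HasDerivAt c (0, (3 * t ^ 2) • p.2.1, (3 * t ^ 2) • p.2.2) t := fun t =>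
    (hasDerivAt_const t p.1).prodMk ((by simpa using (hasDerivAt_pow 3 t).smul_const p.2.1 :
      HasDerivAt (fun t : ℝ => t ^ 3 • p.2.1) ((3 * t ^ 2) • p.2.1) t).prodMk
      (by simpa using (hasDerivAt_pow 3 t).smul_const p.2.2))
  have hcd : ContDiff ℝ 1 c := by simp only [hc]; fun_prop
  refine (lengthDist_le_of_arc (arc := ResArc f κ a) ⟨φ, c, hφ, hcd.contDiffOn,
    by simp [hc], by simp [hc], rfl⟩).trans ?_
  refine lintegral_Icc_le_ofReal (by positivity) fun t ht => ?_
  rw [(hd t).hasDerivWithinAt.derivWithin (uniqueDiffOn_Icc zero_lt_one t ht)]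
  obtain ⟨W, hW0, hWs, hW⟩ := h.exists_resMetric_eq ha (c t)
  rw [hW]
  have hs : sqNorm (c t) = (t ^ 2 * R) ^ 3 := by
    rw [mul_pow, hR3]
    simp only [hc, sqNorm, norm_smul, mul_pow, Real.norm_eq_abs, sq_abs]
    ring
  have hN : velSq (c t) (0, (3 * t ^ 2) • p.2.1, (3 * t ^ 2) • p.2.2) = 9 * t ^ 4 * R ^ 3 := by
    rw [hR3]
    simp only [hc, sqNorm, velSq, mul_zero, add_zero, norm_smul, norm_mul, mul_pow,
      Real.norm_eq_abs, sq_abs]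
    ring
  have hq : fsSq (c t) (0, (3 * t ^ 2) • p.2.1, (3 * t ^ 2) • p.2.2) = 0 := by simp [fsSq]
  rw [hq, mul_zero, add_zero]
  refine (hForm_le_div hW0 (sqNorm_nonneg _) (velSq_nonneg _ _) (velInner_nonneg _ _)).trans ?_
  have hWt : t ^ 2 * R ≤ W := by
    refine le_of_pow_le_pow_left₀ (n := 3) (by norm_num) hW0.le ?_
    rw [← hs, ← hWs]
    have : 0 ≤ W * a ^ 2 := by positivity
    linarith
  rw [hN, div_le_iff₀ hW0]
  have ht1 : t ^ 2 ≤ 1 := pow_le_one₀ ht.1 ht.2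
  calc 9 * t ^ 4 * R ^ 3 = 9 * t ^ 2 * R ^ 2 * (t ^ 2 * R) := by ring
    _ ≤ 9 * 1 * R ^ 2 * W := by gcongr
    _ = (3 * R) ^ 2 * W := by ring

theorem resDist_line_le (h : IsCandelasDeLaOssa f κ) (ha : 0 < a)
    {φ : ℂ × ℂ × ℂ → SmallRes} (hφ : φ = chartU ∨ φ = chartV) {K : ℝ} (hK : 0 ≤ K)
    {p q : ℂ × ℂ × ℂ}
    (hpq : ∀ t ∈ Icc (0 : ℝ) 1, velSq (p + t • (q - p)) (q - p) / a + 3 * a ^ 2 *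
      ‖q.1 - p.1‖ ^ 2 ≤ K ^ 2) :
    resDist f κ a (φ p) (φ q) ≤ ENNReal.ofReal K := by
  have hd : ∀ t : ℝ, HasDerivAt (fun t : ℝ => p + t • (q - p)) (q - p) t := fun t => by
    simpa using ((hasDerivAt_id t).smul_const (q - p)).const_add p
  refine (lengthDist_le_of_arc (arc := ResArc f κ a) ⟨φ, fun t => p + t • (q - p), hφ,
    (by fun_prop : ContDiff ℝ 1 fun t : ℝ => p + t • (q - p)).contDiffOn,
    by simp, by simp, rfl⟩).trans ?_
  refine lintegral_Icc_le_ofReal hK fun t ht => ?_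
  rw [(hd t).hasDerivWithinAt.derivWithin (uniqueDiffOn_Icc zero_lt_one t ht)]
  exact (resMetric_le h ha _ _).trans (hpq t ht)

/-- Along the zero section `velSq` vanishes and only the Fubini–Study term, of order `a²`, remains;
here `3a² · 2² ≤ (4a)²`. -/
theorem resDist_zeroSection_line_le (h : IsCandelasDeLaOssa f κ) (ha : 0 < a)
    {φ : ℂ × ℂ × ℂ → SmallRes} (hφ : φ = chartU ∨ φ = chartV) {k l : ℂ} (hl : ‖l - k‖ ≤ 2) :
    resDist f κ a (φ (k, 0, 0)) (φ (l, 0, 0)) ≤ ENNReal.ofReal (4 * a) := by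
  refine resDist_line_le h ha hφ (by positivity) fun t _ => ?_
  have : ‖l - k‖ ^ 2 ≤ 2 ^ 2 := pow_le_pow_left₀ (norm_nonneg _) hl 2
  simp [velSq]
  nlinarith [sq_nonneg a]

/-- The base point lies over `[1 : 1]`, which has coordinate `1` in both charts and so is within `2`
of every base coordinate in the unit disc. -/
theorem resDist_base_le (h : IsCandelasDeLaOssa f κ) (ha : 0 < a) (P : SmallRes) :
    resDist f κ a (chartU (1, 0, 0)) P ≤ ENNReal.ofReal (3 * radius P + 4 * a) := by
  obtain ⟨φ, p, hφ, rfl, hp⟩ := exists_chart P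
  have hbase : chartU (1, 0, 0) = φ (1, 0, 0) := by
    rcases hφ with rfl | rfl
    · rfl
    · simpa using chartU_eq_chartV 1 0 0 one_ne_zero
  have h1 : ‖p.1 - 1‖ ≤ 2 := (norm_sub_le _ _).trans (by rw [norm_one]; linarith)
  rw [hbase, add_comm, ENNReal.ofReal_add (by positivity)
    (mul_nonneg (by norm_num) (radius_nonneg _))]
  exact (lengthDist_triangle _ (φ (p.1, 0, 0)) _).trans
    (add_le_add (resDist_zeroSection_line_le h ha hφ h1) (resDist_zeroSection_le h ha hφ p))

theorem resDist_comm (h : IsCandelasDeLaOssa f κ) (ha : 0 < a) (P Q : SmallRes) :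
    resDist f κ a P Q = resDist f κ a Q P :=
  lengthDist_comm (ResArc.symm h ha) P Q

theorem resDist_le_of_radius (h : IsCandelasDeLaOssa f κ) (ha : 0 < a) {P Q : SmallRes} {δ : ℝ}
    (hP : radius P ≤ δ) (hQ : radius Q ≤ δ) :
    resDist f κ a P Q ≤ ENNReal.ofReal (6 * δ + 8 * a) := by
  have h0 := radius_nonneg P
  have h1 : resDist f κ a P (chartU (1, 0, 0)) ≤ ENNReal.ofReal (3 * δ + 4 * a) := by
    rw [resDist_comm h ha]
    exact (resDist_base_le h ha P).trans (ENNReal.ofReal_le_ofReal (by linarith))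
  have h2 : resDist f κ a (chartU (1, 0, 0)) Q ≤ ENNReal.ofReal (3 * δ + 4 * a) :=
    (resDist_base_le h ha Q).trans (ENNReal.ofReal_le_ofReal (by linarith))
  refine (lengthDist_triangle _ (chartU (1, 0, 0)) _).trans ((add_le_add h1 h2).trans ?_)
  rw [← ENNReal.ofReal_add (by linarith) (by linarith)]
  exact ENNReal.ofReal_le_ofReal (by linarith)

/-! ### Almost isometry of the contraction -/

/-- The choice `δ = √a` makes both the metric distortion on `r ≥ δ` and the diameter of `r ≤ δ` tend
to zero. -/
theorem ratio_sqrt (ha : 0 < a) : 1 + 6 * a ^ 2 / √a ^ 2 = 1 + 6 * a := by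
  rw [Real.sq_sqrt ha.le]
  field_simp

theorem coneDist_contract_le (h : IsCandelasDeLaOssa f κ) (ha : 0 < a) (P Q : SmallRes) :
    coneDist P.contract Q.contract ≤
      ENNReal.ofReal (1 + 6 * a) * resDist f κ a P Q + ENNReal.ofReal (6 * √a) := by
  rw [← ratio_sqrt ha]
  have hδ : 0 < √a := Real.sqrt_pos.mpr ha
  refine le_mul_lengthDist_add (D := coneDist) (R := fun P z => P.contract = z)
    (B := fun z => coneRadius z.1 ≤ √a) lengthDist_self lengthDist_triangle
    (fun P => ⟨_, rfl⟩) (by rintro P _ _ rfl rfl; exact Or.inl rfl) ?_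
    (fun x y hx hy => coneDist_le_of_radius hx hy) ?_ ENNReal.ofReal_ne_top rfl rfl
  · rintro P Q ℓ _ _ hPQ rfl rfl
    exact resArc_dichotomy h ha hδ hPQ
  · have := one_le_ratio a (√a)
    simp only [ne_eq, ENNReal.ofReal_eq_zero]
    linarith

theorem resDist_le_coneDist_contract (h : IsCandelasDeLaOssa f κ) (ha : 0 < a) (P Q : SmallRes) :
    resDist f κ a P Q ≤ ENNReal.ofReal (1 + 6 * a) * coneDist P.contract Q.contract +
      ENNReal.ofReal (6 * √a + 8 * a) := by
  rw [← ratio_sqrt ha]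
  have hδ : 0 < √a := Real.sqrt_pos.mpr ha
  refine le_mul_lengthDist_add (D := resDist f κ a) (R := fun z P => P.vec = z.1)
    (B := fun P => radius P ≤ √a) lengthDist_self lengthDist_triangle
    exists_vec_eq ?_ ?_
    (fun x y hx hy => resDist_le_of_radius h ha hx hy) ?_ ENNReal.ofReal_ne_top rfl rfl
  · intro z P Q hP hQ
    -- Over the apex the lifts form the whole zero section, which lies in the small region;
    -- elsewhere they are unique.
    by_cases hz : z.1 = 0
    · right
      have h0 : coneRadius (0 : EuclideanSpace ℂ (Fin 4)) ≤ √a := by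
        rw [coneRadius, norm_zero, Real.zero_rpow (by norm_num)]; exact hδ.le
      rw [← coneRadius_vec, ← coneRadius_vec, hP, hQ, hz]
      exact ⟨h0, h0⟩
    · exact Or.inl (SmallRes.eq_of_vec_eq (hP.trans hQ.symm) (by rwa [hP]))
  · intro p q ℓ P Q hpq hP hQ
    exact coneArc_dichotomy h ha hδ hpq hP hQ
  · have := one_le_ratio a (√a)
    simp only [ne_eq, ENNReal.ofReal_eq_zero]
    linarith

end

/-! ### Separation of points -/

/-- The inverse stereographic projection (up to an affine map). -/
def stereo {V : Type} [NormedAddCommGroup V] [NormedSpace ℝ V] (x : V) : V × ℝ :=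
  ((1 + ‖x‖ ^ 2)⁻¹ • x, (1 + ‖x‖ ^ 2)⁻¹)

theorem stereo_injective {V : Type} [NormedAddCommGroup V] [NormedSpace ℝ V] :
    Function.Injective (stereo : V → V × ℝ) := by
  intro x y h
  have h1 := congrArg Prod.fst h
  have h2 := congrArg Prod.snd h
  simp only [stereo] at h1 h2
  rw [← h2] at h1
  have : (1 + ‖x‖ ^ 2)⁻¹ ≠ 0 := by positivity
  exact smul_right_injective V this h1

theorem contDiff_stereo {V : Type} [NormedAddCommGroup V] [InnerProductSpace ℝ V]
    {n : WithTop ℕ∞} : ContDiff ℝ n (stereo : V → V × ℝ) := by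
  have h : ContDiff ℝ n fun x : V => (1 + ‖x‖ ^ 2)⁻¹ :=
    (contDiff_const.add (contDiff_id.norm_sq ℝ)).inv fun x => by positivity
  exact (h.smul contDiff_id).prodMk h

/-- The decay `1/(1 + |x|²)` compensates for the decay of the metrics at infinity, giving global
Lipschitz maps. The square `9` of the constant is the one in `velSq_le_resMetric` and
`fsSq_le_resMetric`. -/
theorem norm_derivWithin_stereo_le {V : Type} [NormedAddCommGroup V] [InnerProductSpace ℝ V]
    {A : ℝ → V} {A' : V} {s : Set ℝ} {t : ℝ} (hs : UniqueDiffWithinAt ℝ s t)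
    (hA : HasDerivWithinAt A A' s t) :
    ‖derivWithin (fun t => stereo (A t)) s t‖ ≤ 3 * ‖A'‖ / (1 + ‖A t‖ ^ 2) := by
  set q := 1 + ‖A t‖ ^ 2 with hq
  have hq0 : 0 < q := by positivity
  have hqd : HasDerivWithinAt (fun t => 1 + ‖A t‖ ^ 2) (2 * inner ℝ (A t) A') s t :=
    hA.norm_sq.const_add 1
  have hid := hqd.inv hq0.ne'
  have hd := (hid.smul hA).prodMk hid
  have hd' : derivWithin (fun t => stereo (A t)) s t = _ := hd.derivWithin hs
  have hin : |inner ℝ (A t) A'| ≤ ‖A t‖ * ‖A'‖ := abs_real_inner_le_norm _ _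
  have h1 : ‖A t‖ ^ 2 ≤ q := by linarith
  have h2 : 2 * ‖A t‖ ≤ q := by nlinarith [sq_nonneg (‖A t‖ - 1)]
  have hn := norm_nonneg A'
  have hAt := norm_nonneg (A t)
  have e1 : |-(2 * inner ℝ (A t) A') / q ^ 2| ≤ 2 * (‖A t‖ * ‖A'‖) / q ^ 2 := by
    rw [abs_div, abs_neg, abs_mul, abs_two, abs_of_pos (by positivity : 0 < q ^ 2)]
    gcongr
  rw [hd', Prod.norm_def]
  refine max_le ?_ ?_
  · refine (norm_add_le _ _).trans ?_
    rw [norm_smul, norm_smul, Real.norm_eq_abs, Real.norm_eq_abs]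
    have e2 : |(fun t => 1 + ‖A t‖ ^ 2)⁻¹ t| * ‖A'‖ = ‖A'‖ / q := by
      simp only [Pi.inv_apply]
      rw [abs_of_pos (by positivity), ← hq]; field_simp
    have e3 : |-(2 * inner ℝ (A t) A') / q ^ 2| * ‖A t‖ ≤ 2 * ‖A'‖ / q := by
      refine (mul_le_mul_of_nonneg_right e1 hAt).trans ?_
      rw [div_mul_eq_mul_div, div_le_div_iff₀ (by positivity) hq0]
      have : ‖A t‖ ^ 2 * (2 * ‖A'‖ * q) ≤ q * (2 * ‖A'‖ * q) := by gcongr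
      linarith
    calc _ ≤ ‖A'‖ / q + 2 * ‖A'‖ / q := add_le_add e2.le e3
      _ = 3 * ‖A'‖ / q := by ring
  · rw [Real.norm_eq_abs]
    refine e1.trans ?_
    rw [div_le_div_iff₀ (by positivity) hq0]
    have : 2 * ‖A t‖ * (‖A'‖ * q) ≤ q * (‖A'‖ * q) := by gcongr
    have : 0 ≤ ‖A'‖ * q * q := by positivity
    linarith

theorem edist_le_arcLength {E V : Type} [NormedAddCommGroup E] [NormedSpace ℝ E]
    [NormedAddCommGroup V] [NormedSpace ℝ V] {g : E → E → ℝ} {c : ℝ → E} {G : ℝ → V}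
    (hG : ContDiffOn ℝ 1 G (Icc 0 1)) {K : ℝ} (hK : 0 ≤ K)
    (hg : ∀ t ∈ Icc (0 : ℝ) 1, ‖derivWithin G (Icc 0 1) t‖ ^ 2 ≤
      K ^ 2 * g (c t) (derivWithin c (Icc 0 1) t)) :
    edist (G 0) (G 1) ≤ ENNReal.ofReal K * arcLength g c := by
  rw [edist_comm, edist_eq_enorm_sub, arcLength, ← lintegral_const_mul' _ _ ENNReal.ofReal_ne_top]
  refine (enorm_sub_le_lintegral_derivWithin_Icc_of_contDiffOn_Icc hG zero_le_one).trans ?_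
  refine setLIntegral_mono' measurableSet_Icc fun t ht => ?_
  rw [← ofReal_norm, ← ENNReal.ofReal_mul hK]
  refine ENNReal.ofReal_le_ofReal ?_
  have h := Real.sqrt_le_sqrt (hg t ht)
  rwa [Real.sqrt_sq (norm_nonneg _), Real.sqrt_mul (sq_nonneg _), Real.sqrt_sq hK] at h

theorem edist_le_mul_lengthDist {M V : Type} [PseudoEMetricSpace V] {arc : M → M → ℝ≥0∞ → Prop}
    {H : M → V} {C : ℝ≥0∞} (hC0 : C ≠ 0) (hC : C ≠ ⊤)
    (hH : ∀ p q ℓ, arc p q ℓ → edist (H p) (H q) ≤ C * ℓ) (p q : M) :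
    edist (H p) (H q) ≤ C * lengthDist arc p q := by
  -- The case of an empty small region and no additive error.
  have := le_mul_lengthDist_add (arc := arc) (D := fun x y : M => edist (H x) (H y))
    (R := fun x y => x = y) (B := fun _ => False) (C := C) (ε := 0) (fun x => edist_self _)
    (fun x y z => edist_triangle _ _ _) (fun m => ⟨m, rfl⟩)
    (by rintro m _ _ rfl rfl; exact Or.inl rfl)
    (by rintro m m' ℓ _ _ ha rfl rfl; exact Or.inl (hH _ _ _ ha)) (by simp) hC0 hC
    (rfl : p = p) (rfl : q = q)
  simpa using this

section

variable {f : ℝ → ℝ} {κ a : ℝ}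

/-- The Lipschitz constant stays bounded as `a → 0`, so the estimate also separates points of the
cone in the limit. -/
theorem edist_stereo_vec_le (h : IsCandelasDeLaOssa f κ) (ha : 0 < a) (P Q : SmallRes) :
    edist (stereo P.vec) (stereo Q.vec) ≤
      ENNReal.ofReal (14 * (1 + a)) * resDist f κ a P Q := by
  refine edist_le_mul_lengthDist (H := fun P : SmallRes => stereo P.vec) ?_
    ENNReal.ofReal_ne_top ?_ P Q
  · simp only [ne_eq, ENNReal.ofReal_eq_zero]; linarith
  · rintro _ _ _ ⟨φ, c, hφ, hc, rfl, rfl, rfl⟩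
    have hZ : ContDiffOn ℝ 1 (fun t => (φ (c t)).vec) (Icc 0 1) :=
      (contDiff_vec_chart hφ).comp_contDiffOn hc
    refine edist_le_arcLength (G := fun t => stereo (φ (c t)).vec)
      (contDiff_stereo.comp_contDiffOn hZ) (by positivity) fun t ht => ?_
    have hu := uniqueDiffOn_Icc (zero_lt_one (α := ℝ)) t ht
    have hd := (hZ.differentiableOn (by norm_num) t ht).hasDerivWithinAt
    rw [derivWithin_vec_comp hφ hu (hc.differentiableOn (by norm_num) t ht)] at hd
    obtain ⟨h1, D, h2, h3⟩ := vec_chart hφ (c t)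
    rw [h2.fderiv] at hd
    refine (pow_le_pow_left₀ (norm_nonneg _) (norm_derivWithin_stereo_le hu hd) 2).trans ?_
    refine le_trans (le_of_eq ?_) (velSq_le_resMetric h ha (c t) _)
    rw [div_pow, mul_pow, (h3 _).1, h1]
    norm_num

/-- A point of the sphere corresponding to a point of `ℙ¹`. -/
def lineCoord (L : ℙ ℂ (Fin 2 → ℂ)) : ℂ × ℝ :=
  ((‖L.rep 0‖ ^ 2 + ‖L.rep 1‖ ^ 2)⁻¹ • (L.rep 1 * starRingEnd ℂ (L.rep 0)),
    (‖L.rep 0‖ ^ 2 + ‖L.rep 1‖ ^ 2)⁻¹ * ‖L.rep 0‖ ^ 2)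

theorem sq_add_sq_pos {w : Fin 2 → ℂ} (hw : w ≠ 0) : 0 < ‖w 0‖ ^ 2 + ‖w 1‖ ^ 2 := by
  by_contra! hle
  have h0 := sq_nonneg ‖w 0‖
  have h1 := sq_nonneg ‖w 1‖
  refine hw ?_
  ext i
  fin_cases i
  · simpa using (by linarith : ‖w 0‖ ^ 2 = 0)
  · simpa using (by linarith : ‖w 1‖ ^ 2 = 0)

theorem lineCoord_mk {w : Fin 2 → ℂ} (hw : w ≠ 0) :
    lineCoord (Projectivization.mk ℂ w hw) =
      ((‖w 0‖ ^ 2 + ‖w 1‖ ^ 2)⁻¹ • (w 1 * starRingEnd ℂ (w 0)),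
        (‖w 0‖ ^ 2 + ‖w 1‖ ^ 2)⁻¹ * ‖w 0‖ ^ 2) := by
  obtain ⟨k, hk⟩ := Projectivization.exists_smul_eq_mk_rep ℂ w hw
  have hk0 : ‖(k : ℂ)‖ ≠ 0 := norm_ne_zero_iff.mpr k.ne_zero
  have hpos := sq_add_sq_pos hw
  have e : ∀ i, (Projectivization.mk ℂ w hw).rep i = k * w i := fun i => by rw [← hk]; rfl
  simp only [lineCoord, e, norm_mul, mul_pow, map_mul, ← mul_add]
  refine Prod.ext ?_ ?_
  · have h1 : (k : ℂ) * w 1 * (starRingEnd ℂ k * starRingEnd ℂ (w 0)) =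
        (‖(k : ℂ)‖ ^ 2 : ℝ) • (w 1 * starRingEnd ℂ (w 0)) := by
      rw [← Complex.normSq_eq_norm_sq, Complex.real_smul, ← Complex.mul_conj]; ring
    simp only
    rw [h1, smul_smul]
    congr 1
    field_simp
  · simp only
    field_simp

theorem lineCoord_injective : Function.Injective lineCoord := by
  intro L L' h
  have hw := L.rep_nonzero
  have hw' := L'.rep_nonzero
  have hpos := sq_add_sq_pos hw
  have hpos' := sq_add_sq_pos hw'
  have h1 := congrArg Prod.fst h
  have h2 := congrArg Prod.snd h
  rw [← L.mk_rep, ← L'.mk_rep, Projectivization.mk_eq_mk_iff']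
  simp only [lineCoord] at h1 h2
  set w := L.rep
  set w' := L'.rep
  by_cases h0 : w 0 = 0
  · have h0' : w' 0 = 0 := by
      rw [h0] at h2
      simpa [hpos'.ne'] using h2.symm
    have hw1' : w' 1 ≠ 0 := fun h => hw' (by ext i; fin_cases i <;> simp [h, h0'])
    refine ⟨w 1 / w' 1, ?_⟩
    ext i
    fin_cases i
    · simp [h0, h0']
    · simp [hw1']
  · have h0' : w' 0 ≠ 0 := by
      intro h0'
      rw [h0'] at h2
      simp [hpos.ne', h0] at h2
    refine ⟨w 0 / w' 0, ?_⟩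
    have key : ∀ (x : Fin 2 → ℂ), x ≠ 0 → x 0 ≠ 0 →
        ((‖x 0‖ ^ 2 + ‖x 1‖ ^ 2)⁻¹ • (x 1 * starRingEnd ℂ (x 0))) /
          (((‖x 0‖ ^ 2 + ‖x 1‖ ^ 2)⁻¹ * ‖x 0‖ ^ 2 : ℝ) : ℂ) = x 1 / x 0 := by
      intro x hx hx0
      have hc : starRingEnd ℂ (x 0) ≠ 0 := by simpa using hx0
      have hq : ((‖x 0‖ ^ 2 + ‖x 1‖ ^ 2 : ℝ) : ℂ) ≠ 0 := by
        exact_mod_cast (sq_add_sq_pos hx).ne'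
      rw [Complex.real_smul, Complex.ofReal_mul, Complex.ofReal_inv, ← Complex.normSq_eq_norm_sq,
        ← Complex.mul_conj]
      rw [← Complex.normSq_eq_norm_sq] at hq
      field_simp
    have h3 : w 1 / w 0 = w' 1 / w' 0 := by
      rw [← key w hw h0, ← key w' hw' h0', h1, h2]
    ext i
    fin_cases i
    · simp [h0']
    · simp
      field_simp at h3 ⊢
      rw [h3]

/-- In the second chart the embedding of `ℙ¹` differs from `stereo` by the isometry `(z, s) ↦ (z̄, 1
- s)`. -/
theorem edist_lineCoord_chart {φ : ℂ × ℂ × ℂ → SmallRes} (hφ : φ = chartU ∨ φ = chartV)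
    (p q : ℂ × ℂ × ℂ) :
    edist (lineCoord (φ p).line) (lineCoord (φ q).line) = edist (stereo p.1) (stereo q.1) := by
  rcases hφ with rfl | rfl
  · have e : ∀ p : ℂ × ℂ × ℂ, lineCoord (chartU p).line = stereo p.1 := fun p => by
      simp only [chartU, SmallRes.ofVec]
      rw [lineCoord_mk]
      simp [stereo]
    rw [e, e]
  · have e : ∀ p : ℂ × ℂ × ℂ, lineCoord (chartV p).line =
        (starRingEnd ℂ (stereo p.1).1, 1 - (stereo p.1).2) := fun p => by
      simp only [chartV, SmallRes.ofVec]
      rw [lineCoord_mk]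
      have : (1 + ‖p.1‖ ^ 2) ≠ 0 := by positivity
      refine Prod.ext ?_ ?_
      · simp [stereo, add_comm]
      · simp [stereo, add_comm]
        field_simp
        ring
    rw [e, e, Prod.edist_eq, Prod.edist_eq]
    congr 1
    · simp only
      rw [edist_eq_enorm_sub, edist_eq_enorm_sub, ← map_sub, ← ofReal_norm,
        ← ofReal_norm, Complex.norm_conj]
    · simp only
      rw [edist_sub_left]

/-- Separates points of the zero section, which the vector in `ℂ⁴` cannot distinguish. The constant
blows up as `a → 0`, as the collapse of the zero section requires. -/
theorem edist_lineCoord_le (h : IsCandelasDeLaOssa f κ) (ha : 0 < a) (P Q : SmallRes) :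
    edist (lineCoord P.line) (lineCoord Q.line) ≤
      ENNReal.ofReal (2 / a) * resDist f κ a P Q := by
  refine edist_le_mul_lengthDist (H := fun P : SmallRes => lineCoord P.line) ?_
    ENNReal.ofReal_ne_top ?_ P Q
  · have : 0 < 2 / a := by positivity
    simp only [ne_eq, ENNReal.ofReal_eq_zero]; linarith
  · rintro _ _ _ ⟨φ, c, hφ, hc, rfl, rfl, rfl⟩
    rw [edist_lineCoord_chart hφ]
    have hc1 : ContDiffOn ℝ 1 (fun t => (c t).1) (Icc 0 1) := contDiff_fst.comp_contDiffOn hc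
    refine edist_le_arcLength (G := fun t => stereo (c t).1)
      (contDiff_stereo.comp_contDiffOn hc1) (by positivity) fun t ht => ?_
    have hu := uniqueDiffOn_Icc (zero_lt_one (α := ℝ)) t ht
    have hd : HasDerivWithinAt (fun t => (c t).1) (derivWithin c (Icc 0 1) t).1 (Icc 0 1) t :=
      (hc.differentiableOn (by norm_num) t ht).hasDerivWithinAt.fst
    refine (pow_le_pow_left₀ (norm_nonneg _) (norm_derivWithin_stereo_le hu hd) 2).trans ?_
    refine le_trans (le_of_eq ?_) (fsSq_le_resMetric h ha (c t) _)
    rw [div_pow, mul_pow, fsSq]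
    ring

theorem eq_of_resDist_eq_zero (h : IsCandelasDeLaOssa f κ) (ha : 0 < a) {P Q : SmallRes}
    (hPQ : resDist f κ a P Q = 0) : P = Q := by
  have h1 := edist_stereo_vec_le h ha P Q
  have h2 := edist_lineCoord_le h ha P Q
  rw [hPQ, mul_zero, nonpos_iff_eq_zero, edist_eq_zero] at h1 h2
  obtain ⟨h3, h4⟩ := quadricVec_injective (stereo_injective h1)
  exact SmallRes.ext (lineCoord_injective h2) h3 h4

/-! ### Finiteness and continuity of the distances -/

theorem resDist_ne_top (h : IsCandelasDeLaOssa f κ) (ha : 0 < a) (P Q : SmallRes) :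
    resDist f κ a P Q ≠ ⊤ :=
  ne_top_of_le_ne_top ENNReal.ofReal_ne_top
    (resDist_le_of_radius h ha (le_max_left (radius P) (radius Q)) (le_max_right _ _))

theorem coneDist_ne_top (p q : Cone) : coneDist p q ≠ ⊤ :=
  ne_top_of_le_ne_top ENNReal.ofReal_ne_top
    (coneDist_le_of_radius (le_max_left (coneRadius p.1) (coneRadius q.1)) (le_max_right _ _))

theorem resDist_chart_le (h : IsCandelasDeLaOssa f κ) (ha : 0 < a)
    {φ : ℂ × ℂ × ℂ → SmallRes} (hφ : φ = chartU ∨ φ = chartV) {p q : ℂ × ℂ × ℂ}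
    (hp : ‖p‖ ≤ 1) (hq : ‖q‖ ≤ 1) :
    resDist f κ a (φ p) (φ q) ≤ ENNReal.ofReal (√(10 / a + 3 * a ^ 2) * ‖q - p‖) := by
  refine resDist_line_le h ha hφ (by positivity) fun t ht => ?_
  rw [mul_pow, Real.sq_sqrt (by positivity)]
  have hx : ‖p + t • (q - p)‖ ≤ 1 := by
    have := (convex_closedBall (0 : ℂ × ℂ × ℂ) 1).add_smul_sub_mem (by simpa using hp)
      (by simpa using hq) ht
    simpa using this
  generalize p + t • (q - p) = x at hx
  have h1 : ‖(q - p).1‖ ≤ ‖q - p‖ := norm_fst_le _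
  have h2 : ‖(q - p).2.1‖ ≤ ‖q - p‖ := (norm_fst_le _).trans (norm_snd_le _)
  have h3 : ‖(q - p).2.2‖ ≤ ‖q - p‖ := (norm_snd_le _).trans (norm_snd_le _)
  have x1 : ‖x.1‖ ≤ 1 := (norm_fst_le _).trans hx
  have x2 : ‖x.2.1‖ ≤ 1 := ((norm_fst_le _).trans (norm_snd_le _)).trans hx
  have x3 : ‖x.2.2‖ ≤ 1 := ((norm_snd_le _).trans (norm_snd_le _)).trans hx
  set v := q - p
  have hm : ∀ y z : ℂ, ‖y‖ ≤ ‖v‖ → ‖z‖ ≤ 1 → ‖y * x.1 + z * v.1‖ ^ 2 ≤ 4 * ‖v‖ ^ 2 := by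
    intro y z hy hz
    have : ‖y * x.1 + z * v.1‖ ≤ 2 * ‖v‖ := by
      refine (norm_add_le _ _).trans ?_
      rw [norm_mul, norm_mul]
      have e1 : ‖y‖ * ‖x.1‖ ≤ ‖v‖ * 1 := by gcongr
      have e2 : ‖z‖ * ‖v.1‖ ≤ 1 * ‖v‖ := by gcongr
      linarith
    calc _ ≤ (2 * ‖v‖) ^ 2 := pow_le_pow_left₀ (norm_nonneg _) this 2
      _ = _ := by ring
  -- The four summands of `velSq` contribute `1 + 4 + 1 + 4`.
  have hvel : velSq x v ≤ 10 * ‖v‖ ^ 2 := by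
    have := hm v.2.1 x.2.1 h2 x2
    have := hm v.2.2 x.2.2 h3 x3
    have := pow_le_pow_left₀ (norm_nonneg _) h2 2
    have := pow_le_pow_left₀ (norm_nonneg _) h3 2
    unfold velSq
    linarith
  have hfst : ‖q.1 - p.1‖ ^ 2 ≤ ‖v‖ ^ 2 := pow_le_pow_left₀ (norm_nonneg _) h1 2
  calc velSq x v / a + 3 * a ^ 2 * ‖q.1 - p.1‖ ^ 2
      ≤ 10 * ‖v‖ ^ 2 / a + 3 * a ^ 2 * ‖v‖ ^ 2 := by gcongr
    _ = _ := by ring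

end

/-! ### Gromov-Hausdorff classes -/

/-- Compactness is transported along `π`: `hcont` makes it continuous for the metric topology, so no
separate comparison of topologies on `X` is needed. -/
theorem exists_isClassOf {X K : Type} [TopologicalSpace K] [CompactSpace K] [Nonempty K]
    {π : K → X} (hπ : Function.Surjective π) {d : X → X → ℝ≥0∞} (hself : ∀ x, d x x = 0)
    (hcomm : ∀ x y, d x y = d y x) (htri : ∀ x y z, d x z ≤ d x y + d y z)
    (hfin : ∀ x y, d x y ≠ ⊤) (heq : ∀ x y, d x y = 0 → x = y)
    (hcont : ∀ k₀, Tendsto (fun k => d (π k) (π k₀)) (𝓝 k₀) (𝓝 0)) :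
    ∃ G, IsClassOf G X d := by
  let _ : EMetricSpace X :=
    { edist := d
      edist_self := hself
      edist_comm := hcomm
      edist_triangle := htri
      eq_of_edist_eq_zero := fun {x y} => heq x y }
  let _ : MetricSpace X := EMetricSpace.toMetricSpace hfin
  have hcπ : Continuous π := continuous_iff_continuousAt.mpr fun k₀ =>
    tendsto_iff_edist_tendsto_0.mpr (hcont k₀)
  have : CompactSpace X := hπ.compactSpace hcπ
  have : Nonempty X := Nonempty.map π inferInstance
  obtain ⟨e⟩ := GromovHausdorff.toGHSpace_eq_toGHSpace_iff_isometryEquiv.mp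
    (GromovHausdorff.GHSpace.toGHSpace_rep (GromovHausdorff.toGHSpace X))
  exact ⟨GromovHausdorff.toGHSpace X, e.symm.toEquiv, fun p q => e.symm.edist_eq p q⟩

/-- A surjection with distortion at most `ε` is a Gromov–Hausdorff approximation; the underlying
estimate even gives `ε / 2`. -/
theorem IsClassOf.dist_le {G G' : GromovHausdorff.GHSpace} {X Y : Type} {d : X → X → ℝ≥0∞}
    {d' : Y → Y → ℝ≥0∞} (hG : IsClassOf G X d) (hG' : IsClassOf G' Y d') {Φ : X → Y}
    (hΦ : Function.Surjective Φ) {ε : ℝ} (hε : 0 ≤ ε)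
    (h : ∀ p q, d p q ≤ d' (Φ p) (Φ q) + ENNReal.ofReal ε)
    (h' : ∀ p q, d' (Φ p) (Φ q) ≤ d p q + ENNReal.ofReal ε) : dist G G' ≤ ε := by
  obtain ⟨e, he⟩ := hG
  obtain ⟨e', he'⟩ := hG'
  have key : ∀ x z ε : ℝ≥0∞, x ≠ ⊤ → ε ≠ ⊤ → z ≤ x + ε → z.toReal ≤ x.toReal + ε.toReal := by
    intro x z ε hx hε hz
    rw [← ENNReal.toReal_add hx hε]
    exact ENNReal.toReal_mono (ENNReal.add_ne_top.mpr ⟨hx, hε⟩) hz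
  rw [GromovHausdorff.dist_ghDist]
  have := GromovHausdorff.ghDist_le_of_approx_subsets (s := (univ : Set G.Rep))
    (fun x => e' (Φ (e.symm x))) (ε₁ := 0) (ε₂ := ε) (ε₃ := 0)
    (fun x => ⟨x, mem_univ x, (dist_self x).le⟩)
    (fun y => by
      obtain ⟨x, hx⟩ := hΦ (e'.symm y)
      exact ⟨⟨e x, mem_univ _⟩, by simp [hx]⟩)
    (fun x y => by
      have hx := h (e.symm x) (e.symm y)
      have hx' := h' (e.symm x) (e.symm y)
      rw [← he, ← he', e.apply_symm_apply, e.apply_symm_apply] at hx hx'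
      have h1 := key _ _ _ (edist_ne_top _ _) ENNReal.ofReal_ne_top hx
      have h2 := key _ _ _ (edist_ne_top _ _) ENNReal.ofReal_ne_top hx'
      rw [← dist_edist, ← dist_edist, ENNReal.toReal_ofReal hε] at h1 h2
      rw [abs_sub_le_iff]
      constructor
      · change dist (x : G.Rep) y - _ ≤ _
        linarith
      · change _ - dist (x : G.Rep) y ≤ _
        linarith)
  linarith

/-! ### The compact models -/

/-- A compact set of coordinates which covers the tube in each of the two trivializations. -/
def tubeCoord : Set (ℂ × ℂ × ℂ) := Metric.closedBall 0 1 ∩ {p | sqNorm p ≤ 1}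

theorem isCompact_tubeCoord : IsCompact tubeCoord :=
  (isCompact_closedBall 0 1).inter_right
    (isClosed_le (contDiff_sqNorm (n := 0)).continuous continuous_const)

theorem radius_le_one_iff {φ : ℂ × ℂ × ℂ → SmallRes} (hφ : φ = chartU ∨ φ = chartV)
    (p : ℂ × ℂ × ℂ) : radius (φ p) ≤ 1 ↔ sqNorm p ≤ 1 := by
  rw [← radius_cube hφ, pow_le_one_iff_of_nonneg (radius_nonneg _) (by norm_num)]

/-- The parametrization of the tube by two copies of a compact set. -/
def tubeParam : tubeCoord ⊕ tubeCoord → Tube 1 :=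
  Sum.elim (fun p => ⟨chartU p, (radius_le_one_iff (Or.inl rfl) _).mpr p.2.2⟩)
    (fun p => ⟨chartV p, (radius_le_one_iff (Or.inr rfl) _).mpr p.2.2⟩)

theorem tubeParam_surjective : Function.Surjective tubeParam := by
  rintro ⟨P, hP⟩
  obtain ⟨φ, p, hφ, rfl, hp⟩ := exists_chart P
  have hs : sqNorm p ≤ 1 := (radius_le_one_iff hφ p).mp hP
  have hT : ‖p.2.1‖ ^ 2 + ‖p.2.2‖ ^ 2 ≤ 1 := by
    refine le_trans ?_ hs
    unfold sqNorm
    have : 0 ≤ ‖p.1‖ ^ 2 * (‖p.2.1‖ ^ 2 + ‖p.2.2‖ ^ 2) := by positivity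
    linarith
  have h1 : ‖p.2.1‖ ≤ 1 :=
    (sq_le_one_iff₀ (norm_nonneg _)).mp (by linarith [sq_nonneg ‖p.2.2‖])
  have h2 : ‖p.2.2‖ ≤ 1 :=
    (sq_le_one_iff₀ (norm_nonneg _)).mp (by linarith [sq_nonneg ‖p.2.1‖])
  have hmem : p ∈ tubeCoord := by
    refine ⟨?_, hs⟩
    rw [mem_closedBall_zero_iff, Prod.norm_def, Prod.norm_def]
    exact max_le hp (max_le h1 h2)
  rcases hφ with rfl | rfl
  · exact ⟨Sum.inl ⟨p, hmem⟩, rfl⟩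
  · exact ⟨Sum.inr ⟨p, hmem⟩, rfl⟩

/-- The contraction of the tube onto the disc. -/
def tubeContract (P : Tube 1) : Disc 1 := ⟨P.1.contract, by
  have h : coneRadius P.1.vec ≤ 1 := by rw [coneRadius_vec]; exact P.2
  exact h⟩

theorem tubeContract_surjective : Function.Surjective tubeContract := by
  rintro ⟨z, hz⟩
  obtain ⟨P, hP⟩ := exists_vec_eq z
  refine ⟨⟨P, by rw [← coneRadius_vec, hP]; exact hz⟩, ?_⟩
  exact Subtype.ext (Subtype.ext hP)

section

variable {f : ℝ → ℝ} {κ a : ℝ}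

theorem tendsto_resDist_chart (h : IsCandelasDeLaOssa f κ) (ha : 0 < a)
    {φ : ℂ × ℂ × ℂ → SmallRes} (hφ : φ = chartU ∨ φ = chartV) (p₀ : tubeCoord) :
    Tendsto (fun p : tubeCoord => resDist f κ a (φ p) (φ p₀)) (𝓝 p₀) (𝓝 0) := by
  have hlim : Tendsto (fun p : tubeCoord =>
      ENNReal.ofReal (√(10 / a + 3 * a ^ 2) * ‖(p₀ : ℂ × ℂ × ℂ) - p‖)) (𝓝 p₀) (𝓝 0) := by
    have hc : Continuous fun p : tubeCoord =>
        ENNReal.ofReal (√(10 / a + 3 * a ^ 2) * ‖(p₀ : ℂ × ℂ × ℂ) - p‖) :=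
      ENNReal.continuous_ofReal.comp (by fun_prop)
    simpa using hc.tendsto p₀
  refine tendsto_of_tendsto_of_tendsto_of_le_of_le tendsto_const_nhds hlim (fun _ => bot_le)
    fun p => ?_
  exact resDist_chart_le h ha hφ (mem_closedBall_zero_iff.mp p.2.1)
    (mem_closedBall_zero_iff.mp p₀.2.1)

theorem tendsto_resDist_tubeParam (h : IsCandelasDeLaOssa f κ) (ha : 0 < a)
    (k₀ : tubeCoord ⊕ tubeCoord) :
    Tendsto (fun k => resDist f κ a (tubeParam k).1 (tubeParam k₀).1) (𝓝 k₀) (𝓝 0) := by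
  rcases k₀ with p₀ | p₀
  · rw [nhds_inl, tendsto_map'_iff]
    exact tendsto_resDist_chart h ha (Or.inl rfl) p₀
  · rw [nhds_inr, tendsto_map'_iff]
    exact tendsto_resDist_chart h ha (Or.inr rfl) p₀

theorem tendsto_ofReal_sqrt (b : ℝ) :
    Tendsto (fun a : ℝ => ENNReal.ofReal (6 * √a + b * a)) (𝓝[>] 0) (𝓝 0) := by
  have hc : Continuous fun a : ℝ => ENNReal.ofReal (6 * √a + b * a) :=
    ENNReal.continuous_ofReal.comp (by fun_prop)
  have := (hc.tendsto 0).mono_left (nhdsWithin_le_nhds (s := Ioi 0))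
  simpa using this

/-- Continuity is borrowed from `resDist`: `a` is first fixed so small that the additive error `6√a`
is at most `ε / 2`, and then `k` approaches `k₀`. -/
theorem tendsto_coneDist_tubeParam (h : IsCandelasDeLaOssa f κ) (k₀ : tubeCoord ⊕ tubeCoord) :
    Tendsto (fun k => coneDist (tubeContract (tubeParam k)).1 (tubeContract (tubeParam k₀)).1)
      (𝓝 k₀) (𝓝 0) := by
  rw [ENNReal.tendsto_nhds_zero]
  intro ε hε
  have hε2 : 0 < ε / 2 := ENNReal.half_pos hε.ne'
  obtain ⟨a, ha, ha0⟩ := ((ENNReal.tendsto_nhds_zero.mp (tendsto_ofReal_sqrt 0) _ hε2).and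
    self_mem_nhdsWithin).exists
  rw [zero_mul, add_zero] at ha
  have h1 := ENNReal.Tendsto.const_mul (a := ENNReal.ofReal (1 + 6 * a))
    (tendsto_resDist_tubeParam h ha0 k₀) (Or.inr ENNReal.ofReal_ne_top)
  rw [mul_zero] at h1
  filter_upwards [ENNReal.tendsto_nhds_zero.mp h1 _ hε2] with k hk
  calc _ ≤ _ := coneDist_contract_le h ha0 _ _
    _ ≤ ε / 2 + ε / 2 := add_le_add hk ha
    _ = ε := ENNReal.add_halves ε

/-- Lifts of the two points have `resDist` at most `6√a + 8a` for every `a`. The uniformly Lipschitz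
map `stereo`, with constant `28 = 14(1 + 1)` for `a < 1`, therefore identifies them as `a → 0`. -/
theorem eq_of_coneDist_eq_zero (h : IsCandelasDeLaOssa f κ) {p q : Cone}
    (hpq : coneDist p q = 0) : p = q := by
  obtain ⟨P, hP⟩ := exists_vec_eq p
  obtain ⟨Q, hQ⟩ := exists_vec_eq q
  have eP : P.contract = p := Subtype.ext hP
  have eQ : Q.contract = q := Subtype.ext hQ
  have hle : ∀ a : ℝ, 0 < a → a < 1 → edist (stereo p.1) (stereo q.1) ≤
      ENNReal.ofReal 28 * ENNReal.ofReal (6 * √a + 8 * a) := by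
    intro a ha ha1
    have h1 := edist_stereo_vec_le h ha P Q
    have h2 := resDist_le_coneDist_contract h ha P Q
    rw [eP, eQ, hpq, mul_zero, zero_add] at h2
    rw [hP, hQ] at h1
    refine h1.trans ?_
    gcongr
    linarith
  have h1 := ENNReal.Tendsto.const_mul (a := ENNReal.ofReal 28) (tendsto_ofReal_sqrt 8)
    (Or.inr ENNReal.ofReal_ne_top)
  rw [mul_zero] at h1
  have h2 : edist (stereo p.1) (stereo q.1) ≤ 0 := by
    refine ge_of_tendsto h1 ?_
    filter_upwards [self_mem_nhdsWithin,
      mem_nhdsWithin_of_mem_nhds (Iio_mem_nhds zero_lt_one)] with a ha ha1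
    exact hle a ha ha1
  rw [nonpos_iff_eq_zero, edist_eq_zero] at h2
  exact Subtype.ext (stereo_injective h2)

theorem exists_isClassOf_tube (h : IsCandelasDeLaOssa f κ) (ha : 0 < a) :
    ∃ G, IsClassOf G (Tube 1) (fun p q => resDist f κ a p.1 q.1) := by
  have : CompactSpace tubeCoord := isCompact_iff_compactSpace.mp isCompact_tubeCoord
  have : Nonempty tubeCoord := ⟨⟨0, by simp, by simp [sqNorm]⟩⟩
  exact exists_isClassOf tubeParam_surjective (fun _ => lengthDist_self _)
    (fun _ _ => resDist_comm h ha _ _) (fun _ _ _ => lengthDist_triangle _ _ _)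
    (fun _ _ => resDist_ne_top h ha _ _)
    (fun _ _ hxy => Subtype.ext (eq_of_resDist_eq_zero h ha hxy))
    (tendsto_resDist_tubeParam h ha)

theorem exists_isClassOf_disc (h : IsCandelasDeLaOssa f κ) :
    ∃ G, IsClassOf G (Disc 1) (fun p q => coneDist p.1 q.1) := by
  have : CompactSpace tubeCoord := isCompact_iff_compactSpace.mp isCompact_tubeCoord
  have : Nonempty tubeCoord := ⟨⟨0, by simp, by simp [sqNorm]⟩⟩
  exact exists_isClassOf (tubeContract_surjective.comp tubeParam_surjective)
    (fun _ => lengthDist_self _) (fun _ _ => lengthDist_comm ConeArc.symm _ _)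
    (fun _ _ _ => lengthDist_triangle _ _ _) (fun _ _ => coneDist_ne_top _ _)
    (fun _ _ hxy => Subtype.ext (eq_of_coneDist_eq_zero h hxy))
    (tendsto_coneDist_tubeParam h)

/-- Bounded diameters turn the factor `1 + 6a` into an additive error: `6a · 6 + 6√a + 8a` in one
direction and `6a(6 + 8a) + 6√a` in the other, both below the stated bound. -/
theorem dist_tube_disc_le (h : IsCandelasDeLaOssa f κ) (ha : 0 < a)
    {G G₀ : GromovHausdorff.GHSpace}
    (hG : IsClassOf G (Tube 1) (fun p q => resDist f κ a p.1 q.1))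
    (hG₀ : IsClassOf G₀ (Disc 1) (fun p q => coneDist p.1 q.1)) :
    dist G G₀ ≤ 44 * a + 48 * a ^ 2 + 6 * √a := by
  have hsq := Real.sqrt_nonneg a
  refine hG.dist_le hG₀ tubeContract_surjective (by positivity) (fun P Q => ?_) (fun P Q => ?_)
  · have hd : coneDist P.1.contract Q.1.contract ≤ ENNReal.ofReal (6 * 1) :=
      coneDist_le_of_radius (tubeContract P).2 (tubeContract Q).2
    calc resDist f κ a P.1 Q.1 ≤ ENNReal.ofReal (1 + 6 * a) *
          coneDist P.1.contract Q.1.contract + ENNReal.ofReal (6 * √a + 8 * a) :=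
          resDist_le_coneDist_contract h ha _ _
      _ = coneDist P.1.contract Q.1.contract + (ENNReal.ofReal (6 * a) *
          coneDist P.1.contract Q.1.contract + ENNReal.ofReal (6 * √a + 8 * a)) := by
          rw [ENNReal.ofReal_add (by norm_num) (by positivity), ENNReal.ofReal_one]; ring
      _ ≤ coneDist P.1.contract Q.1.contract + (ENNReal.ofReal (6 * a) *
          ENNReal.ofReal (6 * 1) + ENNReal.ofReal (6 * √a + 8 * a)) := by gcongr
      _ ≤ coneDist P.1.contract Q.1.contract +
          ENNReal.ofReal (44 * a + 48 * a ^ 2 + 6 * √a) := by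
          rw [← ENNReal.ofReal_mul (by positivity), ← ENNReal.ofReal_add (by positivity)
            (by positivity)]
          exact add_le_add le_rfl (ENNReal.ofReal_le_ofReal (by nlinarith [sq_nonneg a]))
  · have hd : resDist f κ a P.1 Q.1 ≤ ENNReal.ofReal (6 * 1 + 8 * a) :=
      resDist_le_of_radius h ha P.2 Q.2
    calc coneDist P.1.contract Q.1.contract ≤ ENNReal.ofReal (1 + 6 * a) *
          resDist f κ a P.1 Q.1 + ENNReal.ofReal (6 * √a) := coneDist_contract_le h ha _ _
      _ = resDist f κ a P.1 Q.1 + (ENNReal.ofReal (6 * a) *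
          resDist f κ a P.1 Q.1 + ENNReal.ofReal (6 * √a)) := by
          rw [ENNReal.ofReal_add (by norm_num) (by positivity), ENNReal.ofReal_one]; ring
      _ ≤ resDist f κ a P.1 Q.1 + (ENNReal.ofReal (6 * a) *
          ENNReal.ofReal (6 * 1 + 8 * a) + ENNReal.ofReal (6 * √a)) := by gcongr
      _ ≤ resDist f κ a P.1 Q.1 + ENNReal.ofReal (44 * a + 48 * a ^ 2 + 6 * √a) := by
          rw [← ENNReal.ofReal_mul (by positivity), ← ENNReal.ofReal_add (by positivity)
            (by positivity)]
          exact add_le_add le_rfl (ENNReal.ofReal_le_ofReal (by nlinarith [sq_nonneg a]))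

end

end

end Conifold

/-! ### The convergence theorem -/

theorem mainTheorem3 :
    (∃ (f : ℝ → ℝ) (κ : ℝ), Conifold.IsCandelasDeLaOssa f κ) ∧
    ∀ (f : ℝ → ℝ) (κ : ℝ), Conifold.IsCandelasDeLaOssa f κ →
      ∃ (G : ℝ → GromovHausdorff.GHSpace) (G₀ : GromovHausdorff.GHSpace),
        (∀ a : ℝ, 0 < a →
          Conifold.IsClassOf (G a) (Conifold.Tube 1)
            (fun p q => Conifold.resDist f κ a p.1 q.1)) ∧
        Conifold.IsClassOf G₀ (Conifold.Disc 1) (fun p q => Conifold.coneDist p.1 q.1) ∧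
        Tendsto G (𝓝[>] 0) (𝓝 G₀) := by
  refine ⟨Conifold.exists_isCandelasDeLaOssa, fun f κ h => ?_⟩
  have hex : ∀ a : ℝ, ∃ G, 0 < a → Conifold.IsClassOf G (Conifold.Tube 1)
      (fun p q => Conifold.resDist f κ a p.1 q.1) := fun a => by
    by_cases ha : 0 < a
    · obtain ⟨G, hG⟩ := Conifold.exists_isClassOf_tube h ha
      exact ⟨G, fun _ => hG⟩
    -- Values at `a ≤ 0` are immaterial, the limit being taken from the right.
    · exact ⟨default, fun h' => absurd h' ha⟩
  choose G hG using hex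
  obtain ⟨G₀, hG₀⟩ := Conifold.exists_isClassOf_disc h
  refine ⟨G, G₀, hG, hG₀, ?_⟩
  rw [tendsto_iff_dist_tendsto_zero]
  have hlim : Tendsto (fun a : ℝ => 44 * a + 48 * a ^ 2 + 6 * √a) (𝓝[>] 0) (𝓝 0) := by
    have hc : Continuous fun a : ℝ => 44 * a + 48 * a ^ 2 + 6 * √a := by fun_prop
    simpa using (hc.tendsto 0).mono_left (nhdsWithin_le_nhds (s := Ioi 0))
  refine tendsto_of_tendsto_of_tendsto_of_le_of_le' tendsto_const_nhds hlim
    (Eventually.of_forall fun _ => dist_nonneg) ?_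
  filter_upwards [self_mem_nhdsWithin] with a ha
  exact Conifold.dist_tube_disc_le h ha (hG a ha) hG₀
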